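/- Let $S=\mathbb{C}[x,y,z]$. For a reduced plane curve $\mathcal B\subset\mathbb P^2=\mathbb P^2(\mathbb C)$ with homogeneous equation $f\in S$, let $\mathrm{AR}(\mathcal B)=\{(a,b,c)\in S^3 \mid a\,\partial_x f+b\,\partial_y f+c\,\partial_z f=0\}$ be the $S$-module of Jacobian syzygies. A conic-line arrangement is a reduced plane curve all of whose irreducible components are lines or smooth conics. Two reduced plane curves have the same combinatorics if there are a degree-preserving bijection $\varphi$ between their irreducible components, a bijection $\psi$ between their singular points, and, for each singular point $P$ of the first curve, a homeomorphism from a neighbourhood of $P$ in $\mathbb P^2$ to a neighbourhood of $\psi(P)$, with $P\mapsto\psi(P)$, that maps the germ of each irreducible component $C$ onto the germ of $\varphi(C)$. They form a strong Ziegler pair if they have the same combinatorics but non-isomorphic modules $\mathrm{AR}$. Here non-isomorphic is meant in the strong sense that there is no additive bijection $e:\mathrm{AR}(\mathcal B_1)\to\mathrm{AR}(\mathcal B_2)$ and ring automorphism $\sigma$ of $S$ with $e(rm)=\sigma(r)e(m)$ for all $r\in S$, $m\in\mathrm{AR}(\mathcal B_1)$; in particular there is no isomorphism of $S$-modules, graded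 or not, even after a projective change of coordinates. We write $A\pitchfork B$ if $A$ and $B$ are smooth with distinct tangent lines at each point of $A\cap B$. Below, $C,C_1,C_2,D$ are smooth conics, $L_i,M,M_i$ are lines, and the components of an arrangement are distinct. * $\mathrm{Cmb}_{123}$: $C+D+L_1+L_2+M$, where $C\pitchfork(L_1+L_2)$, $L_1\cap L_2\cap C=\emptyset$, $D\pitchfork M$; $D$ is tangent to $C$ at exactly one point, which is not on $L_1$, and $D$ is tangent to $L_2$; $C\cap D\cap L_1$ consists of two points; $M$ passes through $L_1\cap L_2$ and is tangent to $C$. * $\mathrm{Cmb}_{124}$: $C+D+L_1+L_2+M$, where $C\pitchfork(L_1+L_2)$, $L_1\cap L_2\cap C=\emptyset$, $D\pitchfork M$; $D$ is tangent to $C$ at two points, and tangent to each of $L_1$, $L_2$ at a point not on $C$; $M$ passes through a point of $L_1\cap C$ and a point of $L_2\cap C$. * $\mathrm{Cmb}_{212}$: $C_1+C_2+M_1+M_2+M_3$, where $C_1\pitchfork C_2$; $M_1,M_2,M_3$ are not concurrent; $M_1\cap C_1\cap C_2$ consists of two points; $M_2$ and $M_3$ are each tangent to both $C_1$ and $C_2$.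 * $\mathrm{Cmb}_{224}$: $C_1+C_2+D+M$, where $C_1\pitchfork C_2$; $D$ is tangent to $C_1$ at two points and to $C_2$ at two points; $M\cap C_1\cap C_2$ consists of two points; $M\pitchfork D$. * $\mathrm{Cmb}_{223}$ plus another bitangent: $C_1+C_2+D+M_i+M_j$, where $C_1\pitchfork C_2$; $D$ passes through exactly two points of $C_1\cap C_2$, is tangent to $C_1$ at a point not on $C_2$, and is tangent to $C_2$ at a point not on $C_1$; $M_1,\dots,M_4$ are the four common tangent lines of $C_1$ and $C_2$, and $i\neq j$; $M_i\pitchfork D$, $M_j\pitchfork D$; $C_l\cap M_k\cap D=\emptyset$ for $l=1,2$ and $k=1,\dots,4$; $D\cap M_i\cap M_j=\emptyset$. **Theorem.** (i) For each of the combinatorics $\mathrm{Cmb}_{123}$, $\mathrm{Cmb}_{124}$, $\mathrm{Cmb}_{212}$ and $\mathrm{Cmb}_{224}$ there is a strong Ziegler pair of conic-line arrangements of degree $7$, both members of which have this combinatorics. (ii) There is a strong Ziegler pair of conic-line arrangements of degree $8$, both members of which have the combinatorics $\mathrm{Cmb}_{223}$ plus another bitangent. -/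

import Mathlib

open MvPolynomial

/-! ## Plane curves -/

/-- The polynomial ring `S = ℂ[x, y, z]`. -/
abbrev PolyS : Type := MvPolynomial (Fin 3) ℂ

/-- The complex projective plane. -/
abbrev PP2 : Type := Projectivization ℂ (Fin 3 → ℂ)

/-- The usual topology of the complex projective plane: the quotient topology from `ℂ³ ∖ {0}`. -/
noncomputable instance instTopologicalSpacePP2 : TopologicalSpace PP2 :=
  TopologicalSpace.coinduced
    (fun v : {v : Fin 3 → ℂ // v ≠ 0} => Projectivization.mk ℂ v.1 v.2) inferInstance

/-- The zero set in `ℙ²` of `F` (used for homogeneous `F` only, where the choice of the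
homogeneous coordinates `p.rep` of `p` does not matter). -/
def locus (F : PolyS) : Set PP2 := {p | eval p.rep F = 0}

/-- The gradient of `F` at (chosen homogeneous coordinates of) `p`. For homogeneous `F`, other
coordinates multiply it by a nonzero constant. -/
noncomputable def gradAt (F : PolyS) (p : PP2) : Fin 3 → ℂ := fun i => eval p.rep (pderiv i F)

/-- The singular points of the curve `F = 0`. -/
def singLocus (F : PolyS) : Set PP2 := {p | p ∈ locus F ∧ gradAt F p = 0}

/-- `F` is a homogeneous equation of degree `d` of a reduced plane curve of degree `d > 0`. -/
structure IsReducedCurve (d : ℕ) (F : PolyS) : Prop where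
  pos : 0 < d
  homogeneous : F.IsHomogeneous d
  squarefree : Squarefree F

/-- `F` is an equation of a conic-line arrangement of degree `d`: a reduced plane curve of
degree `d`, all of whose irreducible components are lines or (irreducible) conics. -/
structure IsConicLineArrangement (d : ℕ) (F : PolyS) : Prop extends IsReducedCurve d F where
  degree_le_two : ∀ g : PolyS, Irreducible g → g ∣ F → g.totalDegree ≤ 2

/-- `F` is an equation of a line. -/
structure IsLine (F : PolyS) : Prop where
  homogeneous : F.IsHomogeneous 1
  ne_zero : F ≠ 0

/-- `F` is an equation of a smooth conic. -/
structure IsSmoothConic (F : PolyS) : Prop where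
  homogeneous : F.IsHomogeneous 2
  ne_zero : F ≠ 0
  smooth : singLocus F = ∅

/-! ## Jacobian syzygies -/

/-- The `S`-module `AR(F)` of Jacobian syzygies: the `(a, b, c) ∈ S³` with
`a ∂F/∂x + b ∂F/∂y + c ∂F/∂z = 0`. -/
noncomputable def jacobianSyzygies (F : PolyS) : Submodule PolyS (Fin 3 → PolyS) where
  carrier := {a | ∑ i, a i * pderiv i F = 0}
  zero_mem' := by simp
  add_mem' := by
    intro a b ha hb
    simp only [Set.mem_ofPred_eq, Pi.add_apply, add_mul, Finset.sum_add_distrib] at *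
    rw [ha, hb, add_zero]
  smul_mem' := by
    intro c a ha
    simp only [Set.mem_ofPred_eq, Pi.smul_apply, smul_eq_mul, mul_assoc] at *
    rw [← Finset.mul_sum, ha, mul_zero]

/-- `AR(F)` and `AR(G)` are isomorphic as modules, possibly after an automorphism `σ` of `S`.
Here `σ = id` gives the isomorphisms of `S`-modules (graded or not, with or without a shift of
the grading), and linear `σ` are allowed for because a projective change of coordinates
`G = F ∘ A` identifies `AR(F)` with `AR(G)` only up to such a `σ`. -/
def SyzygyModulesIsomorphic (F G : PolyS) : Prop :=
  ∃ (σ : PolyS ≃+* PolyS) (e : jacobianSyzygies F ≃+ jacobianSyzygies G),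
    ∀ (r : PolyS) (m : jacobianSyzygies F), e (r • m) = σ r • e m

/-! ## Combinatorics and strong Ziegler pairs -/

/-- The reduced curves `F = 0` and `G = 0` have the same combinatorics: there are
* a degree-preserving bijection `F' i ↔ G' i` between their irreducible components,
* a bijection `ψ` between their singular points,
* for each singular point `P` a homeomorphism `h` from a neighbourhood of `P` to one of `ψ P`
  that sends the germ at `P` of each component of the first curve to the germ at `ψ P` of the
  corresponding component of the second.

The last condition says that `P` and `ψ P` have the same topological type, by a homeomorphism
whose bijection between the local branches at `P` and at `ψ P` is compatible with the bijection
between the global components containing these branches. -/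
def SameCombinatorics (F G : PolyS) : Prop :=
  ∃ (n : ℕ) (F' G' : Fin n → PolyS),
    F = ∏ i, F' i ∧ G = ∏ i, G' i ∧
    (∀ i, Irreducible (F' i)) ∧ (∀ i, Irreducible (G' i)) ∧
    (∀ i, (F' i).totalDegree = (G' i).totalDegree) ∧
    ∃ ψ : singLocus F ≃ singLocus G, ∀ P : singLocus F,
      ∃ h : OpenPartialHomeomorph PP2 PP2,
        P.1 ∈ h.source ∧ h P.1 = (ψ P).1 ∧
        ∀ i, ∀ x ∈ h.source, x ∈ locus (F' i) ↔ h x ∈ locus (G' i)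

/-- A strong Ziegler pair of reduced plane curves: the combinatorics agree, but the modules of
Jacobian syzygies are not isomorphic. -/
structure IsStrongZieglerPair (F G : PolyS) : Prop where
  left : ∃ d, IsReducedCurve d F
  right : ∃ d, IsReducedCurve d G
  sameCombinatorics : SameCombinatorics F G
  not_isomorphic : ¬ SyzygyModulesIsomorphic F G

/-! ## Relative position of curves -/

/-- `F ⋔ G`: at each common point both curves are smooth, with distinct tangent lines. -/
def Transversal (F G : PolyS) : Prop :=
  ∀ p ∈ locus F ∩ locus G, LinearIndependent ℂ ![gradAt F p, gradAt G p]

/-- The points at which the curves `F` and `G` are tangent: both curves pass through the point,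
are smooth there, and have the same tangent line. -/
def tangencyPoints (F G : PolyS) : Set PP2 :=
  {p | p ∈ locus F ∧ p ∈ locus G ∧ gradAt F p ≠ 0 ∧ gradAt G p ≠ 0 ∧
    ¬ LinearIndependent ℂ ![gradAt F p, gradAt G p]}

/-- `F` is tangent to `G` at some point. -/
def IsTangentTo (F G : PolyS) : Prop := (tangencyPoints F G).Nonempty

/-! ## The combinatorics of the theorem

In each case the components are distinct because the predicates are only used for equations
`F` of reduced curves. -/

/-- `F` is an arrangement with combinatorics `Cmb₁₂₃`. -/
def HasCmb123 (F : PolyS) : Prop :=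
  ∃ C D L₁ L₂ M : PolyS, F = C * D * L₁ * L₂ * M ∧
    IsSmoothConic C ∧ IsSmoothConic D ∧ IsLine L₁ ∧ IsLine L₂ ∧ IsLine M ∧
    -- (i)
    Transversal C (L₁ * L₂) ∧ locus L₁ ∩ locus L₂ ∩ locus C = ∅ ∧ Transversal D M ∧
    -- (ii), the tangency of `C` and `D` being off `L₁`
    (∃ p, tangencyPoints D C = {p} ∧ p ∉ locus L₁) ∧ IsTangentTo D L₂ ∧
    -- (iii)
    (locus C ∩ locus D ∩ locus L₁).ncard = 2 ∧
    -- (iv)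
    locus L₁ ∩ locus L₂ ⊆ locus M ∧ IsTangentTo M C

/-- `F` is an arrangement with combinatorics `Cmb₁₂₄`. -/
def HasCmb124 (F : PolyS) : Prop :=
  ∃ C D L₁ L₂ M : PolyS, F = C * D * L₁ * L₂ * M ∧
    IsSmoothConic C ∧ IsSmoothConic D ∧ IsLine L₁ ∧ IsLine L₂ ∧ IsLine M ∧
    -- (i)
    Transversal C (L₁ * L₂) ∧ locus L₁ ∩ locus L₂ ∩ locus C = ∅ ∧ Transversal D M ∧
    -- (ii)
    (tangencyPoints D C).ncard = 2 ∧
    (tangencyPoints D L₁ \ locus C).Nonempty ∧ (tangencyPoints D L₂ \ locus C).Nonempty ∧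
    -- (iii)
    (locus M ∩ (locus L₁ ∩ locus C)).Nonempty ∧ (locus M ∩ (locus L₂ ∩ locus C)).Nonempty

/-- `F` is an arrangement with combinatorics `Cmb₂₁₂`. -/
def HasCmb212 (F : PolyS) : Prop :=
  ∃ C₁ C₂ M₁ M₂ M₃ : PolyS, F = C₁ * C₂ * M₁ * M₂ * M₃ ∧
    IsSmoothConic C₁ ∧ IsSmoothConic C₂ ∧ IsLine M₁ ∧ IsLine M₂ ∧ IsLine M₃ ∧
    -- (i)
    Transversal C₁ C₂ ∧ locus M₁ ∩ locus M₂ ∩ locus M₃ = ∅ ∧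
    -- (ii)
    (locus M₁ ∩ locus C₁ ∩ locus C₂).ncard = 2 ∧
    IsTangentTo M₂ C₁ ∧ IsTangentTo M₂ C₂ ∧ IsTangentTo M₃ C₁ ∧ IsTangentTo M₃ C₂

/-- `F` is an arrangement with combinatorics `Cmb₂₂₄`. -/
def HasCmb224 (F : PolyS) : Prop :=
  ∃ C₁ C₂ D M : PolyS, F = C₁ * C₂ * D * M ∧
    IsSmoothConic C₁ ∧ IsSmoothConic C₂ ∧ IsSmoothConic D ∧ IsLine M ∧
    -- (i)
    Transversal C₁ C₂ ∧
    (tangencyPoints D C₁).ncard = 2 ∧ (tangencyPoints D C₂).ncard = 2 ∧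
    -- (ii)
    (locus M ∩ locus C₁ ∩ locus C₂).ncard = 2 ∧ Transversal M D

/-- The conics `C₁, C₂, D` and the line `M` are in the position that defines `Cmb₂₂₃`. -/
structure Cmb223Position (C₁ C₂ D M : PolyS) : Prop where
  conic₁ : IsSmoothConic C₁
  conic₂ : IsSmoothConic C₂
  conicD : IsSmoothConic D
  line : IsLine M
  transversal : Transversal C₁ C₂
  through_two : (locus D ∩ (locus C₁ ∩ locus C₂)).ncard = 2
  tangent₁ : (tangencyPoints D C₁ \ locus C₂).Nonempty
  tangent₂ : (tangencyPoints D C₂ \ locus C₁).Nonempty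
  bitangent₁ : IsTangentTo M C₁
  bitangent₂ : IsTangentTo M C₂
  transversalMD : Transversal M D

/-- `F` is an arrangement with the combinatorics `Cmb₂₂₃` plus another bitangent: it consists of
`C₁, C₂, D` and of two of the four bitangents `M 0, …, M 3` of `C₁ + C₂`. -/
def HasCmb223PlusBitangent (F : PolyS) : Prop :=
  ∃ (C₁ C₂ D : PolyS) (M : Fin 4 → PolyS) (i j : Fin 4), i ≠ j ∧
    F = C₁ * C₂ * D * M i * M j ∧
    (∀ k, IsLine (M k) ∧ IsTangentTo (M k) C₁ ∧ IsTangentTo (M k) C₂) ∧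
    (∀ k l, k ≠ l → locus (M k) ≠ locus (M l)) ∧
    Cmb223Position C₁ C₂ D (M i) ∧ Cmb223Position C₁ C₂ D (M j) ∧
    (∀ k, locus C₁ ∩ locus (M k) ∩ locus D = ∅ ∧ locus C₂ ∩ locus (M k) ∩ locus D = ∅) ∧
    locus D ∩ locus (M i) ∩ locus (M j) = ∅

/-- There is a strong Ziegler pair of conic-line arrangements of degree `d`, both of which have
the combinatorics described by `Cmb`. -/
def ExistsStrongZieglerPair (d : ℕ) (Cmb : PolyS → Prop) : Prop :=
  ∃ F G : PolyS, IsConicLineArrangement d F ∧ IsConicLineArrangement d G ∧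
    Cmb F ∧ Cmb G ∧ IsStrongZieglerPair F G

/-! The invariant that separates the members of each pair is `HasThreeGenerators`: whether the
module of Jacobian syzygies is generated by three elements. It survives every additive bijection
that is semilinear over a ring automorphism of `S` (`HasThreeGenerators.of_isomorphic`). For each
combinatorics there are two explicit arrangements with integer coefficients, a special one whose
module has three generators and a generic one whose module has not.

Same combinatorics. All singular points of the ten arrangements are rational. They are nodes,
tacnodes of two branches, or ordinary triple points, and the local topological type of each has no
moduli: explicit coordinate changes bring the germs to a fixed model (`hasLocalModel_node`,
`hasLocalModel_tacnode`, `hasLocalModel_triple`). Hence one table of point types, labelled by the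
components through each point, determines both the combinatorics (`Realizes.sameCombinatorics`) and
the incidence and tangency conditions. Completeness of the list of points follows by intersecting
lines and conics, two conics being cut by a degenerate member of their pencil. The bitangents that
are not components need a separate check.

Three generators (`IsReducedCurve.hasThreeGenerators`). The gradient of a reduced `F` has no common
factor, so the cross product of two syzygies is a polynomial multiple of it. Let three syzygies `ρ
k` satisfy `∑ h k • ρ k = 0`, with `ρ 0 × ρ 1` equal to `c * h 2` times the gradient. Then all three
cross products are `c * h k` times the gradient, and Cramer's rule puts `h k • m` into the span of
the `ρ k` for every syzygy `m`. So the `ρ k` generate wherever some `h k` is nonzero, that is, away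
from the origin. The relations between them are the multiples of `h`, and as `X 0`, `X 1`, `X 2` is
a regular sequence, generation extends over the origin.

No three generators. If there are no syzygies of degree `n`, there are none of lower degree, and the
syzygies of degree `n + 1` inject into the module modulo the maximal ideal. Four independent ones
exclude three generators (`not_hasThreeGenerators_of_four`). The generic member for `Cmb224` needs a
variant (`not_hasThreeGenerators_of_point`): three independent syzygies of lowest degree would
already generate near the origin, yet at a certain point a further syzygy lies outside the span of
their values.

All polynomial identities are checked on lists of integers. The absence of syzygies is linear
algebra: the conditions imposed by sufficiently many integer points form a square matrix that is
invertible modulo 97. -/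

/-! ## Integer forms as nested coefficient lists -/

section CoeffList

variable {A R : Type*} [CommRing R]

/-- Horner evaluation of a coefficient list, the coefficients being interpreted by `ι`. -/
def horner (ι : A → R) (t : R) : List A → R
  | [] => 0
  | a :: l => ι a + t * horner ι t l

/-- Sum of two coefficient lists. -/
def listAdd (add : A → A → A) : List A → List A → List A
  | [], m => m
  | a :: l, [] => a :: l
  | a :: l, b :: m => add a b :: listAdd add l m

/-- Product of two coefficient lists. -/
def listMul (zero : A) (add mul : A → A → A) : List A → List A → List A
  | [], _ => []
  | a :: l, m => listAdd add (m.map (mul a)) (zero :: listMul zero add mul l m)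

/-- The coefficients are abstract, with an interpretation `ι`, so that the lemma can be applied to
itself: taking a Horner evaluation for `ι` treats lists of lists, that is, polynomials in two
variables. -/
theorem horner_listAdd {ι : A → R} {add : A → A → A} (h : ∀ a b, ι (add a b) = ι a + ι b) (t : R) :
    ∀ l m, horner ι t (listAdd add l m) = horner ι t l + horner ι t m
  | [], m => by simp [listAdd, horner]
  | a :: l, [] => by simp [listAdd, horner]
  | a :: l, b :: m => by
    simp only [listAdd, horner, h, horner_listAdd h t l m]
    ring

theorem horner_map_mul {ι : A → R} {mul : A → A → A} (h : ∀ a b, ι (mul a b) = ι a * ι b) (t : R)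
    (a : A) : ∀ l, horner ι t (l.map (mul a)) = ι a * horner ι t l
  | [] => by simp [horner]
  | b :: l => by
    simp only [List.map, horner, h, horner_map_mul h t a l]
    ring

theorem horner_listMul {ι : A → R} {zero : A} {add mul : A → A → A} (h0 : ι zero = 0)
    (ha : ∀ a b, ι (add a b) = ι a + ι b) (hm : ∀ a b, ι (mul a b) = ι a * ι b) (t : R) :
    ∀ l m, horner ι t (listMul zero add mul l m) = horner ι t l * horner ι t m
  | [], m => by simp [listMul, horner]
  | a :: l, m => by
    rw [listMul, horner_listAdd ha, horner_map_mul hm]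
    simp only [horner, horner_listMul h0 ha hm t l m, h0]
    ring

/-- Sums and products of lists are not trimmed, so the zero polynomial has many representatives.
This is why the entries are tested instead of the list being compared with `[]`. -/
theorem horner_eq_zero {ι : A → R} {isZero : A → Bool} (h : ∀ a, isZero a = true → ι a = 0)
    (t : R) :
    ∀ l : List A, l.all isZero = true → horner ι t l = 0
  | [], _ => rfl
  | a :: l, hl => by
    simp only [List.all_cons, Bool.and_eq_true] at hl
    rw [horner, h a hl.1, horner_eq_zero h t l hl.2]
    simp

/-- A ternary form with integer coefficients, its degree being known from the context:
entry `i, j` is the coefficient of `x ^ i * y ^ j`, times a power of `z`. -/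
abbrev CoeffList : Type := List (List ℤ)

namespace CoeffList

def add1 : List ℤ → List ℤ → List ℤ := listAdd Int.add
def mul1 : List ℤ → List ℤ → List ℤ := listMul 0 Int.add Int.mul

/-- Sum of forms. -/
def add : CoeffList → CoeffList → CoeffList := listAdd add1

/-- Product of forms. -/
def mul : CoeffList → CoeffList → CoeffList := listMul [] add1 mul1

/-- Negative of a form. -/
def neg (p : CoeffList) : CoeffList := p.map fun q => q.map Int.neg

/-- Whether all coefficients vanish. -/
def isZero (p : CoeffList) : Bool := p.all fun r => r.all fun a => a == 0

/-- The value of the dehomogenized form at `(x, y)`. -/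
def value (x y : R) (p : CoeffList) : R := horner (horner (Int.cast : ℤ → R) y) x p

theorem value_add (x y : R) (p q : CoeffList) : value x y (add p q) = value x y p + value x y q :=
  horner_listAdd (horner_listAdd Int.cast_add y) x p q

theorem value_mul (x y : R) (p q : CoeffList) :
    value x y (mul p q) = value x y p * value x y q := by
  have h1 : ∀ a b, horner (Int.cast : ℤ → R) y (mul1 a b) =
      horner Int.cast y a * horner Int.cast y b :=
    horner_listMul Int.cast_zero Int.cast_add Int.cast_mul y
  have a1 : ∀ a b, horner (Int.cast : ℤ → R) y (add1 a b) =
      horner Int.cast y a + horner Int.cast y b :=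
    horner_listAdd Int.cast_add y
  exact horner_listMul (ι := horner Int.cast y) rfl a1 h1 x p q

theorem horner_map_neg {ι : A → R} {neg : A → A} (h : ∀ a, ι (neg a) = -ι a) (t : R) :
    ∀ l, horner ι t (l.map neg) = -horner ι t l
  | [] => by simp [horner]
  | a :: l => by
    simp only [List.map, horner, h, horner_map_neg h t l]
    ring

theorem value_neg (x y : R) (p : CoeffList) : value x y (neg p) = -value x y p :=
  horner_map_neg (horner_map_neg Int.cast_neg y) x p

theorem value_eq_zero (x y : R) {p : CoeffList} (h : isZero p = true) : value x y p = 0 := by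
  have h1 : ∀ r : List ℤ, r.all (· == 0) = true → horner (Int.cast : ℤ → R) y r = 0 :=
    horner_eq_zero (fun a ha => by rw [beq_iff_eq.mp ha, Int.cast_zero]) y
  exact horner_eq_zero h1 x p h

/-- The binary form of degree `d` in `y, z` with the given coefficients. -/
def binaryForm (y z : R) : ℕ → List ℤ → R
  | _, [] => 0
  | 0, a :: _ => a
  | d + 1, a :: l => a * z ^ (d + 1) + y * binaryForm y z d l

/-- The ternary form of degree `d` in `x, y, z` with the given coefficients. -/
def form (x y z : R) : ℕ → CoeffList → R
  | _, [] => 0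
  | 0, a :: _ => binaryForm y z 0 a
  | d + 1, a :: l => binaryForm y z (d + 1) a + x * form x y z d l

/-- Whether a coefficient list has no entries beyond those of a form of degree `d`. -/
def fits : ℕ → CoeffList → Bool
  | _, [] => true
  | 0, a :: l => a.length ≤ 1 && l.isEmpty
  | d + 1, a :: l => a.length ≤ d + 2 && fits d l

/-- The bound on the length matters: `binaryForm` drops coefficients beyond the degree, whereas
`horner` keeps them. -/
theorem binaryForm_one (y : R) : ∀ (d : ℕ) (l : List ℤ), l.length ≤ d + 1 →
    binaryForm y 1 d l = horner Int.cast y l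
  | d, [], _ => by cases d <;> rfl
  | 0, a :: l, h => by
    obtain rfl : l = [] := by
      rw [← List.length_eq_zero_iff]
      simpa using h
    simp [binaryForm, horner]
  | d + 1, a :: l, h => by
    rw [binaryForm, horner, binaryForm_one y d l (by simpa using h)]
    simp

theorem form_one (x y : R) : ∀ (d : ℕ) (p : CoeffList), fits d p = true →
    form x y 1 d p = value x y p
  | d, [], _ => by cases d <;> rfl
  | 0, a :: l, h => by
    simp only [fits, Bool.and_eq_true, decide_eq_true_eq, List.isEmpty_iff] at h
    rw [form, binaryForm_one y 0 a h.1, h.2]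
    simp [value, horner]
  | d + 1, a :: l, h => by
    simp only [fits, Bool.and_eq_true, decide_eq_true_eq] at h
    rw [form, form_one x y d l h.2, binaryForm_one y _ a h.1]
    rfl

theorem map_binaryForm {S : Type*} [CommRing S] (φ : R →+* S) (y z : R) : ∀ (d : ℕ) (l : List ℤ),
    φ (binaryForm y z d l) = binaryForm (φ y) (φ z) d l
  | d, [] => by cases d <;> simp [binaryForm]
  | 0, a :: l => by simp [binaryForm]
  | d + 1, a :: l => by simp [binaryForm, map_binaryForm φ y z d l]

theorem map_form {S : Type*} [CommRing S] (φ : R →+* S) (x y z : R) : ∀ (d : ℕ) (p : CoeffList),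
    φ (form x y z d p) = form (φ x) (φ y) (φ z) d p
  | d, [] => by cases d <;> simp [form]
  | 0, a :: l => by simp [form, map_binaryForm]
  | d + 1, a :: l => by simp [form, map_binaryForm, map_form φ x y z d l]

/-- The form as an element of `ℂ[x, y, z]`. -/
noncomputable def toPoly (d : ℕ) (p : CoeffList) : PolyS := form (X 0) (X 1) (X 2) d p

theorem eval_toPoly (v : Fin 3 → ℂ) (d : ℕ) (p : CoeffList) :
    eval v (toPoly d p) = form (v 0) (v 1) (v 2) d p := by
  rw [toPoly, map_form]
  simp

theorem eval_toPoly_intCast (v : Fin 3 → ℤ) (d : ℕ) (p : CoeffList) :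
    eval (fun i => (v i : ℂ)) (toPoly d p) = ((form (v 0) (v 1) (v 2) d p : ℤ) : ℂ) := by
  rw [eval_toPoly]
  exact (map_form (Int.castRingHom ℂ) _ _ _ d p).symm

theorem isHomogeneous_binaryForm : ∀ (d : ℕ) (l : List ℤ),
    (binaryForm (X 1) (X 2) d l : PolyS).IsHomogeneous d
  | d, [] => by cases d <;> exact isHomogeneous_zero _ _ _
  | 0, a :: l => by simpa [binaryForm] using isHomogeneous_C (Fin 3) (a : ℂ)
  | d + 1, a :: l => by
    refine IsHomogeneous.add ?_ ?_
    · simpa using isHomogeneous_C_mul_X_pow (a : ℂ) (2 : Fin 3) (d + 1)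
    · rw [add_comm d 1]
      exact (isHomogeneous_X _ _).mul (isHomogeneous_binaryForm d l)

theorem isHomogeneous_toPoly : ∀ (d : ℕ) (p : CoeffList), (toPoly d p).IsHomogeneous d
  | d, [] => by cases d <;> exact isHomogeneous_zero _ _ _
  | 0, a :: l => isHomogeneous_binaryForm 0 a
  | d + 1, a :: l => by
    refine (isHomogeneous_binaryForm (d + 1) a).add ?_
    rw [add_comm d 1]
    exact (isHomogeneous_X _ _).mul (isHomogeneous_toPoly d l)

theorem eval_toPoly_one (x y : ℂ) {d : ℕ} {p : CoeffList} (h : fits d p = true) :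
    eval ![x, y, 1] (toPoly d p) = value x y p := by
  rw [eval_toPoly, ← form_one x y d p h]
  rfl

end CoeffList

end CoeffList

/-! ### Homogeneous polynomials and their dehomogenizations. -/

theorem eval_smul_of_isHomogeneous {F : PolyS} {d : ℕ} (hF : F.IsHomogeneous d) (a : ℂ)
    (v : Fin 3 → ℂ) : eval (a • v) F = a ^ d * eval v F := by
  rw [eval_eq, eval_eq, Finset.mul_sum]
  refine Finset.sum_congr rfl fun m hm => ?_
  have hd : ∑ i ∈ m.support, m i = d := (hF.degree_eq_sum_deg_support hm).symm
  simp only [Pi.smul_apply, smul_eq_mul, mul_pow, Finset.prod_mul_distrib,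
    Finset.prod_pow_eq_pow_sum, hd]
  ring

/-- A form vanishes if its dehomogenization does. -/
theorem eq_zero_of_eval_one {F : PolyS} {d : ℕ} (hF : F.IsHomogeneous d)
    (h : ∀ x y : ℂ, eval ![x, y, 1] F = 0) : F = 0 := by
  -- The factor `X 2` takes care of the line at infinity; it is cancelled at the end.
  have hz : (X 2 : PolyS) * F = 0 := by
    refine MvPolynomial.funext fun v => ?_
    by_cases h2 : v 2 = 0
    · simp [h2]
    · have hv : v = v 2 • ![v 0 / v 2, v 1 / v 2, 1] := by
        ext i
        fin_cases i <;> simp [mul_div_cancel₀, h2]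
      rw [map_mul, map_zero, hv, eval_smul_of_isHomogeneous hF, h]
      simp
  exact (mul_eq_zero.mp hz).resolve_left (X_ne_zero 2)

/-! ## Divisibility in `ℂ[x, y, z]` -/

/-- Induction on the irreducible factors of `a`: each of them fails to divide some `f i`, hence
divides `b`, and can be cancelled from both sides. -/
theorem dvd_of_forall_dvd_mul {ι R : Type*} [CommRing R] [IsDomain R] [UniqueFactorizationMonoid R]
    {f : ι → R} (h0 : ∃ i, f i ≠ 0) (hf : ∀ p, Irreducible p → ¬ ∀ i, p ∣ f i) (a : R) :
    ∀ b, (∀ i, a ∣ b * f i) → a ∣ b := by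
  refine WfDvdMonoid.induction_on_irreducible a ?_ ?_ ?_
  · intro b hb
    obtain ⟨i, hi⟩ := h0
    exact zero_dvd_iff.mpr ((mul_eq_zero.mp (zero_dvd_iff.mp (hb i))).resolve_right hi)
  · exact fun u hu b _ => hu.dvd
  · intro a p ha hp ih b hb
    obtain ⟨i, hi⟩ := not_forall.mp (hf p hp)
    have hpb : p ∣ b := (hp.prime.dvd_or_dvd ((dvd_mul_right p a).trans (hb i))).resolve_right hi
    obtain ⟨b, rfl⟩ := hpb
    refine mul_dvd_mul_left p (ih b fun j => ?_)
    have := hb j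
    rw [mul_assoc] at this
    exact (mul_dvd_mul_iff_left hp.ne_zero).mp this

/-- A vector that is proportional to a primitive vector over the fraction field is a multiple of it
over the ring: `f i` divides `w i * f j` for all `j`, hence divides `w i`. -/
theorem exists_eq_mul_of_proportional {ι R : Type*} [CommRing R] [IsDomain R]
    [UniqueFactorizationMonoid R] {f w : ι → R} (h0 : ∃ i, f i ≠ 0)
    (hf : ∀ p, Irreducible p → ¬ ∀ i, p ∣ f i) (hw : ∀ i j, w i * f j = w j * f i) :
    ∃ g, ∀ i, w i = g * f i := by
  obtain ⟨i, hi⟩ := h0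
  obtain ⟨g, hg⟩ := dvd_of_forall_dvd_mul ⟨i, hi⟩ hf (f i) (w i)
    fun j => ⟨w j, by rw [hw i j, mul_comm]⟩
  refine ⟨g, fun j => mul_right_cancel₀ hi ?_⟩
  rw [← hw i j, hg]
  ring

theorem totalDegree_pderiv_lt {p : PolyS} {i : Fin 3} (h : pderiv i p ≠ 0) :
    (pderiv i p).totalDegree < p.totalDegree := by
  have hle : ∀ m ∈ (pderiv i p).support, (m.sum fun _ e => e) + 1 ≤ p.totalDegree := by
    intro m hm
    rw [mem_support_iff, coeff_pderiv] at hm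
    have := le_totalDegree (mem_support_iff.mpr (left_ne_zero_of_mul hm))
    rwa [Finsupp.sum_add_index' (by simp) (by simp), Finsupp.sum_single_index rfl] at this
  obtain ⟨m, hm⟩ := Finset.nonempty_of_ne_empty (mt support_eq_empty.mp h)
  have hp : 0 < p.totalDegree := by have := hle m hm; omega
  rw [totalDegree, Finset.sup_lt_iff (by simpa using hp)]
  exact fun m hm => hle m hm

/-- By degree, `p` can divide its derivatives only if they vanish. In characteristic zero every
nonconstant monomial survives in some derivative, so `p` would be constant. -/
theorem not_dvd_all_pderiv_self {p : PolyS} (hp : Irreducible p) : ¬ ∀ i, p ∣ pderiv i p := by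
  intro h
  have h0 : ∀ i, pderiv i p = 0 := by
    intro i
    by_contra hi
    obtain ⟨q, hq⟩ := h i
    have hq0 : q ≠ 0 := by
      rintro rfl
      exact hi (by rw [hq, mul_zero])
    have := totalDegree_pderiv_lt hi
    rw [hq, totalDegree_mul_of_isDomain hp.ne_zero hq0] at this
    omega
  have hC : p = C (coeff 0 p) := by
    ext m
    rw [coeff_C]
    split_ifs with hm
    · rw [hm]
    · obtain ⟨i, hi⟩ : ∃ i, m i ≠ 0 := by
        by_contra! hc
        exact hm (Finsupp.ext fun i => (hc i).symm)
      have hle : Finsupp.single i 1 ≤ m := Finsupp.single_le_iff.mpr (Nat.one_le_iff_ne_zero.mpr hi)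
      have := congrArg (coeff (m - Finsupp.single i 1)) (h0 i)
      rw [coeff_pderiv, tsub_add_cancel_of_le hle, coeff_zero] at this
      exact (mul_eq_zero.mp this).resolve_right (Nat.cast_add_one_ne_zero _)
  have hc0 : coeff 0 p ≠ 0 := by
    intro hc
    rw [hc, C_0] at hC
    exact hp.ne_zero hC
  refine hp.not_isUnit ?_
  rw [hC]
  exact (isUnit_iff_ne_zero.mpr hc0).map C

/-- The partial derivatives of the equation of a reduced curve have no common factor. -/
theorem IsReducedCurve.not_dvd_all_pderiv {d : ℕ} {F : PolyS} (hF : IsReducedCurve d F)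
    (p : PolyS) (hp : Irreducible p) : ¬ ∀ i, p ∣ pderiv i F := by
  intro h
  -- Euler's formula: `p` divides `d • F`, and `d` is a unit.
  have hpF : p ∣ F := by
    have hdvd : p ∣ d • F := by
      rw [← hF.homogeneous.sum_X_mul_pderiv]
      exact Finset.dvd_sum fun i _ => (h i).mul_left _
    rw [nsmul_eq_mul] at hdvd
    refine (hp.prime.dvd_or_dvd hdvd).resolve_left fun hd =>
      hp.not_isUnit (isUnit_of_dvd_unit hd ?_)
    have : IsUnit (C (d : ℂ) : PolyS) :=
      (isUnit_iff_ne_zero.mpr (Nat.cast_ne_zero.mpr hF.pos.ne')).map C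
    simpa using this
  obtain ⟨g, rfl⟩ := hpF
  have hg : ¬ p ∣ g := fun ⟨k, hk⟩ => hp.not_isUnit (hF.squarefree p ⟨k, by rw [hk]; ring⟩)
  -- With `F = p * g`, the product rule shows that `p` divides `g * pderiv i p`, and it does not
  -- divide `g` because `F` is squarefree.
  refine not_dvd_all_pderiv_self hp fun i => ?_
  have := h i
  rw [Derivation.leibniz, smul_eq_mul, smul_eq_mul,
    dvd_add_right (Dvd.intro _ rfl)] at this
  exact (hp.prime.dvd_or_dvd this).resolve_left hg

theorem IsReducedCurve.exists_pderiv_ne_zero {d : ℕ} {F : PolyS} (hF : IsReducedCurve d F) :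
    ∃ i, pderiv i F ≠ 0 := by
  by_contra! h
  exact hF.not_dvd_all_pderiv (X 0) (X_prime).irreducible fun i => by simp [h i]

/-! ## Syzygies -/

theorem mem_jacobianSyzygies {F : PolyS} {a : Fin 3 → PolyS} :
    a ∈ jacobianSyzygies F ↔ a 0 * pderiv 0 F + a 1 * pderiv 1 F + a 2 * pderiv 2 F = 0 := by
  change ∑ i, a i * pderiv i F = 0 ↔ _
  rw [Fin.sum_univ_three]

/-- The coordinates of the cross product, up to a cyclic numbering. -/
def crossAt {R : Type*} [CommRing R] (u v : Fin 3 → R) (i : Fin 3) : R :=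
  u (i + 1) * v (i + 2) - u (i + 2) * v (i + 1)

/-- Both `u` and `v` are orthogonal to `f`, so their cross product is parallel to `f`. -/
theorem crossAt_mul_comm {R : Type*} [CommRing R] {u v f : Fin 3 → R}
    (hu : u 0 * f 0 + u 1 * f 1 + u 2 * f 2 = 0) (hv : v 0 * f 0 + v 1 * f 1 + v 2 * f 2 = 0)
    (i j : Fin 3) : crossAt u v i * f j = crossAt u v j * f i := by
  have h01 : crossAt u v 0 * f 1 = crossAt u v 1 * f 0 := by
    simp only [crossAt, Fin.isValue, Fin.reduceAdd]
    linear_combination v 2 * hu - u 2 * hv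
  have h02 : crossAt u v 0 * f 2 = crossAt u v 2 * f 0 := by
    simp only [crossAt, Fin.isValue, Fin.reduceAdd]
    linear_combination u 1 * hv - v 1 * hu
  have h12 : crossAt u v 1 * f 2 = crossAt u v 2 * f 1 := by
    simp only [crossAt, Fin.isValue, Fin.reduceAdd]
    linear_combination v 0 * hu - u 0 * hv
  revert i j
  simp only [Fin.forall_fin_succ, Fin.isValue]
  simp [h01, h02, h12]

/-- The cross product of two syzygies is a multiple of the gradient. -/
theorem IsReducedCurve.exists_crossAt_eq {d : ℕ} {F : PolyS} (hF : IsReducedCurve d F)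
    {u v : Fin 3 → PolyS} (hu : u ∈ jacobianSyzygies F) (hv : v ∈ jacobianSyzygies F) :
    ∃ g, ∀ i, crossAt u v i = g * pderiv i F :=
  exists_eq_mul_of_proportional (f := fun i => pderiv i F) hF.exists_pderiv_ne_zero
    hF.not_dvd_all_pderiv
    (crossAt_mul_comm (mem_jacobianSyzygies.mp hu) (mem_jacobianSyzygies.mp hv))

/-- The module of Jacobian syzygies is generated by three elements. -/
def HasThreeGenerators (F : PolyS) : Prop :=
  ∃ m : Fin 3 → jacobianSyzygies F, ∀ a, ∃ r : Fin 3 → PolyS, a = ∑ k, r k • m k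

/-- This is the invariance on which all five pairs rest. Generators go to generators, and the twist
by `σ` only changes the coefficients. -/
theorem HasThreeGenerators.of_isomorphic {F G : PolyS} (h : SyzygyModulesIsomorphic F G)
    (hF : HasThreeGenerators F) : HasThreeGenerators G := by
  obtain ⟨σ, e, he⟩ := h
  obtain ⟨m, hm⟩ := hF
  refine ⟨fun k => e (m k), fun b => ?_⟩
  obtain ⟨r, hr⟩ := hm (e.symm b)
  refine ⟨fun k => σ (r k), ?_⟩
  rw [← e.apply_symm_apply b, hr, map_sum]
  exact Finset.sum_congr rfl fun k _ => he _ _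

/-- `X 2` is a nonzerodivisor modulo `X 0 ^ a` and `X 1 ^ b`: membership in a monomial ideal is
tested monomial by monomial, and multiplication by `X 2 ^ e` leaves the exponents of the other
variables alone. -/
theorem mem_span_X_pow_of_X_pow_mul_mem {t : PolyS} {a b e : ℕ}
    (h : X 2 ^ e * t ∈ Ideal.span {(X 0 : PolyS) ^ a, X 1 ^ b}) :
    t ∈ Ideal.span {(X 0 : PolyS) ^ a, X 1 ^ b} := by
  have hs : ({(X 0 : PolyS) ^ a, X 1 ^ b} : Set PolyS) = (fun s => monomial s (1 : ℂ)) ''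
      {Finsupp.single 0 a, Finsupp.single 1 b} := by
    rw [Set.image_pair, X_pow_eq_monomial, X_pow_eq_monomial]
  rw [hs, mem_ideal_span_monomial_image] at h ⊢
  intro m hm
  have hm' : Finsupp.single 2 e + m ∈ (X 2 ^ e * t).support := by
    rw [mem_support_iff, X_pow_eq_monomial, coeff_monomial_mul, one_mul]
    exact mem_support_iff.mp hm
  obtain ⟨s, hs, hle⟩ := h _ hm'
  refine ⟨s, hs, ?_⟩
  rcases hs with rfl | rfl
  · rw [Finsupp.single_le_iff] at hle ⊢
    simpa using hle
  · rw [Finsupp.single_le_iff] at hle ⊢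
    simpa using hle

theorem not_X_dvd_X {i j : Fin 3} (hij : i ≠ j) : ¬ (X i : PolyS) ∣ X j := by
  rintro ⟨q, hq⟩
  have := congrArg (eval (Pi.single j (1 : ℂ))) hq
  simp [Pi.single_eq_of_ne hij] at this

theorem X_pow_dvd_of_dvd_mul {i j : Fin 3} (hij : i ≠ j) {a b : ℕ} {p : PolyS}
    (h : (X i : PolyS) ^ a ∣ X j ^ b * p) : X i ^ a ∣ p :=
  (X_prime).pow_dvd_of_dvd_mul_left a (fun hd => not_X_dvd_X hij ((X_prime).dvd_of_dvd_pow hd)) h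

/-! ## Modules of syzygies with three generators -/

/-- Cramer's rule says that `crossAt u v i * w l + crossAt v w i * u l + crossAt w u i * v l` is the
determinant of `u, v, w` if `i = l`, and zero otherwise. The determinant vanishes because `u × v` is
a multiple of `f` and `w` is orthogonal to `f`. It remains to cancel a nonzero entry of `f`. -/
theorem triple_identity {R : Type*} [CommRing R] [IsDomain R] {u v w f : Fin 3 → R} {a b c : R}
    (hf : ∃ i, f i ≠ 0) (hw : w 0 * f 0 + w 1 * f 1 + w 2 * f 2 = 0)
    (huv : ∀ i, crossAt u v i = a * f i) (hvw : ∀ i, crossAt v w i = b * f i)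
    (hwu : ∀ i, crossAt w u i = c * f i) (l : Fin 3) : a * w l + b * u l + c * v l = 0 := by
  obtain ⟨i, hi⟩ := hf
  refine (mul_eq_zero.mp ?_).resolve_left hi
  have hdet : crossAt u v 0 * w 0 + crossAt u v 1 * w 1 + crossAt u v 2 * w 2 = 0 := by
    rw [huv, huv, huv]
    linear_combination a * hw
  have key : crossAt u v i * w l + crossAt v w i * u l + crossAt w u i * v l = 0 := by
    simp only [crossAt, Fin.isValue, Fin.reduceAdd] at hdet ⊢
    revert i l
    simp only [Fin.forall_fin_succ, Fin.isValue]
    simp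
    refine ⟨⟨?_, ?_, ?_⟩, ⟨?_, ?_, ?_⟩, ⟨?_, ?_, ?_⟩⟩ <;> intro _ <;>
      first | ring1 | linear_combination hdet
  rw [huv, hvw, hwu] at key
  linear_combination key

/-- Three syzygies `ρ k` with a relation `∑ h k • ρ k = 0` generate all syzygies, if `ρ 0 × ρ 1` is
`h 2` times the gradient, up to a constant, and the `h k` have only the trivial common zero. -/
theorem IsReducedCurve.hasThreeGenerators {d : ℕ} {F : PolyS} (hF : IsReducedCurve d F)
    {ρ : Fin 3 → Fin 3 → PolyS} (hρ : ∀ k, ρ k ∈ jacobianSyzygies F) {h : Fin 3 → PolyS}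
    (hrel : ∀ i, h 0 * ρ 0 i + h 1 * ρ 1 i + h 2 * ρ 2 i = 0) {c : ℂ} (hc : c ≠ 0)
    (h2 : h 2 ≠ 0) (hF0 : pderiv 0 F ≠ 0)
    (hcross : ρ 0 1 * ρ 1 2 - ρ 0 2 * ρ 1 1 = C c * h 2 * pderiv 0 F) {a b e : ℕ}
    (h0e : X 0 ^ a ∈ Ideal.span (Set.range h)) (h1e : X 1 ^ b ∈ Ideal.span (Set.range h))
    (h2e : X 2 ^ e ∈ Ideal.span (Set.range h)) : HasThreeGenerators F := by
  have hcu : (C c : PolyS) ≠ 0 := by simpa using hc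
  have hcomb : ∀ q, q ∈ Ideal.span (Set.range h) → ∃ u : Fin 3 → PolyS,
      u 0 * h 0 + u 1 * h 1 + u 2 * h 2 = q := by
    intro q hq
    obtain ⟨u, hu⟩ := Ideal.mem_span_range_iff_exists_fun.mp hq
    exact ⟨u, by rw [← hu, Fin.sum_univ_three]⟩
  -- the pairwise cross products
  have hcop : ∀ p, Irreducible p → ¬ ∀ i, p ∣ h i := by
    intro p hp hdvd
    have hall : ∀ q, q ∈ Ideal.span (Set.range h) → p ∣ q := by
      intro q hq
      obtain ⟨u, rfl⟩ := hcomb q hq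
      exact dvd_add (dvd_add ((hdvd 0).mul_left _) ((hdvd 1).mul_left _)) ((hdvd 2).mul_left _)
    have p0 : p ∣ X 0 := hp.prime.dvd_of_dvd_pow (hall _ h0e)
    have p1 : p ∣ X 1 := hp.prime.dvd_of_dvd_pow (hall _ h1e)
    have : (X 0 : PolyS) ∣ X 1 :=
      (hp.dvd_symm X_prime.irreducible p0).trans p1
    exact not_X_dvd_X (by decide) this
  obtain ⟨g01, hg01⟩ := hF.exists_crossAt_eq (hρ 0) (hρ 1)
  obtain ⟨g12, hg12⟩ := hF.exists_crossAt_eq (hρ 1) (hρ 2)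
  obtain ⟨g20, hg20⟩ := hF.exists_crossAt_eq (hρ 2) (hρ 0)
  have e01 : g01 = C c * h 2 := by
    refine mul_right_cancel₀ hF0 ?_
    rw [← hg01, ← hcross]
    rfl
  have x0 : ∀ k l, crossAt (ρ k) (ρ l) 0 = ρ k 1 * ρ l 2 - ρ k 2 * ρ l 1 := fun _ _ => rfl
  -- The cross product of the relation `hrel` with `ρ 0` gives `h 2 • (ρ 2 × ρ 0) = h 1 • (ρ 0 × ρ
  -- 1)`. One coordinate is enough, since the vectors are known to be multiples of the gradient.
  have e20 : g20 = C c * h 1 := by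
    refine mul_left_cancel₀ h2 (mul_right_cancel₀ hF0 ?_)
    have := hg20 0
    rw [x0] at this
    linear_combination (-h 2) * this + h 1 * hcross + ρ 0 2 * hrel 1 - ρ 0 1 * hrel 2
  have e12 : g12 = C c * h 0 := by
    refine mul_left_cancel₀ h2 (mul_right_cancel₀ hF0 ?_)
    have := hg12 0
    rw [x0] at this
    linear_combination (-h 2) * this + h 0 * hcross - ρ 1 2 * hrel 1 + ρ 1 1 * hrel 2
  rw [e01] at hg01
  rw [e20] at hg20
  rw [e12] at hg12
  -- the relations between the `ρ k` are the multiples of `h`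
  have hrels : ∀ β : Fin 3 → PolyS, (∀ i, β 0 * ρ 0 i + β 1 * ρ 1 i + β 2 * ρ 2 i = 0) →
      ∃ t, ∀ k, β k = t * h k := by
    intro β hβ
    -- The cross product of the relation `β` with `ρ 2`, where `ρ 2 × ρ 0` and `ρ 1 × ρ 2` are `c *
    -- h 1` and `c * h 0` times the gradient.
    have b01 : β 0 * h 1 = β 1 * h 0 := by
      refine mul_left_cancel₀ hcu (mul_right_cancel₀ hF0 ?_)
      have q1 := hg20 0
      have q2 := hg12 0
      rw [x0] at q1 q2
      linear_combination (-β 0) * q1 + β 1 * q2 - ρ 2 2 * hβ 1 + ρ 2 1 * hβ 2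
    have b02 : β 0 * h 2 = β 2 * h 0 := by
      refine mul_left_cancel₀ hcu (mul_right_cancel₀ hF0 ?_)
      have q1 := hg01 0
      have q2 := hg12 0
      rw [x0] at q1 q2
      linear_combination (-β 0) * q1 + β 2 * q2 + ρ 1 2 * hβ 1 - ρ 1 1 * hβ 2
    have b12 : β 1 * h 2 = β 2 * h 1 := by
      refine mul_left_cancel₀ hcu (mul_right_cancel₀ hF0 ?_)
      have q1 := hg01 0
      have q2 := hg20 0
      rw [x0] at q1 q2
      linear_combination (-β 1) * q1 + β 2 * q2 - ρ 0 2 * hβ 1 + ρ 0 1 * hβ 2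
    refine exists_eq_mul_of_proportional ⟨2, h2⟩ hcop ?_
    simp only [Fin.forall_fin_succ, Fin.isValue]
    simp [b01, b02, b12]
  refine ⟨fun k => ⟨ρ k, hρ k⟩, fun ⟨m, hm⟩ => ?_⟩
  -- the multiples of `m` by the ideal of the `h k`
  have hmul : ∀ q, q ∈ Ideal.span (Set.range h) → ∃ α : Fin 3 → PolyS,
      ∀ i, q * m i = α 0 * ρ 0 i + α 1 * ρ 1 i + α 2 * ρ 2 i := by
    obtain ⟨g0, hg0⟩ := hF.exists_crossAt_eq (hρ 0) hm
    obtain ⟨g1, hg1⟩ := hF.exists_crossAt_eq (hρ 1) hm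
    obtain ⟨g2, hg2⟩ := hF.exists_crossAt_eq (hρ 2) hm
    have anti : ∀ {u v : Fin 3 → PolyS} {g : PolyS} {f : Fin 3 → PolyS},
        (∀ i, crossAt u v i = g * f i) → ∀ i, crossAt v u i = (-g) * f i := by
      intro u v g f huv i
      rw [neg_mul, ← huv]
      simp only [crossAt]
      ring
    have hm' := mem_jacobianSyzygies.mp hm
    -- Each of the three identities expresses `c * h k` times `m` by the two `ρ j` with `j ≠ k`.
    have t01 := triple_identity (f := fun i => pderiv i F) ⟨0, hF0⟩ hm' hg01 hg1 (anti hg0)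
    have t12 := triple_identity (f := fun i => pderiv i F) ⟨0, hF0⟩ hm' hg12 hg2 (anti hg1)
    have t20 := triple_identity (f := fun i => pderiv i F) ⟨0, hF0⟩ hm' hg20 hg0 (anti hg2)
    intro q hq
    obtain ⟨u, rfl⟩ := hcomb q hq
    have hinv : C c⁻¹ * C c = (1 : PolyS) := by
      rw [← C_mul, inv_mul_cancel₀ hc, C_1]
    refine ⟨![C c⁻¹ * (u 1 * g2 - u 2 * g1), C c⁻¹ * (u 2 * g0 - u 0 * g2),
      C c⁻¹ * (u 0 * g1 - u 1 * g0)], fun i => ?_⟩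
    simp only [Matrix.cons_val_zero, Matrix.cons_val_one, Matrix.cons_val]
    linear_combination (C c⁻¹) * (u 0 * t12 i + u 1 * t20 i + u 2 * t01 i) -
      (u 0 * h 0 + u 1 * h 1 + u 2 * h 2) * m i * hinv
  -- The two expressions `α` of `X 0 ^ a • m` and `β` of `X 1 ^ b • m` yield two expressions of `X 0
  -- ^ a * X 1 ^ b • m`, which differ by a relation `t • h`. Since `X 2 ^ e` is a combination of the
  -- `h k`, the product `X 2 ^ e * t` lies in the ideal of `X 0 ^ a` and `X 1 ^ b`; hence so does
  -- `t`. This allows `α` to be changed by a multiple of `h` so that it becomes divisible by `X 0 ^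
  -- a`.
  obtain ⟨α, hα⟩ := hmul _ h0e
  obtain ⟨β, hβ⟩ := hmul _ h1e
  obtain ⟨t, ht⟩ := hrels (fun k => X 1 ^ b * α k - X 0 ^ a * β k) fun i => by
    linear_combination X 0 ^ a * hβ i - X 1 ^ b * hα i
  obtain ⟨w, hw⟩ := hcomb _ h2e
  have htI : t ∈ Ideal.span {(X 0 : PolyS) ^ a, X 1 ^ b} := by
    refine mem_span_X_pow_of_X_pow_mul_mem (e := e) (Ideal.mem_span_pair.mpr
      ⟨-(w 0 * β 0 + w 1 * β 1 + w 2 * β 2), w 0 * α 0 + w 1 * α 1 + w 2 * α 2, ?_⟩)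
    linear_combination t * hw + w 0 * ht 0 + w 1 * ht 1 + w 2 * ht 2
  obtain ⟨p, q, hpq⟩ := Ideal.mem_span_pair.mp htI
  have hdvd : ∀ k, ∃ γ, α k - q * h k = X 0 ^ a * γ := by
    intro k
    refine X_pow_dvd_of_dvd_mul (i := 0) (j := 1) (b := b) (by decide) ⟨β k + p * h k, ?_⟩
    linear_combination ht k - h k * hpq
  choose γ hγ using hdvd
  refine ⟨γ, Subtype.ext (funext fun i => ?_)⟩
  simp only [Fin.sum_univ_three, Submodule.coe_add, Submodule.coe_smul, Pi.add_apply,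
    Pi.smul_apply, smul_eq_mul]
  refine mul_left_cancel₀ (pow_ne_zero a (X_ne_zero (0 : Fin 3))) ?_
  linear_combination hα i + ρ 0 i * hγ 0 + ρ 1 i * hγ 1 + ρ 2 i * hγ 2 + q * hrel i

/-! ## Modules of syzygies without three generators -/

theorem homogeneousComponent_mul_of_isHomogeneous {f g : PolyS} {n : ℕ} (hg : g.IsHomogeneous n)
    (j : ℕ) : homogeneousComponent (j + n) (f * g) = homogeneousComponent j f * g := by
  have hterm : ∀ i, homogeneousComponent (j + n) (homogeneousComponent i f * g) =
      if i = j then homogeneousComponent j f * g else 0 := by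
    intro i
    rw [homogeneousComponent_of_mem ((homogeneousComponent_isHomogeneous i f).mul hg)]
    by_cases hij : i = j
    · rw [if_pos (by omega), if_pos hij, hij]
    · rw [if_neg (by omega), if_neg hij]
  conv_lhs => rw [← sum_homogeneousComponent f]
  rw [Finset.sum_mul, map_sum, Finset.sum_congr rfl fun i _ => hterm i, Finset.sum_ite_eq']
  split_ifs with h
  · rfl
  · rw [homogeneousComponent_eq_zero _ _ (by simpa using h), zero_mul]

/-- A polynomial without terms of degree less than `n`. -/
def HasOrder (n : ℕ) (f : PolyS) : Prop := ∀ j < n, homogeneousComponent j f = 0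

theorem HasOrder.coeff_eq_zero {n : ℕ} {f : PolyS} (h : HasOrder n f) {m : Fin 3 →₀ ℕ}
    (hm : m.degree < n) : coeff m f = 0 := by
  have := congrArg (coeff m) (h _ hm)
  rwa [coeff_homogeneousComponent, if_pos rfl, coeff_zero] at this

/-- In the lowest degree only the constant term of the coefficient `r` contributes. This plays the
role of reduction modulo the maximal ideal and needs no homogeneous generators. -/
theorem HasOrder.homogeneousComponent_mul {n : ℕ} {f : PolyS} (h : HasOrder n f) (r : PolyS) :
    homogeneousComponent n (r * f) = C (coeff 0 r) * homogeneousComponent n f := by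
  ext m
  rw [coeff_homogeneousComponent, coeff_C_mul, coeff_homogeneousComponent]
  split_ifs with hm
  · rw [coeff_mul, Finset.sum_eq_single (0, m)]
    · rintro ⟨p, q⟩ hpq hne
      rw [Finset.HasAntidiagonal.mem_antidiagonal] at hpq
      simp only at hpq ⊢
      have hp : p ≠ 0 := by
        rintro rfl
        exact hne (by rw [← hpq, zero_add])
      have hp' : p.degree ≠ 0 := by rwa [ne_eq, Finsupp.degree_eq_zero_iff]
      have hd : p.degree + q.degree = n := by rw [← map_add, hpq, hm]
      rw [h.coeff_eq_zero (by omega), mul_zero]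
    · intro h0
      simp at h0
  · rw [mul_zero]

/-- The module is graded: all partial derivatives have the same degree, so the defining equation
splits into its homogeneous parts. -/
theorem homogeneousComponent_mem_jacobianSyzygies {G : PolyS} {d : ℕ} (hG : G.IsHomogeneous d)
    {a : Fin 3 → PolyS} (ha : a ∈ jacobianSyzygies G) (j : ℕ) :
    (fun i => homogeneousComponent j (a i)) ∈ jacobianSyzygies G := by
  have h : ∑ i, a i * pderiv i G = 0 := ha
  change ∑ i, homogeneousComponent j (a i) * pderiv i G = 0
  have := congrArg (homogeneousComponent (j + (d - 1))) h
  rw [map_sum, map_zero] at this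
  rw [← this]
  exact Finset.sum_congr rfl fun i _ =>
    (homogeneousComponent_mul_of_isHomogeneous hG.pderiv j).symm

/-- If there are no syzygies of degree `n`, then there are none of lower degree. -/
theorem hasOrder_of_no_syzygies {G : PolyS} {d : ℕ} (hG : G.IsHomogeneous d) {n : ℕ}
    (h : ∀ a ∈ jacobianSyzygies G, (∀ i, (a i).IsHomogeneous n) → a = 0)
    {a : Fin 3 → PolyS} (ha : a ∈ jacobianSyzygies G) (i : Fin 3) : HasOrder (n + 1) (a i) := by
  intro j hj
  -- A component of degree `j < n + 1` is moved, injectively, into degree `n`.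
  have hmem := (jacobianSyzygies G).smul_mem (X 0 ^ (n - j))
    (homogeneousComponent_mem_jacobianSyzygies hG ha j)
  have h0 := congrFun (h _ hmem fun i => by
    have := ((isHomogeneous_X_pow (R := ℂ) (0 : Fin 3) (n - j)).mul
      (homogeneousComponent_isHomogeneous j (a i)))
    rwa [Nat.sub_add_cancel (by omega)] at this) i
  simpa using h0

/-- If all syzygies have order at least `n`, four independent syzygies of degree `n` cannot be
generated by three syzygies. -/
theorem not_hasThreeGenerators_of_four {G : PolyS} {n : ℕ}
    (hord : ∀ a ∈ jacobianSyzygies G, ∀ i, HasOrder n (a i)) {ρ : Fin 4 → Fin 3 → PolyS}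
    (hρ : ∀ l, ρ l ∈ jacobianSyzygies G) (hhom : ∀ l i, (ρ l i).IsHomogeneous n)
    (idx : Fin 4 → Fin 3) (v : Fin 4 → Fin 3 → ℂ)
    (hdet : (Matrix.of fun l k => eval (v k) (ρ l (idx k))).det ≠ 0) : ¬ HasThreeGenerators G := by
  rintro ⟨m, hm⟩
  choose r hr using fun l => hm ⟨ρ l, hρ l⟩
  let A : Matrix (Fin 4) (Fin 3) ℂ := Matrix.of fun l j => coeff 0 (r l j)
  let B : Matrix (Fin 3) (Fin 4) ℂ :=
    Matrix.of fun j k => eval (v k) (homogeneousComponent n ((m j).1 (idx k)))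
  -- In degree `n` the syzygies `ρ l` are combinations, with constant coefficients, of the degree
  -- `n` parts of the three supposed generators. So their matrix of values has rank at most three.
  have hAB : (Matrix.of fun l k => eval (v k) (ρ l (idx k))) = A * B := by
    ext l k
    have h1 : ρ l (idx k) = ∑ j, r l j * (m j).1 (idx k) := by
      have := congrFun (congrArg Subtype.val (hr l)) (idx k)
      simpa [Finset.sum_apply] using this
    have h2 : ρ l (idx k) = homogeneousComponent n (ρ l (idx k)) := by
      rw [homogeneousComponent_of_mem (hhom l (idx k)), if_pos rfl]
    rw [Matrix.of_apply, h2, h1, map_sum, map_sum, Matrix.mul_apply]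
    refine Finset.sum_congr rfl fun j _ => ?_
    rw [(hord _ (m j).2 _).homogeneousComponent_mul, map_mul, eval_C]
    rfl
  have h4 := Matrix.rank_of_isUnit _ ((Matrix.isUnit_iff_isUnit_det _).mpr
    (isUnit_iff_ne_zero.mpr hdet))
  rw [hAB, Fintype.card_fin] at h4
  have h3 := (Matrix.rank_mul_le_left A B).trans (Matrix.rank_le_width A)
  omega

/-- If all syzygies have order at least `n`, and three independent syzygies of degree `n` are
multiples of one vector at some point `p`, then there are no three generators if the value of
another syzygy at `p` is not a multiple of that vector. -/
theorem not_hasThreeGenerators_of_point {G : PolyS} {n n' : ℕ}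
    (hord : ∀ a ∈ jacobianSyzygies G, ∀ i, HasOrder n (a i)) {ρ : Fin 3 → Fin 3 → PolyS}
    (hρ : ∀ l, ρ l ∈ jacobianSyzygies G) (hhom : ∀ l i, (ρ l i).IsHomogeneous n)
    (idx : Fin 3 → Fin 3) (v : Fin 3 → Fin 3 → ℂ)
    (hdet : (Matrix.of fun l k => eval (v k) (ρ l (idx k))).det ≠ 0)
    {τ : Fin 3 → PolyS} (hτ : τ ∈ jacobianSyzygies G) (hτn : ∀ i, (τ i).IsHomogeneous n')
    {p κ : Fin 3 → ℂ} (hκ : ∀ l, ∑ i, κ i * eval p (ρ l i) = 0)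
    (hκτ : ∑ i, κ i * eval p (τ i) ≠ 0) : ¬ HasThreeGenerators G := by
  rintro ⟨m, hm⟩
  choose r hr using fun l => hm ⟨ρ l, hρ l⟩
  let R : Matrix (Fin 3) (Fin 3) PolyS := Matrix.of r
  let B : Matrix (Fin 3) (Fin 3) ℂ :=
    Matrix.of fun j k => eval (v k) (homogeneousComponent n ((m j).1 (idx k)))
  have hρr : ∀ l i, ρ l i = ∑ j, r l j * (m j).1 i := by
    intro l i
    have := congrFun (congrArg Subtype.val (hr l)) i
    simpa [Finset.sum_apply] using this
  have hAB : (Matrix.of fun l k => eval (v k) (ρ l (idx k))) =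
      R.map (eval (0 : Fin 3 → ℂ)) * B := by
    ext l k
    have h2 : ρ l (idx k) = homogeneousComponent n (ρ l (idx k)) := by
      rw [homogeneousComponent_of_mem (hhom l (idx k)), if_pos rfl]
    rw [Matrix.of_apply, h2, hρr, map_sum, map_sum, Matrix.mul_apply]
    refine Finset.sum_congr rfl fun j _ => ?_
    rw [(hord _ (m j).2 _).homogeneousComponent_mul, map_mul, eval_C]
    have h3 : R.map (eval (0 : Fin 3 → ℂ)) l j = coeff 0 (r l j) := by
      rw [Matrix.map_apply, eval_zero, constantCoeff_eq]
      rfl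
    rw [h3]
    rfl
  -- The same factorization as for four syzygies, now with a square matrix `R`: its constant term is
  -- invertible, so the `ρ l` generate near the origin.
  have hR : eval 0 R.det ≠ 0 := by
    rw [RingHom.map_det]
    intro h0
    rw [hAB, Matrix.det_mul] at hdet
    exact hdet (mul_eq_zero_of_left h0 _)
  -- The point `p` may be far from the origin. Scaling brings it near, and by homogeneity of the `ρ
  -- l` and of `τ` nothing is lost.
  obtain ⟨s, hs, hs0⟩ : ∃ s : ℂ, eval (s • p) R.det ≠ 0 ∧ s ≠ 0 := by
    have hcont : Continuous fun s : ℂ => eval (s • p) R.det :=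
      (MvPolynomial.continuous_eval R.det).comp (continuous_id.smul continuous_const)
    have h0 : ∀ᶠ s in nhds (0 : ℂ), eval (s • p) R.det ≠ 0 :=
      hcont.continuousAt.eventually_ne (by simpa using hR)
    have h1 := (h0.filter_mono nhdsWithin_le_nhds).and
      (self_mem_nhdsWithin : {(0 : ℂ)}ᶜ ∈ nhdsWithin 0 {(0 : ℂ)}ᶜ)
    exact h1.exists
  obtain ⟨q, hq⟩ := hm ⟨τ, hτ⟩
  have hq' : ∀ i, τ i = ∑ j, q j * (m j).1 i := by
    intro i
    have := congrFun (congrArg Subtype.val hq) i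
    simpa [Finset.sum_apply] using this
  -- The adjugate of `R` inverts the expression of the `ρ l` by the generators, up to the factor
  -- `R.det`.
  have hadj : ∀ i, R.det * τ i = ∑ l, (∑ j, q j * R.adjugate j l) * ρ l i := by
    intro i
    have h1 : ∀ j, R.det * (m j).1 i = ∑ l, R.adjugate j l * ρ l i := by
      intro j
      have h2 : (fun l => ρ l i) = R.mulVec fun j => (m j).1 i := by
        funext l
        rw [hρr]
        rfl
      have h3 := congrFun (congrArg R.adjugate.mulVec h2) j
      rw [Matrix.mulVec_mulVec, Matrix.adjugate_mul, Matrix.smul_mulVec, Matrix.one_mulVec] at h3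
      exact h3.symm
    rw [hq', Finset.mul_sum]
    simp_rw [Finset.sum_mul]
    rw [Finset.sum_comm]
    refine Finset.sum_congr rfl fun j _ => ?_
    rw [mul_left_comm, h1, Finset.mul_sum]
    exact Finset.sum_congr rfl fun l _ => by ring
  refine hκτ ?_
  -- Pairing `hadj` with `κ` at the point `s • p` annihilates the right-hand side.
  have hzero : eval (s • p) R.det * (s ^ n' * ∑ i, κ i * eval p (τ i)) = 0 := by
    have h1 : ∀ i, eval (s • p) R.det * (s ^ n' * (κ i * eval p (τ i))) =
        ∑ l, (eval (s • p) (∑ j, q j * R.adjugate j l) * s ^ n) * (κ i * eval p (ρ l i)) := by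
      intro i
      have := congrArg (eval (s • p)) (hadj i)
      rw [map_mul, eval_smul_of_isHomogeneous (hτn i), map_sum] at this
      calc _ = κ i * (eval (s • p) R.det * (s ^ n' * eval p (τ i))) := by ring
        _ = _ := by
          rw [this, Finset.mul_sum]
          refine Finset.sum_congr rfl fun l _ => ?_
          rw [map_mul, eval_smul_of_isHomogeneous (hhom l i)]
          ring
    rw [Finset.mul_sum, Finset.mul_sum, Finset.sum_congr rfl fun i _ => h1 i, Finset.sum_comm]
    refine Finset.sum_eq_zero fun l _ => ?_
    rw [← Finset.mul_sum, hκ, mul_zero]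
  exact ((mul_eq_zero.mp hzero).resolve_left hs |> mul_eq_zero.mp).resolve_left (pow_ne_zero _ hs0)

/-! ## A criterion for the absence of syzygies of a given degree -/

section LinearCombination

variable {R : Type*} [CommRing R]

/-- The linear form with coefficient list `r`, evaluated at `w`. -/
def rowValue : List ℤ → List R → R
  | [], _ => 0
  | _ :: _, [] => 0
  | a :: r, b :: w => a * b + rowValue r w

theorem rowValue_listAdd : ∀ (r s : List ℤ) (w : List R),
    rowValue (listAdd Int.add r s) w = rowValue r w + rowValue s w
  | [], s, w => by simp [listAdd, rowValue]
  | a :: r, [], w => by cases w <;> simp [listAdd, rowValue]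
  | a :: r, b :: s, [] => by simp [listAdd, rowValue]
  | a :: r, b :: s, c :: w => by
    simp only [listAdd, rowValue, rowValue_listAdd r s w]
    change ((a + b : ℤ) : R) * c + _ = _
    push_cast
    ring

theorem rowValue_map_mul (c : ℤ) : ∀ (r : List ℤ) (w : List R),
    rowValue (r.map (Int.mul c)) w = c * rowValue r w
  | [], w => by simp [rowValue]
  | a :: r, [] => by simp [rowValue]
  | a :: r, b :: w => by
    simp only [List.map, rowValue, rowValue_map_mul c r w]
    change ((c * a : ℤ) : R) * b + _ = _
    push_cast
    ring

theorem rowValue_append : ∀ (r s : List ℤ) (w u : List R), r.length = w.length →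
    rowValue (r ++ s) (w ++ u) = rowValue r w + rowValue s u
  | [], s, [], u, _ => by simp [rowValue]
  | a :: r, s, b :: w, u, h => by
    simp only [List.cons_append, rowValue, rowValue_append r s w u (by simpa using h)]
    ring

theorem rowValue_map_map {α : Type*} (f : α → ℤ) (g : α → R) : ∀ l : List α,
    rowValue (l.map f) (l.map g) = (l.map fun t => (f t : R) * g t).sum
  | [] => rfl
  | a :: l => by simp [rowValue, rowValue_map_map f g l]

theorem rowValue_eq_sum : ∀ (K : ℕ) (r : List ℤ) (w : List R), w.length = K →
    rowValue r w = ∑ k : Fin K, ((r.getD k 0 : ℤ) : R) * w.getD k 0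
  | _, [], w, _ => by simp [rowValue]
  | 0, a :: r, w, h => by
    obtain rfl := List.length_eq_zero_iff.mp h
    simp [rowValue]
  | K + 1, a :: r, b :: w, h => by
    rw [rowValue, rowValue_eq_sum K r w (by simpa using h), Fin.sum_univ_succ]
    simp

/-- Linear combination of rows. -/
def combineRows : List ℤ → List (List ℤ) → List ℤ
  | [], _ => []
  | _ :: _, [] => []
  | b :: bs, r :: rs => listAdd Int.add (r.map (Int.mul b)) (combineRows bs rs)

theorem rowValue_combineRows_eq_zero : ∀ (b : List ℤ) (rows : List (List ℤ)) (w : List R),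
    (∀ r ∈ rows, rowValue r w = 0) → rowValue (combineRows b rows) w = 0
  | [], _, w, _ => by simp [combineRows, rowValue]
  | _ :: _, [], w, _ => by simp [combineRows, rowValue]
  | b :: bs, r :: rs, w, h => by
    rw [combineRows, rowValue_listAdd, rowValue_map_mul, h r (by simp),
      rowValue_combineRows_eq_zero bs rs w fun r' hr' => h r' (by simp [hr'])]
    simp

/-- Reduction of a list of integers modulo `p`. -/
def reduceRow (p : ℤ) (r : List ℤ) : List ℤ := r.map fun a => Int.emod a p

theorem rowValue_reduceRow (p : ℕ) : ∀ (r : List ℤ) (w : List (ZMod p)),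
    rowValue (reduceRow p r) w = rowValue r w
  | [], w => by simp [rowValue, reduceRow]
  | a :: r, [] => by simp [rowValue, reduceRow]
  | a :: r, b :: w => by
    have := rowValue_reduceRow p r w
    simp only [reduceRow, List.map, rowValue] at this ⊢
    rw [this]
    congr 2
    exact ZMod.intCast_mod a p

/-- The row `(0, …, 0, 1, 0, …, 0)` of length `K`. -/
def unitRow : ℕ → ℕ → List ℤ
  | _, 0 => []
  | 0, K + 1 => 1 :: List.replicate K 0
  | k + 1, K + 1 => 0 :: unitRow k K

theorem rowValue_replicate_zero : ∀ (K : ℕ) (w : List R), rowValue (List.replicate K 0) w = 0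
  | 0, w => by simp [rowValue]
  | K + 1, [] => by simp [rowValue, List.replicate]
  | K + 1, b :: w => by simp [rowValue, List.replicate, rowValue_replicate_zero K w]

theorem rowValue_unitRow : ∀ (k K : ℕ) (w : List R), k < K → rowValue (unitRow k K) w = w.getD k 0
  | _, 0, _, h => by omega
  | 0, K + 1, [], _ => by simp [rowValue, unitRow]
  | 0, K + 1, b :: w, _ => by simp [rowValue, unitRow, rowValue_replicate_zero]
  | k + 1, K + 1, [], _ => by simp [rowValue, unitRow]
  | k + 1, K + 1, b :: w, h => by
    simp [rowValue, unitRow, rowValue_unitRow k K w (by omega)]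

/-- Whether `B * A = 1` modulo `p`, the rows of `B` being counted from `k` on. -/
def isLeftInverse (p : ℤ) (K : ℕ) (A : List (List ℤ)) : ℕ → List (List ℤ) → Bool
  | k, [] => k == K
  | k, b :: B => decide (reduceRow p (combineRows b A) = unitRow k K) &&
    isLeftInverse p K A (k + 1) B

theorem exists_of_isLeftInverse {p : ℤ} {K : ℕ} {A : List (List ℤ)} : ∀ (k : ℕ) (B : List (List ℤ)),
    isLeftInverse p K A k B = true → ∀ j, k ≤ j → j < K →
      ∃ b, reduceRow p (combineRows b A) = unitRow j K
  | k, [], h, j, hk, hj => by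
    simp only [isLeftInverse, beq_iff_eq] at h
    omega
  | k, b :: B, h, j, hk, hj => by
    simp only [isLeftInverse, Bool.and_eq_true, decide_eq_true_eq] at h
    rcases hk.eq_or_lt with rfl | hlt
    · exact ⟨b, h.1⟩
    · exact exists_of_isLeftInverse (k + 1) B h.2 j hlt hj

/-- A square integer matrix that is invertible modulo a prime `p` has a nonzero determinant. -/
theorem det_ne_zero_of_isLeftInverse {p : ℕ} [Fact p.Prime] {K : ℕ} {rows A B : List (List ℤ)}
    (hlen : rows.length = K) (hA : rows.map (reduceRow p) = A)
    (hB : isLeftInverse p K A 0 B = true) :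
    (Matrix.of fun i k : Fin K =>
      (((rows.get (i.cast hlen.symm)).getD k 0 : ℤ) : ℂ)).det ≠ 0 := by
  let M : Matrix (Fin K) (Fin K) ℤ :=
    Matrix.of fun i k => (rows.get (i.cast hlen.symm)).getD k 0
  -- A kernel vector modulo `p` is annihilated by the rows, hence by their combinations. These
  -- include all unit rows, so every coordinate of the vector vanishes.
  have hdetp : (M.map (Int.castRingHom (ZMod p))).det ≠ 0 := by
    intro h0
    obtain ⟨u, hu, hMu⟩ := Matrix.exists_mulVec_eq_zero_iff.mpr h0
    refine hu (funext fun j => ?_)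
    have hget : ∀ k : Fin K, (List.ofFn u).getD k 0 = u k := by
      intro k
      simp [List.getD_eq_getElem?_getD]
    have hrow : ∀ r ∈ A, rowValue r (List.ofFn u) = 0 := by
      intro r hr
      rw [← hA, List.mem_map] at hr
      obtain ⟨r', hr', rfl⟩ := hr
      obtain ⟨i, rfl⟩ := List.get_of_mem hr'
      rw [rowValue_reduceRow, rowValue_eq_sum K _ _ (List.length_ofFn)]
      have := congrFun hMu (i.cast hlen)
      simp only [hget]
      simpa [Matrix.mulVec, dotProduct, M] using this
    obtain ⟨b, hb⟩ := exists_of_isLeftInverse 0 B hB j (Nat.zero_le _) j.2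
    have h1 := rowValue_combineRows_eq_zero b A _ hrow
    rw [← rowValue_reduceRow, hb, rowValue_unitRow _ _ _ j.2, hget] at h1
    exact h1
  -- The determinant commutes with reduction modulo `p` and with the inclusion of the integers in
  -- `ℂ`.
  have hdet : M.det ≠ 0 := by
    intro h0
    refine hdetp ?_
    have := (RingHom.map_det (Int.castRingHom (ZMod p)) M).symm
    rw [h0, map_zero] at this
    exact this
  have := (RingHom.map_det (Int.castRingHom ℂ) M).symm
  rw [RingHom.mapMatrix_apply] at this
  refine ne_of_eq_of_ne this ?_
  simpa using hdet

/-- A square integer matrix that is invertible modulo a prime `p` has no kernel. -/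
theorem eq_zero_of_rowValue_eq_zero {p : ℕ} [Fact p.Prime] {K : ℕ} {rows A B : List (List ℤ)}
    (hlen : rows.length = K) (hA : rows.map (reduceRow p) = A)
    (hB : isLeftInverse p K A 0 B = true) {w : List ℂ} (hw : w.length = K)
    (h : ∀ r ∈ rows, rowValue r w = 0) : ∀ x ∈ w, x = 0 := by
  have hzero := Matrix.eq_zero_of_mulVec_eq_zero (det_ne_zero_of_isLeftInverse hlen hA hB)
    (v := fun k : Fin K => w.getD k 0) (by
    funext i
    have := h _ (List.get_mem rows (i.cast hlen.symm))
    rw [rowValue_eq_sum K _ _ hw] at this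
    simpa [Matrix.mulVec, dotProduct] using this)
  intro x hx
  obtain ⟨k, hk, rfl⟩ := List.mem_iff_getElem.mp hx
  have := congrFun hzero ⟨k, hw ▸ hk⟩
  simpa [List.getD_eq_getElem?_getD, hk] using this

end LinearCombination

/-! ### Linear conditions on syzygies from their values at points. -/

/-- The exponents of the monomials of degree `n` in three variables. -/
def exponents (n : ℕ) : List (Fin 3 → ℕ) := List.Nat.antidiagonalTuple 3 n

/-- The sum runs over all monomials of degree `n` in a fixed order, and not over the support of `F`,
so that coefficient vectors have a known length and can be paired with rows of integers. -/
theorem eval_eq_sum_exponents {F : PolyS} {n : ℕ} (hF : F.IsHomogeneous n) (v : Fin 3 → ℂ) :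
    eval v F = ((exponents n).map fun t =>
      (v 0 ^ t 0 * v 1 ^ t 1 * v 2 ^ t 2) * coeff (Finsupp.equivFunOnFinite.symm t) F).sum := by
  have h1 : ((exponents n).map fun t =>
      (v 0 ^ t 0 * v 1 ^ t 1 * v 2 ^ t 2) * coeff (Finsupp.equivFunOnFinite.symm t) F).sum =
      ∑ t ∈ Finset.Nat.antidiagonalTuple 3 n,
        (v 0 ^ t 0 * v 1 ^ t 1 * v 2 ^ t 2) * coeff (Finsupp.equivFunOnFinite.symm t) F := rfl
  rw [h1, eval_eq']
  refine Finset.sum_of_injOn (fun m => ⇑m) DFunLike.coe_injective.injOn ?_ ?_ ?_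
  · intro m hm
    have := hF (mem_support_iff.mp hm)
    rw [Finset.mem_coe, Finset.Nat.mem_antidiagonalTuple, ← this]
    simp [Finsupp.weight_apply, Finsupp.sum_fintype]
  · intro t _ ht
    have : coeff (Finsupp.equivFunOnFinite.symm t) F = 0 := by
      by_contra hne
      exact ht ⟨_, mem_support_iff.mpr hne, by simp⟩
    rw [this, mul_zero]
  · intro m _
    have : Finsupp.equivFunOnFinite.symm ⇑m = m := by ext; simp
    rw [this, Fin.prod_univ_three]
    ring

/-- The values at `v` of the monomials with exponents `l`. -/
def monomialValues (l : List (Fin 3 → ℕ)) (v : Fin 3 → ℤ) : List ℤ :=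
  l.map fun t => v 0 ^ t 0 * v 1 ^ t 1 * v 2 ^ t 2

/-- The linear condition on the coefficients of a syzygy that comes from its value at a point,
if the monomials have the values `m` and the partial derivatives have the values `g` there. -/
def syzygyRow (m : List ℤ) (g : Fin 3 → ℤ) : List ℤ :=
  m.map (Int.mul (g 0)) ++ (m.map (Int.mul (g 1)) ++ m.map (Int.mul (g 2)))

/-- There are no syzygies of degree `n` if a matrix of conditions is invertible modulo `p`. -/
theorem no_syzygies_of_isLeftInverse {G : PolyS} {g : (Fin 3 → ℤ) → Fin 3 → ℤ}
    (hg : ∀ v i, eval (fun k => (v k : ℂ)) (pderiv i G) = g v i) {n p K : ℕ} [Fact p.Prime]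
    {pts : List (Fin 3 → ℤ)} {A B : List (List ℤ)}
    (hK : 3 * (exponents n).length = K) (hlen : pts.length = K)
    (hA : (pts.map fun v => reduceRow p (syzygyRow (monomialValues (exponents n) v) (g v))) = A)
    (hB : isLeftInverse p K A 0 B = true) {a : Fin 3 → PolyS} (ha : a ∈ jacobianSyzygies G)
    (hn : ∀ i, (a i).IsHomogeneous n) : a = 0 := by
  -- The unknowns are the coefficients of the three entries of `a`. Each integer point gives one
  -- linear equation for them, and there are as many points as unknowns.
  let c : Fin 3 → List ℂ := fun i =>
    (exponents n).map fun t => coeff (Finsupp.equivFunOnFinite.symm t) (a i)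
  have hval : ∀ i (v : Fin 3 → ℤ), rowValue (monomialValues (exponents n) v) (c i) =
      eval (fun k => (v k : ℂ)) (a i) := by
    intro i v
    rw [eval_eq_sum_exponents (hn i), monomialValues, rowValue_map_map]
    simp
  have hzero := eq_zero_of_rowValue_eq_zero (p := p) (K := K)
    (rows := pts.map fun v => syzygyRow (monomialValues (exponents n) v) (g v)) (A := A) (B := B)
    (by simpa using hlen) (by rw [← hA, List.map_map]; rfl) hB
    (w := c 0 ++ (c 1 ++ c 2)) (by simp [c]; omega) (by
      intro r hr
      obtain ⟨v, _, rfl⟩ := List.mem_map.mp hr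
      have hs := congrArg (eval fun k => (v k : ℂ)) (mem_jacobianSyzygies.mp ha)
      simp only [map_add, map_mul, map_zero, hg] at hs
      rw [syzygyRow, rowValue_append _ _ _ _ (by simp [monomialValues, c]),
        rowValue_append _ _ _ _ (by simp [monomialValues, c]), rowValue_map_mul, rowValue_map_mul,
        rowValue_map_mul, hval, hval, hval, ← hs]
      ring)
  have hci : ∀ i, ∀ x ∈ c i, x = 0 := by
    intro i x hx
    refine hzero x ?_
    fin_cases i <;> simp_all
  funext i
  refine MvPolynomial.funext fun v => ?_
  rw [eval_eq_sum_exponents (hn i), Pi.zero_apply, map_zero]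
  refine List.sum_eq_zero fun x hx => ?_
  obtain ⟨t, ht, rfl⟩ := List.mem_map.mp hx
  rw [hci i _ (List.mem_map.mpr ⟨t, ht, rfl⟩), mul_zero]

/-! ## Lines and conics with integer coefficients -/

/-- A line `a x + b y + c z = 0` or a conic, with the coefficients of
`x ^ 2, y ^ 2, z ^ 2, x y, x z, y z`. -/
inductive PlaneForm : Type
  | line (a b c : ℤ)
  | conic (a b c d e f : ℤ)

namespace PlaneForm

variable {R : Type*} [CommRing R]

/-- The degree of the form. -/
def degree : PlaneForm → ℕ
  | line _ _ _ => 1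
  | conic _ _ _ _ _ _ => 2

/-- The coefficients of the form. -/
def coeffs : PlaneForm → CoeffList
  | line a b c => [[c, b], [a]]
  | conic a b c d e f => [[c, f, b], [e, d], [a]]

/-- The coefficients of the partial derivatives. -/
def gradCoeffs : PlaneForm → Fin 3 → CoeffList
  | line a b c => ![[[a]], [[b]], [[c]]]
  | conic a b c d e f => ![[[e, d], [2 * a]], [[f, 2 * b], [d]], [[2 * c, f], [e]]]

/-- The form as a polynomial. -/
noncomputable def poly (f : PlaneForm) : PolyS := CoeffList.toPoly f.degree f.coeffs

/-- The value of the form. -/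
def val (v : Fin 3 → R) : PlaneForm → R
  | line a b c => a * v 0 + b * v 1 + c * v 2
  | conic a b c d e f => a * v 0 ^ 2 + b * v 1 ^ 2 + c * v 2 ^ 2 + d * (v 0 * v 1) +
      e * (v 0 * v 2) + f * (v 1 * v 2)

/-- The gradient of the form. -/
def grad (v : Fin 3 → R) : PlaneForm → Fin 3 → R
  | line a b c => ![a, b, c]
  | conic a b c d e f => ![2 * a * v 0 + d * v 1 + e * v 2, d * v 0 + 2 * b * v 1 + f * v 2,
      e * v 0 + f * v 1 + 2 * c * v 2]

theorem eval_poly (v : Fin 3 → ℂ) (f : PlaneForm) : eval v f.poly = f.val v := by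
  rw [poly, CoeffList.eval_toPoly]
  cases f <;> simp [degree, coeffs, val, CoeffList.form, CoeffList.binaryForm] <;> ring

theorem pderiv_poly (f : PlaneForm) (i : Fin 3) :
    pderiv i f.poly = CoeffList.toPoly (f.degree - 1) (f.gradCoeffs i) := by
  cases f <;> fin_cases i <;>
    simp [poly, degree, coeffs, gradCoeffs, CoeffList.toPoly, CoeffList.form, CoeffList.binaryForm,
      pderiv_X, Derivation.leibniz, Derivation.leibniz_pow] <;> ring

theorem eval_pderiv_poly (v : Fin 3 → ℂ) (f : PlaneForm) (i : Fin 3) :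
    eval v (pderiv i f.poly) = f.grad v i := by
  rw [pderiv_poly, CoeffList.eval_toPoly]
  cases f <;> fin_cases i <;>
    simp [degree, gradCoeffs, grad, CoeffList.form, CoeffList.binaryForm] <;> ring

theorem isHomogeneous_poly (f : PlaneForm) : f.poly.IsHomogeneous f.degree :=
  CoeffList.isHomogeneous_toPoly _ _

theorem map_val {S : Type*} [CommRing S] (φ : R →+* S) (v : Fin 3 → R) (f : PlaneForm) :
    φ (f.val v) = f.val fun i => φ (v i) := by
  cases f <;> simp [val]

theorem map_grad {S : Type*} [CommRing S] (φ : R →+* S) (v : Fin 3 → R) (f : PlaneForm)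
    (i : Fin 3) : φ (f.grad v i) = f.grad (fun i => φ (v i)) i := by
  have h2 : φ 2 = 2 := map_ofNat φ 2
  cases f <;> fin_cases i <;> simp [grad, h2]

theorem val_intCast (v : Fin 3 → ℤ) (f : PlaneForm) :
    f.val (fun i => (v i : ℂ)) = (f.val v : ℤ) := (map_val (Int.castRingHom ℂ) v f).symm

theorem grad_intCast (v : Fin 3 → ℤ) (f : PlaneForm) (i : Fin 3) :
    f.grad (fun i => (v i : ℂ)) i = (f.grad v i : ℤ) := (map_grad (Int.castRingHom ℂ) v f i).symm

/-- The value of a product of forms. -/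
def prodVal (v : Fin 3 → R) : List PlaneForm → R
  | [] => 1
  | f :: l => f.val v * prodVal v l

/-- The gradient of a product of forms. -/
def prodGrad (v : Fin 3 → R) (i : Fin 3) : List PlaneForm → R
  | [] => 0
  | f :: l => f.grad v i * prodVal v l + f.val v * prodGrad v i l

/-- The coefficients of a product of forms. -/
def prodCoeffs : List PlaneForm → CoeffList
  | [] => [[1]]
  | f :: l => CoeffList.mul f.coeffs (prodCoeffs l)

/-- The coefficients of the gradient of a product of forms. -/
def prodGradCoeffs (i : Fin 3) : List PlaneForm → CoeffList
  | [] => []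
  | f :: l => CoeffList.add (CoeffList.mul (f.gradCoeffs i) (prodCoeffs l))
      (CoeffList.mul f.coeffs (prodGradCoeffs i l))

/-- The product of the forms as a polynomial. -/
noncomputable def prodPoly (l : List PlaneForm) : PolyS := (l.map poly).prod

theorem prodPoly_cons (f : PlaneForm) (l : List PlaneForm) :
    prodPoly (f :: l) = f.poly * prodPoly l := by simp [prodPoly]

theorem prodVal_intCast (v : Fin 3 → ℤ) : ∀ l : List PlaneForm,
    prodVal (fun i => (v i : ℂ)) l = (prodVal v l : ℤ)
  | [] => by simp [prodVal]
  | f :: l => by simp [prodVal, prodVal_intCast v l, val_intCast]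

theorem prodGrad_intCast (v : Fin 3 → ℤ) (i : Fin 3) : ∀ l : List PlaneForm,
    prodGrad (fun i => (v i : ℂ)) i l = (prodGrad v i l : ℤ)
  | [] => by simp [prodGrad]
  | f :: l => by
    simp [prodGrad, prodGrad_intCast v i l, prodVal_intCast, val_intCast, grad_intCast]

theorem eval_prodPoly (v : Fin 3 → ℂ) : ∀ l : List PlaneForm, eval v (prodPoly l) = prodVal v l
  | [] => by simp [prodPoly, prodVal]
  | f :: l => by rw [prodPoly_cons, map_mul, eval_prodPoly v l, eval_poly, prodVal]

theorem eval_pderiv_prodPoly (v : Fin 3 → ℂ) (i : Fin 3) : ∀ l : List PlaneForm,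
    eval v (pderiv i (prodPoly l)) = prodGrad v i l
  | [] => by simp [prodPoly, prodGrad]
  | f :: l => by
    rw [prodPoly_cons, pderiv_mul, map_add, map_mul, map_mul, eval_pderiv_prodPoly v i l,
      eval_pderiv_poly, eval_poly, eval_prodPoly, prodGrad]

theorem value_coeffs (x y : R) (f : PlaneForm) : f.coeffs.value x y = f.val ![x, y, 1] := by
  cases f <;> simp [coeffs, val, CoeffList.value, horner] <;> ring

theorem value_gradCoeffs (x y : R) (f : PlaneForm) (i : Fin 3) :
    (f.gradCoeffs i).value x y = f.grad ![x, y, 1] i := by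
  cases f <;> fin_cases i <;> simp [gradCoeffs, grad, CoeffList.value, horner] <;> ring

theorem value_prodCoeffs (x y : R) : ∀ l : List PlaneForm,
    (prodCoeffs l).value x y = prodVal ![x, y, 1] l
  | [] => by simp [prodCoeffs, prodVal, CoeffList.value, horner]
  | f :: l => by
    rw [prodCoeffs, CoeffList.value_mul, value_prodCoeffs x y l, value_coeffs, prodVal]

theorem value_prodGradCoeffs (x y : R) (i : Fin 3) : ∀ l : List PlaneForm,
    (prodGradCoeffs i l).value x y = prodGrad ![x, y, 1] i l
  | [] => by simp [prodGradCoeffs, prodGrad, CoeffList.value, horner]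
  | f :: l => by
    rw [prodGradCoeffs, CoeffList.value_add, CoeffList.value_mul, CoeffList.value_mul,
      value_prodCoeffs, value_prodGradCoeffs x y i l, value_coeffs, value_gradCoeffs, prodGrad]

/-- The degree of a product of forms. -/
def prodDegree (l : List PlaneForm) : ℕ := (l.map degree).sum

theorem isHomogeneous_prodPoly : ∀ l : List PlaneForm, (prodPoly l).IsHomogeneous (prodDegree l)
  | [] => by simpa [prodPoly, prodDegree] using isHomogeneous_one (Fin 3) ℂ
  | f :: l => by
    rw [prodPoly_cons, prodDegree, List.map_cons, List.sum_cons]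
    exact f.isHomogeneous_poly.mul (isHomogeneous_prodPoly l)

end PlaneForm

/-! ## Verification of identities between forms -/

/-- `P` is a form of degree `d` whose dehomogenization has the coefficients `p`. -/
structure Represents (d : ℕ) (P : PolyS) (p : CoeffList) : Prop where
  homogeneous : P.IsHomogeneous d
  eval_one : ∀ x y : ℂ, eval ![x, y, 1] P = p.value x y

namespace Represents

variable {d e : ℕ} {P Q : PolyS} {p q : CoeffList}

theorem mul (hP : Represents d P p) (hQ : Represents e Q q) :
    Represents (d + e) (P * Q) (p.mul q) :=
  ⟨hP.homogeneous.mul hQ.homogeneous, fun x y => by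
    rw [map_mul, hP.eval_one, hQ.eval_one, CoeffList.value_mul]⟩

theorem add (hP : Represents d P p) (hQ : Represents d Q q) : Represents d (P + Q) (p.add q) :=
  ⟨hP.homogeneous.add hQ.homogeneous, fun x y => by
    rw [map_add, hP.eval_one, hQ.eval_one, CoeffList.value_add]⟩

theorem neg (hP : Represents d P p) : Represents d (-P) p.neg :=
  ⟨hP.homogeneous.neg, fun x y => by rw [map_neg, hP.eval_one, CoeffList.value_neg]⟩

/-- Identities between polynomials become computations with integer lists. The common degree
recorded in `Represents` makes dehomogenization faithful. -/
theorem eq_zero (hP : Represents d P p) (hp : p.isZero = true) : P = 0 :=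
  eq_zero_of_eval_one hP.homogeneous fun x y => by
    rw [hP.eval_one, CoeffList.value_eq_zero x y hp]

theorem cast (hP : Represents d P p) (h : d = e) : Represents e P p := h ▸ hP

theorem toPoly (h : p.fits d = true) : Represents d (p.toPoly d) p :=
  ⟨CoeffList.isHomogeneous_toPoly d p, fun x y => CoeffList.eval_toPoly_one x y h⟩

theorem intCast (a : ℤ) : Represents 0 (a : PolyS) [[a]] :=
  ⟨by simpa using isHomogeneous_C (Fin 3) (a : ℂ), fun x y => by
    simp [CoeffList.value, horner]⟩

/-- The list `p` is kept separate from `prodGradCoeffs i l`, so that the expanded gradient can be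
supplied as a literal table and used in several checks. -/
theorem pderiv_prodPoly (l : List PlaneForm) (i : Fin 3)
    (hp : PlaneForm.prodGradCoeffs i l = p) :
    Represents (PlaneForm.prodDegree l - 1) (pderiv i (PlaneForm.prodPoly l)) p :=
  ⟨(PlaneForm.isHomogeneous_prodPoly l).pderiv, fun x y => by
    rw [PlaneForm.eval_pderiv_prodPoly, ← hp, PlaneForm.value_prodGradCoeffs]⟩

end Represents

/-- The sum of the products of three forms. -/
def CoeffList.dot (p q : Fin 3 → CoeffList) : CoeffList :=
  CoeffList.add (CoeffList.add (CoeffList.mul (p 0) (q 0)) (CoeffList.mul (p 1) (q 1)))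
    (CoeffList.mul (p 2) (q 2))

theorem Represents.dot {P Q : Fin 3 → PolyS} {p q : Fin 3 → CoeffList} {a b : Fin 3 → ℕ} {d : ℕ}
    (hP : ∀ i, Represents (a i) (P i) (p i)) (hQ : ∀ i, Represents (b i) (Q i) (q i))
    (hd : ∀ i, a i + b i = d) :
    Represents d (P 0 * Q 0 + P 1 * Q 1 + P 2 * Q 2) (CoeffList.dot p q) :=
  ((((hP 0).mul (hQ 0)).cast (hd 0)).add (((hP 1).mul (hQ 1)).cast (hd 1))).add
    (((hP 2).mul (hQ 2)).cast (hd 2))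

/-- Whether `ρ` consists of forms of degree `n` and is orthogonal to `g`. -/
def checkSyzygy (g : Fin 3 → CoeffList) (n : ℕ) (ρ : Fin 3 → CoeffList) : Bool :=
  (CoeffList.fits n (ρ 0) && CoeffList.fits n (ρ 1) && CoeffList.fits n (ρ 2)) &&
    CoeffList.isZero (CoeffList.dot ρ g)

theorem fits_of_checkSyzygy {g : Fin 3 → CoeffList} {n : ℕ} {ρ : Fin 3 → CoeffList}
    (h : checkSyzygy g n ρ = true) (i : Fin 3) : CoeffList.fits n (ρ i) = true := by
  simp only [checkSyzygy, Bool.and_eq_true] at h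
  fin_cases i
  · exact h.1.1.1
  · exact h.1.1.2
  · exact h.1.2

theorem mem_jacobianSyzygies_of_check {l : List PlaneForm} {g : Fin 3 → CoeffList}
    (hg : ∀ i, PlaneForm.prodGradCoeffs i l = g i) {n : ℕ} {ρ : Fin 3 → CoeffList}
    (h : checkSyzygy g n ρ = true) :
    (fun i => CoeffList.toPoly n (ρ i)) ∈ jacobianSyzygies (PlaneForm.prodPoly l) := by
  rw [mem_jacobianSyzygies]
  refine (Represents.dot (fun i => Represents.toPoly (fits_of_checkSyzygy h i))
    (fun i => Represents.pderiv_prodPoly l i (hg i)) fun _ => rfl).eq_zero ?_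
  simp only [checkSyzygy, Bool.and_eq_true] at h
  exact h.2

/-! ### Certificates for three generators. -/

/-- Three syzygies `ρ k` of degrees `deg k`, the coefficients `h k` of a relation between them and
the representations `u j` of multiples of powers of the variables by the `h k`. -/
structure ThreeGenerators : Type where
  deg : Fin 3 → ℕ
  ρ : Fin 3 → Fin 3 → CoeffList
  -- The degree of the relation: `h k` has degree `total - deg k`.
  total : ℕ
  h : Fin 3 → CoeffList
  -- The constant in `ρ 0 × ρ 1 = factor * h 2` times the gradient.
  factor : ℤ
  -- A point where `h 2` and the first partial derivative do not vanish, which shows that they are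
  -- nonzero polynomials.
  point : Fin 3 → ℤ
  power : ℕ
  -- The identities are `∑ k, u j k * h k = coefficient j * X j ^ power`; the nonzero integer on the
  -- right avoids denominators in `u`.
  coefficient : Fin 3 → ℤ
  u : Fin 3 → Fin 3 → CoeffList

namespace ThreeGenerators

theorem horner_replicate_append {A R : Type*} [CommRing R] (ι : A → R) (t : R) (z a : A)
    (hz : ι z = 0) : ∀ n, horner ι t (List.replicate n z ++ [a]) = ι a * t ^ n
  | 0 => by simp [horner]
  | n + 1 => by
    rw [List.replicate_succ, List.cons_append, horner, horner_replicate_append ι t z a hz n, hz]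
    ring

/-- The monomial `x ^ n`, `y ^ n` or `z ^ n`, with a coefficient. -/
def powerCoeffs (a : ℤ) (n : ℕ) : Fin 3 → CoeffList :=
  ![List.replicate n [] ++ [[a]], [List.replicate n 0 ++ [a]], [[a]]]

theorem represents_powerCoeffs (a : ℤ) (n : ℕ) (j : Fin 3) :
    Represents n ((a : PolyS) * X j ^ n) (powerCoeffs a n j) := by
  refine ⟨by simpa using isHomogeneous_C_mul_X_pow (a : ℂ) j n, fun x y => ?_⟩
  fin_cases j
  · have := horner_replicate_append (horner (Int.cast : ℤ → ℂ) y) x [] [a] rfl n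
    simp [powerCoeffs, CoeffList.value, this]
    simp [horner]
  · have := horner_replicate_append (Int.cast : ℤ → ℂ) y 0 a Int.cast_zero n
    simp only [powerCoeffs, CoeffList.value]
    simp [horner, this]
  · simp [powerCoeffs, CoeffList.value, horner]

/-- Verification of the data. -/
def check (g : Fin 3 → CoeffList) (c : ThreeGenerators) : Bool :=
  (List.finRange 3).all (fun k => checkSyzygy g (c.deg k) (c.ρ k) &&
    CoeffList.fits (c.total - c.deg k) (c.h k) && decide (c.deg k ≤ c.total) &&
    CoeffList.isZero (CoeffList.dot c.h fun j => c.ρ j k) &&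
    CoeffList.isZero (CoeffList.add (CoeffList.dot (c.u k) c.h)
      (CoeffList.neg (powerCoeffs (c.coefficient k) c.power k))) &&
    -- The inequalities between `total`, `power` and `deg k` ensure that the truncated differences
    -- occurring as degrees are true differences.
    decide (c.coefficient k ≠ 0) && decide (c.total ≤ c.power + c.deg k) &&
    (List.finRange 3).all fun j => CoeffList.fits (c.power + c.deg j - c.total) (c.u k j)) &&
  decide (c.factor ≠ 0) &&
  -- One coordinate of the cross product suffices, because the cross product of two syzygies is
  -- always a multiple of the gradient.
  CoeffList.isZero (CoeffList.add (CoeffList.add (CoeffList.mul (c.ρ 0 1) (c.ρ 1 2))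
    (CoeffList.neg (CoeffList.mul (c.ρ 0 2) (c.ρ 1 1))))
    (CoeffList.neg (CoeffList.mul (CoeffList.mul [[c.factor]] (c.h 2)) (g 0)))) &&
  decide (CoeffList.form (c.point 0) (c.point 1) (c.point 2) (c.total - c.deg 2) (c.h 2) ≠ 0)

end ThreeGenerators

-- The hypothesis `hdeg` says that `ρ 0 × ρ 1` and `h 2` times the gradient have the same degree. It
-- is needed for passing from the identity of dehomogenizations to that of the forms.
open PlaneForm in
theorem hasThreeGenerators_of_check {d : ℕ} {l : List PlaneForm} {g : Fin 3 → CoeffList}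
    (hF : IsReducedCurve d (prodPoly l)) (hg : ∀ i, prodGradCoeffs i l = g i)
    (hd : prodDegree l = d) (c : ThreeGenerators) (hc : c.check g = true)
    (hdeg : c.deg 0 + c.deg 1 = c.total - c.deg 2 + (d - 1))
    (hpt : prodGrad c.point 0 l ≠ 0) : HasThreeGenerators (prodPoly l) := by
  simp only [ThreeGenerators.check, Bool.and_eq_true, List.all_eq_true, decide_eq_true_eq,
    List.mem_finRange, forall_const] at hc
  obtain ⟨⟨⟨hk, hfac⟩, hcr⟩, hpoint⟩ := hc
  have hρ := fun k => (hk k).1.1.1.1.1.1.1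
  have hfit := fun k => (hk k).1.1.1.1.1.1.2
  have hle := fun k => (hk k).1.1.1.1.1.2
  have hrel := fun k => (hk k).1.1.1.1.2
  have hbez := fun k => (hk k).1.1.1.2
  have hcoe := fun k => (hk k).1.1.2
  have hpow := fun k => (hk k).1.2
  have hu := fun k j => (hk k).2 j
  have Rρ : ∀ k i, Represents (c.deg k) (CoeffList.toPoly (c.deg k) (c.ρ k i)) (c.ρ k i) :=
    fun k i => Represents.toPoly (fits_of_checkSyzygy (hρ k) i)
  have Rh : ∀ k, Represents (c.total - c.deg k)
      (CoeffList.toPoly (c.total - c.deg k) (c.h k)) (c.h k) :=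
    fun k => Represents.toPoly (hfit k)
  have Rg : ∀ i, Represents (d - 1) (pderiv i (prodPoly l)) (g i) := fun i =>
    hd ▸ Represents.pderiv_prodPoly l i (hg i)
  have hmem : ∀ j, X j ^ c.power ∈ Ideal.span (Set.range fun k =>
      CoeffList.toPoly (c.total - c.deg k) (c.h k)) := by
    intro j
    have hsum := (((Represents.dot (fun k => Represents.toPoly (hu j k)) Rh (d := c.power)
      fun k => by have := hle k; have := hpow k; omega).add
      (ThreeGenerators.represents_powerCoeffs (c.coefficient j) c.power j).neg).eq_zero (hbez j))
    have hinv : C ((c.coefficient j : ℂ)⁻¹) * (c.coefficient j : PolyS) = 1 := by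
      rw [← map_intCast (C : ℂ →+* PolyS), ← C_mul, inv_mul_cancel₀ (by exact_mod_cast hcoe j), C_1]
    refine Ideal.mem_span_range_iff_exists_fun.mpr ⟨fun k => C ((c.coefficient j : ℂ)⁻¹) *
      CoeffList.toPoly (c.power + c.deg k - c.total) (c.u j k), ?_⟩
    rw [Fin.sum_univ_three]
    linear_combination C ((c.coefficient j : ℂ)⁻¹) * hsum + X j ^ c.power * hinv
  refine hF.hasThreeGenerators (fun k => mem_jacobianSyzygies_of_check hg (hρ k))
    (h := fun k => CoeffList.toPoly (c.total - c.deg k) (c.h k)) (c := c.factor) ?_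
    (by exact_mod_cast hfac) ?_ ?_ ?_ (hmem 0) (hmem 1) (hmem 2)
  · intro i
    exact (Represents.dot Rh (fun k => Rρ k i) (d := c.total) fun k => by
      have := hle k; omega).eq_zero (hrel i)
  · intro h0
    have := congrArg (eval fun i => (c.point i : ℂ)) h0
    rw [CoeffList.eval_toPoly_intCast, map_zero] at this
    exact hpoint (by exact_mod_cast this)
  · intro h0
    have := congrArg (eval fun i => (c.point i : ℂ)) h0
    rw [eval_pderiv_prodPoly, prodGrad_intCast, map_zero] at this
    exact hpt (by exact_mod_cast this)
  · have hC : (C (c.factor : ℂ) : PolyS) = (c.factor : PolyS) := map_intCast C _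
    have hz := (((((Rρ 0 1).mul (Rρ 1 2)).add (((Rρ 0 2).mul (Rρ 1 1)).neg)).add
      ((((Represents.intCast c.factor).mul (Rh 2)).mul (Rg 0)).cast
        (by omega)).neg).eq_zero hcr)
    rw [hC]
    linear_combination hz

/-! ### Certificates against three generators. -/

/-- Data for the absence of syzygies of degree `n`: a list of points, and the resulting conditions
on the coefficients of a syzygy modulo the prime `p` with an inverse matrix. -/
structure NoSyzygies : Type where
  p : ℕ
  pts : List (Fin 3 → ℤ)
  A : List (List ℤ)
  B : List (List ℤ)

/-- The data verify that the product of the forms `l` has no syzygies of degree `n`. -/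
structure NoSyzygies.Valid (c : NoSyzygies) (l : List PlaneForm) (n : ℕ) : Prop where
  prime : c.p.Prime
  length : c.pts.length = 3 * (exponents n).length
  rows : (c.pts.map fun v => reduceRow c.p (syzygyRow (monomialValues (exponents n) v)
    fun i => PlaneForm.prodGrad v i l)) = c.A
  inverse : isLeftInverse c.p (3 * (exponents n).length) c.A 0 c.B = true

theorem NoSyzygies.Valid.hasOrder {c : NoSyzygies} {l : List PlaneForm} {n : ℕ}
    (h : c.Valid l n) : ∀ a ∈ jacobianSyzygies (PlaneForm.prodPoly l), ∀ i,
      HasOrder (n + 1) (a i) := by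
  have := Fact.mk h.prime
  intro a ha i
  refine hasOrder_of_no_syzygies (PlaneForm.isHomogeneous_prodPoly l) (fun a ha hn => ?_) ha i
  exact no_syzygies_of_isLeftInverse (g := fun v i => PlaneForm.prodGrad v i l)
    (fun v i => by rw [PlaneForm.eval_pderiv_prodPoly, PlaneForm.prodGrad_intCast])
    rfl h.length h.rows h.inverse ha hn

/-- Data for the independence of the vectors `ρ k` of forms of degree `n`: values of certain
entries at certain points, modulo the prime `p`, with an inverse matrix. -/
structure Independence (r : ℕ) : Type where
  ρ : Fin r → Fin 3 → CoeffList
  idx : Fin r → Fin 3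
  pts : Fin r → Fin 3 → ℤ
  p : ℕ
  A : List (List ℤ)
  B : List (List ℤ)

namespace Independence

variable {r : ℕ}

/-- The values of the entries. -/
def rows (c : Independence r) (n : ℕ) : List (List ℤ) :=
  List.ofFn fun l => List.ofFn fun k =>
    CoeffList.form (c.pts k 0) (c.pts k 1) (c.pts k 2) n (c.ρ l (c.idx k))

/-- The data verify that the `ρ k` are independent and are orthogonal to `g`. -/
structure Valid (c : Independence r) (g : Fin 3 → CoeffList) (n : ℕ) : Prop where
  syzygy : ∀ l, checkSyzygy g n (c.ρ l) = true
  prime : c.p.Prime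
  rows : (c.rows n).map (reduceRow c.p) = c.A
  inverse : isLeftInverse c.p r c.A 0 c.B = true

theorem Valid.det_ne_zero {c : Independence r} {g : Fin 3 → CoeffList} {n : ℕ}
    (h : c.Valid g n) : (Matrix.of fun l k => eval (fun i => (c.pts k i : ℂ))
      (CoeffList.toPoly n (c.ρ l (c.idx k)))).det ≠ 0 := by
  have := Fact.mk h.prime
  have hdet := det_ne_zero_of_isLeftInverse (p := c.p) (K := r) (rows := c.rows n)
    (by simp [Independence.rows]) h.rows h.inverse
  convert hdet using 4 with l
  funext k
  rw [CoeffList.eval_toPoly_intCast]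
  simp [Independence.rows, List.getD_eq_getElem?_getD]
  rfl

end Independence

/-- Absence in degree `n` makes all syzygies have order at least `n + 1`, which is therefore the
degree of the independent ones. -/
theorem not_hasThreeGenerators_of_independence {l : List PlaneForm} {g : Fin 3 → CoeffList}
    (hg : ∀ i, PlaneForm.prodGradCoeffs i l = g i) {n : ℕ} {s : NoSyzygies} (hs : s.Valid l n)
    {c : Independence 4} (hc : c.Valid g (n + 1)) :
    ¬ HasThreeGenerators (PlaneForm.prodPoly l) :=
  not_hasThreeGenerators_of_four hs.hasOrder
    (fun k => mem_jacobianSyzygies_of_check hg (hc.syzygy k))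
    (fun _ _ => CoeffList.isHomogeneous_toPoly _ _) c.idx _ hc.det_ne_zero

theorem not_hasThreeGenerators_of_value {l : List PlaneForm} {g : Fin 3 → CoeffList}
    (hg : ∀ i, PlaneForm.prodGradCoeffs i l = g i) {n : ℕ} {s : NoSyzygies} (hs : s.Valid l n)
    {c : Independence 3} (hc : c.Valid g (n + 1)) {m : ℕ} {τ : Fin 3 → CoeffList}
    (hτ : checkSyzygy g m τ = true) {p κ : Fin 3 → ℤ}
    (hκ : ∀ k, κ 0 * CoeffList.form (p 0) (p 1) (p 2) (n + 1) (c.ρ k 0) +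
      κ 1 * CoeffList.form (p 0) (p 1) (p 2) (n + 1) (c.ρ k 1) +
      κ 2 * CoeffList.form (p 0) (p 1) (p 2) (n + 1) (c.ρ k 2) = 0)
    (hκτ : κ 0 * CoeffList.form (p 0) (p 1) (p 2) m (τ 0) +
      κ 1 * CoeffList.form (p 0) (p 1) (p 2) m (τ 1) +
      κ 2 * CoeffList.form (p 0) (p 1) (p 2) m (τ 2) ≠ 0) :
    ¬ HasThreeGenerators (PlaneForm.prodPoly l) := by
  refine not_hasThreeGenerators_of_point hs.hasOrder
    (fun k => mem_jacobianSyzygies_of_check hg (hc.syzygy k))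
    (fun _ _ => CoeffList.isHomogeneous_toPoly _ _) c.idx _ hc.det_ne_zero
    (mem_jacobianSyzygies_of_check hg hτ) (fun _ => CoeffList.isHomogeneous_toPoly _ _)
    (p := fun i => (p i : ℂ)) (κ := fun i => (κ i : ℂ)) (fun k => ?_) ?_
  · simp only [Fin.sum_univ_three, CoeffList.eval_toPoly_intCast]
    exact_mod_cast hκ k
  · simp only [Fin.sum_univ_three, CoeffList.eval_toPoly_intCast]
    exact_mod_cast hκτ

/-! ## Charts of the projective plane -/

/-- The determinant of three vectors. -/
def det3 {R : Type*} [CommRing R] (a b c : Fin 3 → R) : R :=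
  a 0 * (b 1 * c 2 - b 2 * c 1) - a 1 * (b 0 * c 2 - b 2 * c 0) + a 2 * (b 0 * c 1 - b 1 * c 0)

theorem det3_cramer {R : Type*} [CommRing R] (a b c w : Fin 3 → R) :
    det3 a b c • w = det3 w b c • a + det3 a w c • b + det3 a b w • c := by
  funext i
  simp only [det3, Pi.smul_apply, Pi.add_apply, smul_eq_mul]
  fin_cases i <;> simp only [Fin.isValue, Fin.zero_eta, Fin.mk_one, Fin.reduceFinMk] <;> ring

theorem det3_smul_left {R : Type*} [CommRing R] (t : R) (a b c : Fin 3 → R) :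
    det3 (t • a) b c = t * det3 a b c := by
  simp only [det3, Pi.smul_apply, smul_eq_mul]
  ring

theorem det3_smul_middle {R : Type*} [CommRing R] (t : R) (a b c : Fin 3 → R) :
    det3 a (t • b) c = t * det3 a b c := by
  simp only [det3, Pi.smul_apply, smul_eq_mul]
  ring

theorem det3_smul_right {R : Type*} [CommRing R] (t : R) (a b c : Fin 3 → R) :
    det3 a b (t • c) = t * det3 a b c := by
  simp only [det3, Pi.smul_apply, smul_eq_mul]
  ring

@[fun_prop]
theorem continuous_det3 {X : Type*} [TopologicalSpace X] {f g h : X → Fin 3 → ℂ}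
    (hf : Continuous f) (hg : Continuous g) (hh : Continuous h) :
    Continuous fun x => det3 (f x) (g x) (h x) := by
  unfold det3
  fun_prop

/-- The quotient map to the projective plane. -/
noncomputable def toPP2 (v : {v : Fin 3 → ℂ // v ≠ 0}) : PP2 := Projectivization.mk ℂ v.1 v.2

theorem isQuotientMap_toPP2 : Topology.IsQuotientMap toPP2 := by
  exact ⟨⟨rfl⟩, fun P => ⟨⟨P.rep, P.rep_nonzero⟩, P.mk_rep⟩⟩

theorem exists_rep_eq_smul {v : Fin 3 → ℂ} (hv : v ≠ 0) :
    ∃ a : ℂ, a ≠ 0 ∧ (Projectivization.mk ℂ v hv).rep = a • v := by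
  obtain ⟨a, ha⟩ := Projectivization.exists_smul_eq_mk_rep ℂ v hv
  exact ⟨a, a.ne_zero, ha.symm⟩

/-- Affine coordinates of the projective plane around a point. -/
theorem exists_chart {v τ ν : Fin 3 → ℂ} (hv : v ≠ 0) (h : det3 v τ ν ≠ 0) :
    ∃ φ : OpenPartialHomeomorph PP2 (ℂ × ℂ),
      Projectivization.mk ℂ v hv ∈ φ.source ∧ φ (Projectivization.mk ℂ v hv) = 0 ∧
      ∀ x ∈ φ.source, ∃ a : ℂ, a ≠ 0 ∧ x.rep = a • (v + (φ x).1 • τ + (φ x).2 • ν) := by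
  have hα : ∀ s r : ℂ, det3 (v + s • τ + r • ν) τ ν = det3 v τ ν := by
    intro s r
    simp only [det3, Pi.add_apply, Pi.smul_apply, smul_eq_mul]
    ring
  have hβ : ∀ s r : ℂ, det3 v (v + s • τ + r • ν) ν = s * det3 v τ ν := by
    intro s r
    simp only [det3, Pi.add_apply, Pi.smul_apply, smul_eq_mul]
    ring
  have hγ : ∀ s r : ℂ, det3 v τ (v + s • τ + r • ν) = r * det3 v τ ν := by
    intro s r
    simp only [det3, Pi.add_apply, Pi.smul_apply, smul_eq_mul]
    ring
  have hne : ∀ s r : ℂ, v + s • τ + r • ν ≠ 0 := by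
    intro s r h0
    have := hα s r
    rw [h0] at this
    exact h (by rw [← this]; simp [det3])
  -- By Cramer's rule, these are the coordinates of `w` in the basis `v, τ, ν` after scaling the
  -- coefficient of `v` to one.
  let f : (Fin 3 → ℂ) → ℂ × ℂ := fun w =>
    (det3 v w ν / det3 w τ ν, det3 v τ w / det3 w τ ν)
  have hf : ∀ (a : ℂ), a ≠ 0 → ∀ w, f (a • w) = f w := by
    intro a ha w
    simp only [f, det3_smul_left, det3_smul_middle, det3_smul_right,
      mul_div_mul_left _ _ ha]
  have hfv : ∀ s r : ℂ, f (v + s • τ + r • ν) = (s, r) := by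
    intro s r
    simp only [f, hα, hβ, hγ, mul_div_cancel_right₀ _ h]
  have hfr : ∀ (w : Fin 3 → ℂ) (hw : w ≠ 0), f (Projectivization.mk ℂ w hw).rep = f w := by
    intro w hw
    obtain ⟨a, ha, hr⟩ := exists_rep_eq_smul hw
    rw [hr, hf a ha]
  -- The complement of the line through the points `τ` and `ν`.
  let S : Set PP2 := {x | det3 x.rep τ ν ≠ 0}
  have hS : toPP2 ⁻¹' S = {w | det3 w.1 τ ν ≠ 0} := by
    ext w
    obtain ⟨a, ha, hr⟩ := exists_rep_eq_smul w.2
    change det3 (Projectivization.mk ℂ w.1 w.2).rep τ ν ≠ 0 ↔ _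
    rw [hr, det3_smul_left]
    simp [ha]
  have hSo : IsOpen S := by
    rw [← isQuotientMap_toPP2.isOpen_preimage, hS]
    exact isOpen_ne_fun (by fun_prop) continuous_const
  let φ : OpenPartialHomeomorph PP2 (ℂ × ℂ) :=
    { toFun := fun x => f x.rep
      invFun := fun y => Projectivization.mk ℂ (v + y.1 • τ + y.2 • ν) (hne _ _)
      source := S
      target := Set.univ
      map_source' := fun _ _ => Set.mem_univ _
      map_target' := fun y _ => by
        obtain ⟨a, ha, hr⟩ := exists_rep_eq_smul (hne y.1 y.2)
        change det3 _ τ ν ≠ 0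
        rw [hr, det3_smul_left, hα]
        exact mul_ne_zero ha h
      left_inv' := fun x hx => by
        have hx' : det3 x.rep τ ν ≠ 0 := hx
        conv_rhs => rw [← x.mk_rep]
        rw [Projectivization.mk_eq_mk_iff']
        refine ⟨det3 v τ ν / det3 x.rep τ ν, ?_⟩
        rw [div_eq_inv_mul, mul_smul, det3_cramer, smul_add, smul_add, smul_smul, smul_smul,
          smul_smul, inv_mul_cancel₀ hx', one_smul, ← div_eq_inv_mul, ← div_eq_inv_mul]
      right_inv' := fun y _ => by
        rw [hfr, hfv]
      open_source := hSo
      open_target := isOpen_univ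
      continuousOn_toFun := by
        -- Continuity is tested on the space of nonzero vectors, where `f` is a quotient of
        -- determinants; `x.rep` itself need not depend continuously on `x`.
        rw [isQuotientMap_toPP2.continuousOn_isOpen_iff hSo, hS]
        have : ContinuousOn (fun w : {v : Fin 3 → ℂ // v ≠ 0} => f w.1)
            {w | det3 w.1 τ ν ≠ 0} := by
          refine ContinuousOn.prodMk ?_ ?_ <;>
            exact ContinuousOn.div (Continuous.continuousOn (by fun_prop))
              (Continuous.continuousOn (by fun_prop)) fun w hw => hw
        exact this.congr fun w _ => hfr w.1 w.2
      continuousOn_invFun := by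
        refine Continuous.continuousOn ?_
        have h1 : Continuous fun y : ℂ × ℂ =>
            (⟨v + y.1 • τ + y.2 • ν, hne _ _⟩ : {v : Fin 3 → ℂ // v ≠ 0}) :=
          Continuous.subtype_mk (by fun_prop) _
        exact isQuotientMap_toPP2.continuous.comp h1 }
  have hv0 : v = v + (0 : ℂ) • τ + (0 : ℂ) • ν := by simp
  refine ⟨φ, ?_, ?_, fun x hx => ?_⟩
  · obtain ⟨a, ha, hr⟩ := exists_rep_eq_smul hv
    change det3 _ τ ν ≠ 0
    rw [hr, det3_smul_left]
    exact mul_ne_zero ha h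
  · change f _ = 0
    rw [hfr, hv0, hfv]
    rfl
  · have hx' : det3 x.rep τ ν ≠ 0 := hx
    refine ⟨det3 x.rep τ ν / det3 v τ ν, div_ne_zero hx' h, ?_⟩
    change x.rep = (det3 x.rep τ ν / det3 v τ ν) • (v +
      (det3 v x.rep ν / det3 x.rep τ ν) • τ + (det3 v τ x.rep / det3 x.rep τ ν) • ν)
    have h1 : x.rep = (det3 v τ ν)⁻¹ • (det3 v τ ν • x.rep) := by
      rw [smul_smul, inv_mul_cancel₀ h, one_smul]
    conv_lhs => rw [h1, det3_cramer]
    simp only [smul_add, smul_smul]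
    congr 1
    · congr 1
      · rw [div_eq_inv_mul]
      · congr 1
        field_simp
    · congr 1
      field_simp

theorem mem_locus_mk {F : PolyS} {d : ℕ} (hF : F.IsHomogeneous d) {v : Fin 3 → ℂ} (hv : v ≠ 0) :
    Projectivization.mk ℂ v hv ∈ locus F ↔ eval v F = 0 := by
  obtain ⟨a, ha, hr⟩ := exists_rep_eq_smul hv
  change eval _ F = 0 ↔ _
  rw [hr, eval_smul_of_isHomogeneous hF]
  simp [ha]

theorem gradAt_mk {F : PolyS} {d : ℕ} (hF : F.IsHomogeneous d) {v : Fin 3 → ℂ} (hv : v ≠ 0) :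
    ∃ a : ℂ, a ≠ 0 ∧ gradAt F (Projectivization.mk ℂ v hv) = a • fun i => eval v (pderiv i F) := by
  obtain ⟨a, ha, hr⟩ := exists_rep_eq_smul hv
  refine ⟨a ^ (d - 1), pow_ne_zero _ ha, funext fun i => ?_⟩
  rw [gradAt, hr, eval_smul_of_isHomogeneous hF.pderiv]
  rfl

/-! ## Local models -/

/-- The germs at `P` of the curves `F i` look like the germs of the sets `B i` at the origin. -/
def HasLocalModel {n : ℕ} (F : Fin n → PolyS) (P : PP2) (B : Fin n → Set (ℂ × ℂ)) : Prop :=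
  ∃ h : OpenPartialHomeomorph PP2 (ℂ × ℂ), P ∈ h.source ∧ h P = 0 ∧
    ∀ i, ∀ x ∈ h.source, x ∈ locus (F i) ↔ h x ∈ B i

/-- One chart followed by the inverse of the other, which is possible because both lead to the same
model `B` for every component simultaneously. -/
theorem HasLocalModel.exists_homeomorph {n : ℕ} {F G : Fin n → PolyS} {P Q : PP2}
    {B : Fin n → Set (ℂ × ℂ)} (hF : HasLocalModel F P B) (hG : HasLocalModel G Q B) :
    ∃ h : OpenPartialHomeomorph PP2 PP2, P ∈ h.source ∧ h P = Q ∧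
      ∀ i, ∀ x ∈ h.source, x ∈ locus (F i) ↔ h x ∈ locus (G i) := by
  obtain ⟨h, hP, hP0, hh⟩ := hF
  obtain ⟨k, hQ, hQ0, hk⟩ := hG
  refine ⟨h.trans k.symm, ?_, ?_, fun i x hx => ?_⟩
  · rw [OpenPartialHomeomorph.trans_source]
    refine ⟨hP, ?_⟩
    rw [Set.mem_preimage, hP0, ← hQ0]
    exact k.map_source hQ
  · rw [OpenPartialHomeomorph.trans_apply, hP0, ← hQ0, k.left_inv hQ]
  · rw [OpenPartialHomeomorph.trans_source] at hx
    rw [hh i x hx.1, OpenPartialHomeomorph.trans_apply, hk i _ (k.map_target hx.2),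
      k.right_inv hx.2]

/-- A local model from affine coordinates and local coordinates at the origin. -/
theorem HasLocalModel.of_coordinates {n : ℕ} {F : Fin n → PolyS} {d : Fin n → ℕ}
    (hF : ∀ i, (F i).IsHomogeneous (d i)) {v τ ν : Fin 3 → ℂ} (hv : v ≠ 0) (h : det3 v τ ν ≠ 0)
    {e : ℂ × ℂ → ℂ × ℂ} {a b : ℂ} (ha : a ≠ 0) (hb : b ≠ 0)
    (he₁ : HasStrictFDerivAt (fun x => (e x).1) (a • ContinuousLinearMap.fst ℂ ℂ ℂ) 0)
    (he₂ : HasStrictFDerivAt (fun x => (e x).2) (b • ContinuousLinearMap.snd ℂ ℂ ℂ) 0)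
    (he0 : e 0 = 0) {B : Fin n → Set (ℂ × ℂ)}
    (hB : ∀ i, ∀ᶠ x in nhds (0 : ℂ × ℂ),
      eval (v + x.1 • τ + x.2 • ν) (F i) = 0 ↔ e x ∈ B i) :
    HasLocalModel F (Projectivization.mk ℂ v hv) B := by
  obtain ⟨φ, hφv, hφ0, hφ⟩ := exists_chart hv h
  -- The derivative of `e` at the origin is diagonal with entries `a` and `b`, so the inverse
  -- function theorem applies.
  let L : (ℂ × ℂ) ≃L[ℂ] (ℂ × ℂ) := ContinuousLinearEquiv.prodCongr
    (ContinuousLinearEquiv.unitsEquivAut ℂ (Units.mk0 a ha))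
    (ContinuousLinearEquiv.unitsEquivAut ℂ (Units.mk0 b hb))
  have hL : HasStrictFDerivAt e (L : (ℂ × ℂ) →L[ℂ] (ℂ × ℂ)) 0 := by
    have hLe : (L : (ℂ × ℂ) →L[ℂ] (ℂ × ℂ)) =
        (a • ContinuousLinearMap.fst ℂ ℂ ℂ).prod (b • ContinuousLinearMap.snd ℂ ℂ ℂ) := by
      ext <;> simp [L]
    rw [hLe]
    exact he₁.prodMk he₂
  let ψ := hL.toOpenPartialHomeomorph e
  -- There are finitely many components, so one neighbourhood serves all of them.
  obtain ⟨U, hU, hUo, h0U⟩ := eventually_nhds_iff.mp (Filter.eventually_all.mpr hB)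
  let k := (φ.trans ψ)
  have hk : IsOpen (φ.source ∩ φ ⁻¹' U) := φ.isOpen_inter_preimage hUo
  refine ⟨k.restrOpen _ hk, ?_, ?_, fun i x hx => ?_⟩
  · rw [OpenPartialHomeomorph.restrOpen_source, OpenPartialHomeomorph.trans_source]
    refine ⟨⟨hφv, ?_⟩, hφv, ?_⟩
    · rw [Set.mem_preimage, hφ0]
      exact hL.mem_toOpenPartialHomeomorph_source
    · rw [Set.mem_preimage, hφ0]
      exact h0U
  · change e (φ _) = 0
    rw [hφ0, he0]
  · rw [OpenPartialHomeomorph.restrOpen_source, OpenPartialHomeomorph.trans_source] at hx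
    obtain ⟨c, hc, hx'⟩ := hφ x hx.2.1
    change eval x.rep (F i) = 0 ↔ e (φ x) ∈ B i
    rw [← hU _ hx.2.2 i, hx', eval_smul_of_isHomogeneous (hF i)]
    simp [hc]

/-! ## Nodes, tacnodes and triple points -/

/-- A singular point of an arrangement of `n` curves: a node or a tacnode on the two given curves,
or an ordinary triple point on the three given curves. -/
inductive PointType (n : ℕ) : Type
  | node (i j : Fin n)
  | tacnode (i j : Fin n)
  | triple (i j k : Fin n)

namespace PointType

variable {n : ℕ}

/-- The curves through the point. -/
def curves : PointType n → List (Fin n)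
  | node i j => [i, j]
  | tacnode i j => [i, j]
  | triple i j k => [i, j, k]

/-- The curves through the point near the origin of suitable coordinates. -/
def model : PointType n → Fin n → Set (ℂ × ℂ)
  | node i j, l => if l = i then {u | u.1 = 0} else if l = j then {u | u.2 = 0} else ∅
  | tacnode i j, l =>
    if l = i then {u | u.1 = 0} else if l = j then {u | u.1 + u.2 ^ 2 = 0} else ∅
  | triple i j k, l =>
    if l = i then {u | u.1 = 0} else if l = j then {u | u.2 = 0} else
      if l = k then {u | u.1 + u.2 = 0} else ∅

/-- Whether the curves `i` and `j` are tangent at the point. -/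
def tangent : PointType n → Fin n → Fin n → Bool
  | tacnode i j, k, l => (k == i && l == j) || (k == j && l == i)
  | _, _, _ => false

end PointType

/-- A quadratic polynomial in two variables without constant term. -/
def quadratic (a b c d e : ℂ) (x : ℂ × ℂ) : ℂ :=
  a * x.1 + b * x.2 + c * x.1 ^ 2 + d * (x.1 * x.2) + e * x.2 ^ 2

theorem quadratic_zero (a b c d e : ℂ) : quadratic a b c d e 0 = 0 := by simp [quadratic]

theorem hasStrictFDerivAt_quadratic (a b c d e : ℂ) :
    HasStrictFDerivAt (quadratic a b c d e)
      (a • ContinuousLinearMap.fst ℂ ℂ ℂ + b • ContinuousLinearMap.snd ℂ ℂ ℂ) 0 := by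
  have h1 : HasStrictFDerivAt (fun x : ℂ × ℂ => x.1) (ContinuousLinearMap.fst ℂ ℂ ℂ) 0 :=
    hasStrictFDerivAt_fst
  have h2 : HasStrictFDerivAt (fun x : ℂ × ℂ => x.2) (ContinuousLinearMap.snd ℂ ℂ ℂ) 0 :=
    hasStrictFDerivAt_snd
  have := ((((h1.const_mul a).add (h2.const_mul b)).add ((h1.pow 2).const_mul c)).add
    ((h1.mul h2).const_mul d)).add ((h2.pow 2).const_mul e)
  refine this.congr_fderiv ?_
  ext <;> simp

/-- At a zero of `q` the product rule leaves only `g 0` times the derivative of `q`. So local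
equations may be multiplied by units without spoiling their role as coordinates. -/
theorem HasStrictFDerivAt.mul_of_eq_zero {g q : ℂ × ℂ → ℂ} {L : ℂ × ℂ →L[ℂ] ℂ}
    (hg : ContDiff ℂ 1 g) (hq : HasStrictFDerivAt q L 0) (h0 : q 0 = 0) :
    HasStrictFDerivAt (fun x => g x * q x) (g 0 • L) 0 := by
  have := (hg.contDiffAt.hasStrictFDerivAt (x := 0) one_ne_zero).mul hq
  refine this.congr_fderiv ?_
  exact ContinuousLinearMap.ext fun y => by simp [h0]

section LocalModels

variable {n : ℕ} {F : Fin n → PolyS} {deg : Fin n → ℕ} {v τ ν : Fin 3 → ℂ}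

theorem eventually_of_eval_ne_zero {G : PolyS} (h : eval v G ≠ 0) {e : ℂ × ℂ → ℂ × ℂ} :
    ∀ᶠ x in nhds (0 : ℂ × ℂ), eval (v + x.1 • τ + x.2 • ν) G = 0 ↔ e x ∈ (∅ : Set (ℂ × ℂ)) := by
  have hc : Continuous fun x : ℂ × ℂ => eval (v + x.1 • τ + x.2 • ν) G :=
    (MvPolynomial.continuous_eval G).comp (by fun_prop)
  filter_upwards [hc.continuousAt.eventually_ne (y := 0) (by simpa using h)] with x hx
  simpa using hx

/-- The two local equations themselves serve as coordinates; the directions `τ` and `ν` are such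
that their linear parts are multiples of the two coordinate functions. -/
theorem hasLocalModel_node (hF : ∀ i, (F i).IsHomogeneous (deg i)) (hv : v ≠ 0)
    (h : det3 v τ ν ≠ 0) {i j : Fin n} {a c d e b c' d' e' : ℂ} (ha : a ≠ 0) (hb : b ≠ 0)
    (hi : ∀ x : ℂ × ℂ, eval (v + x.1 • τ + x.2 • ν) (F i) = quadratic a 0 c d e x)
    (hj : ∀ x : ℂ × ℂ, eval (v + x.1 • τ + x.2 • ν) (F j) = quadratic 0 b c' d' e' x)
    (hl : ∀ l, l ≠ i → l ≠ j → eval v (F l) ≠ 0) :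
    HasLocalModel F (Projectivization.mk ℂ v hv) (PointType.model (.node i j)) := by
  refine HasLocalModel.of_coordinates hF hv h (a := a) (b := b)
    (e := fun x => (quadratic a 0 c d e x, quadratic 0 b c' d' e' x)) ha hb ?_ ?_ ?_ fun l => ?_
  · exact (hasStrictFDerivAt_quadratic a 0 c d e).congr_fderiv (by ext <;> simp)
  · exact (hasStrictFDerivAt_quadratic 0 b c' d' e').congr_fderiv (by ext <;> simp)
  · simp [quadratic_zero]
  · by_cases hli : l = i
    · subst hli
      exact .of_forall fun x => by simp [PointType.model, hi]
    by_cases hlj : l = j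
    · subst hlj
      exact .of_forall fun x => by simp [PointType.model, hj, hli]
    simp only [PointType.model, hli, hlj, if_false]
    exact eventually_of_eval_ne_zero (hl l hli hlj)

/-- With `x, y` the affine coordinates, the branches are `f = U x + e y²` and `g = V x + e' y²` with
units `U` and `V`. For `K = e' U - e V` this gives `U g = V f + K y²`, and after multiplication by
`K` the last term is the square of `K y`. Thus `K V f` and `K y` are coordinates that produce the
model, and no square root has to be extracted. The condition `hK` says that `K` is a unit, that is,
the contact is of order exactly two. -/
theorem hasLocalModel_tacnode (hF : ∀ i, (F i).IsHomogeneous (deg i)) (hv : v ≠ 0)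
    (h : det3 v τ ν ≠ 0) {i j : Fin n} {a c d e a' c' d' e' : ℂ} (ha : a ≠ 0) (ha' : a' ≠ 0)
    (hi : ∀ x : ℂ × ℂ, eval (v + x.1 • τ + x.2 • ν) (F i) = quadratic a 0 c d e x)
    (hj : ∀ x : ℂ × ℂ, eval (v + x.1 • τ + x.2 • ν) (F j) = quadratic a' 0 c' d' e' x)
    (hK : e' * a - e * a' ≠ 0) (hl : ∀ l, l ≠ i → l ≠ j → eval v (F l) ≠ 0) :
    HasLocalModel F (Projectivization.mk ℂ v hv) (PointType.model (.tacnode i j)) := by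
  let U : ℂ × ℂ → ℂ := fun x => a + c * x.1 + d * x.2
  let V : ℂ × ℂ → ℂ := fun x => a' + c' * x.1 + d' * x.2
  let K : ℂ × ℂ → ℂ := fun x => e' * U x - e * V x
  have hU : ContDiff ℂ 1 U := by fun_prop
  have hV : ContDiff ℂ 1 V := by fun_prop
  have hKc : ContDiff ℂ 1 K := by fun_prop
  have hU0 : U 0 = a := by simp [U]
  have hV0 : V 0 = a' := by simp [V]
  have hK0 : K 0 ≠ 0 := by simpa [K, hU0, hV0] using hK
  refine HasLocalModel.of_coordinates hF hv h (a := K 0 * V 0 * a) (b := K 0)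
    (e := fun x => (K x * V x * quadratic a 0 c d e x, K x * x.2)) ?_ hK0 ?_ ?_ ?_ fun l => ?_
  · exact mul_ne_zero (mul_ne_zero hK0 (hV0 ▸ ha')) ha
  · have := HasStrictFDerivAt.mul_of_eq_zero (hKc.mul hV) (hasStrictFDerivAt_quadratic a 0 c d e)
      (quadratic_zero _ _ _ _ _)
    exact this.congr_fderiv (by ext <;> simp)
  · exact HasStrictFDerivAt.mul_of_eq_zero hKc hasStrictFDerivAt_snd rfl
  · simp [quadratic_zero]
  · have evK := hKc.continuous.continuousAt.eventually_ne hK0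
    have evV := hV.continuous.continuousAt.eventually_ne (hV0.symm ▸ ha' : V 0 ≠ 0)
    have evU := hU.continuous.continuousAt.eventually_ne (hU0.symm ▸ ha : U 0 ≠ 0)
    by_cases hli : l = i
    · subst hli
      filter_upwards [evK, evV] with x hKx hVx
      simp [PointType.model, hi, hKx, hVx]
    by_cases hlj : l = j
    · subst hlj
      filter_upwards [evK, evU] with x hKx hUx
      simp only [PointType.model, hli, if_false, if_true, Set.mem_ofPred_eq, hj]
      have key : K x * U x * quadratic a' 0 c' d' e' x =
          K x * V x * quadratic a 0 c d e x + (K x * x.2) ^ 2 := by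
        simp only [quadratic, K, U, V]
        ring
      rw [← key]
      simp [hKx, hUx]
    simp only [PointType.model, hli, hlj, if_false]
    exact eventually_of_eval_ne_zero (hl l hli hlj)

/-- With `x, y` the affine coordinates, the first two branches are `f = U x + e y²` and `g = V y +
c' x²`, and the third is `X x + Y y`. Solving the first two equations for `x` and `y` by Cramer's
rule, with determinant `Δ`, turns `Δ` times the third into `A f + B g`. All of `Δ`, `A`, `B` are
units because the three tangents are distinct, so `A f` and `B g` are coordinates in which the third
branch is the antidiagonal. -/
theorem hasLocalModel_triple (hF : ∀ i, (F i).IsHomogeneous (deg i)) (hv : v ≠ 0)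
    (h : det3 v τ ν ≠ 0) {i j k : Fin n} {a c d e b c' d' e' α β γ δ ε : ℂ} (ha : a ≠ 0)
    (hb : b ≠ 0) (hα : α ≠ 0) (hβ : β ≠ 0)
    (hi : ∀ x : ℂ × ℂ, eval (v + x.1 • τ + x.2 • ν) (F i) = quadratic a 0 c d e x)
    (hj : ∀ x : ℂ × ℂ, eval (v + x.1 • τ + x.2 • ν) (F j) = quadratic 0 b c' d' e' x)
    (hk : ∀ x : ℂ × ℂ, eval (v + x.1 • τ + x.2 • ν) (F k) = quadratic α β γ δ ε x)
    (hl : ∀ l, l ≠ i → l ≠ j → l ≠ k → eval v (F l) ≠ 0) :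
    HasLocalModel F (Projectivization.mk ℂ v hv) (PointType.model (.triple i j k)) := by
  let U : ℂ × ℂ → ℂ := fun x => a + c * x.1 + d * x.2
  let V : ℂ × ℂ → ℂ := fun x => b + d' * x.1 + e' * x.2
  let X : ℂ × ℂ → ℂ := fun x => α + γ * x.1 + δ * x.2
  let Y : ℂ × ℂ → ℂ := fun x => β + ε * x.2
  let Δ : ℂ × ℂ → ℂ := fun x => U x * V x - e * c' * x.1 * x.2
  let A : ℂ × ℂ → ℂ := fun x => V x * X x - c' * x.1 * Y x
  let B : ℂ × ℂ → ℂ := fun x => U x * Y x - e * x.2 * X x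
  have hΔ : ContDiff ℂ 1 Δ := by fun_prop
  have hA : ContDiff ℂ 1 A := by fun_prop
  have hB : ContDiff ℂ 1 B := by fun_prop
  have hΔ0 : Δ 0 ≠ 0 := by simpa [Δ, U, V] using ⟨ha, hb⟩
  have hA0 : A 0 ≠ 0 := by simpa [A, V, X] using ⟨hb, hα⟩
  have hB0 : B 0 ≠ 0 := by simpa [B, U, Y] using ⟨ha, hβ⟩
  refine HasLocalModel.of_coordinates hF hv h (a := A 0 * a) (b := B 0 * b)
    (e := fun x => (A x * quadratic a 0 c d e x, B x * quadratic 0 b c' d' e' x))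
    (mul_ne_zero hA0 ha) (mul_ne_zero hB0 hb) ?_ ?_ ?_ fun l => ?_
  · exact (HasStrictFDerivAt.mul_of_eq_zero hA (hasStrictFDerivAt_quadratic a 0 c d e)
      (quadratic_zero _ _ _ _ _)).congr_fderiv (by ext <;> simp)
  · exact (HasStrictFDerivAt.mul_of_eq_zero hB (hasStrictFDerivAt_quadratic 0 b c' d' e')
      (quadratic_zero _ _ _ _ _)).congr_fderiv (by ext <;> simp)
  · simp [quadratic_zero]
  · have evA := hA.continuous.continuousAt.eventually_ne hA0
    have evB := hB.continuous.continuousAt.eventually_ne hB0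
    have evΔ := hΔ.continuous.continuousAt.eventually_ne hΔ0
    by_cases hli : l = i
    · subst hli
      filter_upwards [evA] with x hx
      simp [PointType.model, hi, hx]
    by_cases hlj : l = j
    · subst hlj
      filter_upwards [evB] with x hx
      simp [PointType.model, hj, hli, hx]
    by_cases hlk : l = k
    · subst hlk
      filter_upwards [evΔ] with x hx
      simp only [PointType.model, hli, hlj, if_false, if_true, Set.mem_ofPred_eq, hk]
      have key : Δ x * quadratic α β γ δ ε x =
          A x * quadratic a 0 c d e x + B x * quadratic 0 b c' d' e' x := by
        simp only [quadratic, Δ, A, B, U, V, X, Y]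
        ring
      rw [← key]
      simp [hx]
    simp only [PointType.model, hli, hlj, hlk, if_false]
    exact eventually_of_eval_ne_zero (hl l hli hlj hlk)

end LocalModels

/-! ## Local models of arrangements of lines and conics -/

/-- The scalar product. -/
def dot3 {R : Type*} [CommRing R] (a b : Fin 3 → R) : R := a 0 * b 0 + a 1 * b 1 + a 2 * b 2

/-- The vector product. -/
def cross3 {R : Type*} [CommRing R] (a b : Fin 3 → R) : Fin 3 → R :=
  ![a 1 * b 2 - a 2 * b 1, a 2 * b 0 - a 0 * b 2, a 0 * b 1 - a 1 * b 0]

namespace PlaneForm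

variable {R : Type*} [CommRing R]

/-- The quadratic part of the restriction to an affine line with the direction `w`. -/
def quad (w : Fin 3 → R) : PlaneForm → R
  | line _ _ _ => 0
  | f@(conic _ _ _ _ _ _) => f.val w

/-- The polar form of the quadratic part. -/
def polar (w u : Fin 3 → R) : PlaneForm → R
  | line _ _ _ => 0
  | f@(conic _ _ _ _ _ _) => dot3 (f.grad w) u

theorem val_add (f : PlaneForm) (v τ ν : Fin 3 → R) (s r : R) :
    f.val (v + s • τ + r • ν) = f.val v + s * dot3 (f.grad v) τ + r * dot3 (f.grad v) ν +
      f.quad τ * s ^ 2 + f.polar τ ν * (s * r) + f.quad ν * r ^ 2 := by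
  cases f <;> simp [val, quad, polar, grad, dot3] <;> ring

theorem eval_poly_add (f : PlaneForm) {v τ ν : Fin 3 → ℂ} (h : f.val v = 0) (x : ℂ × ℂ) :
    eval (v + x.1 • τ + x.2 • ν) f.poly = quadratic (dot3 (f.grad v) τ) (dot3 (f.grad v) ν)
      (f.quad τ) (f.polar τ ν) (f.quad ν) x := by
  rw [eval_poly, val_add, h, quadratic]
  ring

end PlaneForm

/-- The vector with the given integer coordinates. -/
def intVec (p : Fin 3 → ℤ) : Fin 3 → ℂ := fun i => (p i : ℂ)

theorem dot3_intVec (a b : Fin 3 → ℤ) : dot3 (intVec a) (intVec b) = (dot3 a b : ℤ) := by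
  simp [dot3, intVec]

theorem det3_intVec (a b c : Fin 3 → ℤ) :
    det3 (intVec a) (intVec b) (intVec c) = (det3 a b c : ℤ) := by
  simp [det3, intVec]

theorem cross3_intVec (a b : Fin 3 → ℤ) : cross3 (intVec a) (intVec b) = intVec (cross3 a b) := by
  funext i
  fin_cases i <;> simp [cross3, intVec]

theorem intVec_ne_zero {p : Fin 3 → ℤ} (h : p ≠ 0) : intVec p ≠ 0 := by
  refine fun h0 => h (funext fun i => ?_)
  have := congrFun h0 i
  simpa [intVec] using this

theorem PlaneForm.val_intVec (f : PlaneForm) (p : Fin 3 → ℤ) :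
    f.val (intVec p) = (f.val p : ℤ) := f.val_intCast p

theorem PlaneForm.grad_intVec (f : PlaneForm) (p : Fin 3 → ℤ) :
    f.grad (intVec p) = intVec (f.grad p) := funext fun i => f.grad_intCast p i

theorem PlaneForm.quad_intVec (f : PlaneForm) (p : Fin 3 → ℤ) :
    f.quad (intVec p) = (f.quad p : ℤ) := by
  cases f with
  | line a b c => simp [quad]
  | conic a b c d e f => exact val_intVec (conic a b c d e f) p

section Identities

variable {R : Type*} [CommRing R] (v g h k : Fin 3 → R)

theorem dot3_cross3 (a b c : Fin 3 → R) : dot3 a (cross3 b c) = det3 a b c := by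
  simp [dot3, cross3, det3]
  ring

theorem dot3_self_cross3_left : dot3 g (cross3 g v) = 0 := by
  simp [dot3, cross3]
  ring

theorem dot3_self_cross3_right : dot3 g (cross3 v g) = 0 := by
  simp [dot3, cross3]
  ring

theorem det3_rotate : det3 h v g = det3 v g h := by
  simp only [det3]
  ring

theorem det3_cross3 : det3 v (cross3 h v) (cross3 v g) = dot3 v v * det3 v g h := by
  simp [det3, dot3, cross3]
  ring

end Identities

/-- The integer data that verify that the arrangement `c` has a singular point of the given type
at `p`. -/
def LocalCheck {n : ℕ} (c : Fin n → PlaneForm) (p : Fin 3 → ℤ) : PointType n → Prop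
  | .node i j => dot3 p p ≠ 0 ∧ (c i).val p = 0 ∧ (c j).val p = 0 ∧
      det3 p ((c i).grad p) ((c j).grad p) ≠ 0 ∧ ∀ l, l ≠ i → l ≠ j → (c l).val p ≠ 0
  | .tacnode i j => (c i).val p = 0 ∧ (c j).val p = 0 ∧
      det3 p ((c i).grad p) (cross3 p ((c i).grad p)) ≠ 0 ∧
      dot3 ((c i).grad p) ((c i).grad p) ≠ 0 ∧ dot3 ((c j).grad p) ((c i).grad p) ≠ 0 ∧
      dot3 ((c j).grad p) (cross3 p ((c i).grad p)) = 0 ∧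
      (c j).quad (cross3 p ((c i).grad p)) * dot3 ((c i).grad p) ((c i).grad p) -
        (c i).quad (cross3 p ((c i).grad p)) * dot3 ((c j).grad p) ((c i).grad p) ≠ 0 ∧
      ∀ l, l ≠ i → l ≠ j → (c l).val p ≠ 0
  | .triple i j k => dot3 p p ≠ 0 ∧ (c i).val p = 0 ∧ (c j).val p = 0 ∧ (c k).val p = 0 ∧
      det3 p ((c i).grad p) ((c j).grad p) ≠ 0 ∧
      det3 p ((c k).grad p) ((c j).grad p) ≠ 0 ∧ det3 p ((c i).grad p) ((c k).grad p) ≠ 0 ∧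
      ∀ l, l ≠ i → l ≠ j → l ≠ k → (c l).val p ≠ 0

instance {n : ℕ} (c : Fin n → PlaneForm) (p : Fin 3 → ℤ) : (T : PointType n) →
    Decidable (LocalCheck c p T)
  | .node _ _ => by unfold LocalCheck; infer_instance
  | .tacnode _ _ => by unfold LocalCheck; infer_instance
  | .triple _ _ _ => by unfold LocalCheck; infer_instance

/-- For a node or triple point, `τ = ∇(c j) × p` is orthogonal to the gradient of `c j`, and `ν = p
× ∇(c i)` to that of `c i`, so that the linear parts become diagonal. The determinant of `p, τ, ν`
is `dot3 p p` times that of `p` and the two gradients. For a tacnode, `ν` is the common tangent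
direction and `τ` is the gradient of `c i`. -/
theorem LocalCheck.hasLocalModel {n : ℕ} {c : Fin n → PlaneForm} {p : Fin 3 → ℤ}
    (hp : intVec p ≠ 0) : ∀ {T : PointType n}, LocalCheck c p T →
      HasLocalModel (fun i => (c i).poly) (Projectivization.mk ℂ (intVec p) hp) T.model
  | .node i j, ⟨hpp, hi, hj, hij, hl⟩ => by
    have hi' : (c i).val (intVec p) = 0 := by rw [PlaneForm.val_intVec, hi, Int.cast_zero]
    have hj' : (c j).val (intVec p) = 0 := by rw [PlaneForm.val_intVec, hj, Int.cast_zero]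
    have hδ : det3 (intVec p) ((c i).grad (intVec p)) ((c j).grad (intVec p)) ≠ 0 := by
      rw [PlaneForm.grad_intVec, PlaneForm.grad_intVec, det3_intVec]
      exact_mod_cast hij
    have hpp' : dot3 (intVec p) (intVec p) ≠ 0 := by
      rw [dot3_intVec]
      exact_mod_cast hpp
    have hli := fun x => (c i).eval_poly_add
      (τ := cross3 ((c j).grad (intVec p)) (intVec p))
      (ν := cross3 (intVec p) ((c i).grad (intVec p))) hi' x
    have hlj := fun x => (c j).eval_poly_add
      (τ := cross3 ((c j).grad (intVec p)) (intVec p))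
      (ν := cross3 (intVec p) ((c i).grad (intVec p))) hj' x
    rw [dot3_self_cross3_right] at hli
    rw [dot3_self_cross3_left] at hlj
    refine hasLocalModel_node (fun i => (c i).isHomogeneous_poly) hp ?_ ?_ ?_ hli hlj
      fun l h1 h2 => ?_
    · rw [det3_cross3]
      exact mul_ne_zero hpp' hδ
    · rw [dot3_cross3, ← det3_rotate]
      exact hδ
    · rw [dot3_cross3, det3_rotate]
      exact hδ
    · rw [PlaneForm.eval_poly, PlaneForm.val_intVec]
      exact_mod_cast hl l h1 h2
  | .tacnode i j, ⟨hi, hj, hdet, ha, ha', htan, hK, hl⟩ => by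
    have hi' : (c i).val (intVec p) = 0 := by rw [PlaneForm.val_intVec, hi, Int.cast_zero]
    have hj' : (c j).val (intVec p) = 0 := by rw [PlaneForm.val_intVec, hj, Int.cast_zero]
    have hli := fun x => (c i).eval_poly_add (τ := (c i).grad (intVec p))
      (ν := cross3 (intVec p) ((c i).grad (intVec p))) hi' x
    have hlj := fun x => (c j).eval_poly_add (τ := (c i).grad (intVec p))
      (ν := cross3 (intVec p) ((c i).grad (intVec p))) hj' x
    rw [dot3_self_cross3_right] at hli
    simp only [PlaneForm.grad_intVec, cross3_intVec, dot3_intVec, PlaneForm.quad_intVec] at hli hlj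
    rw [htan, Int.cast_zero] at hlj
    refine hasLocalModel_tacnode (fun i => (c i).isHomogeneous_poly) hp ?_ ?_ ?_ hli hlj ?_ ?_
    · rw [det3_intVec]
      exact_mod_cast hdet
    · exact_mod_cast ha
    · exact_mod_cast ha'
    · exact_mod_cast hK
    · intro l h1 h2
      rw [PlaneForm.eval_poly, PlaneForm.val_intVec]
      exact_mod_cast hl l h1 h2
  | .triple i j k, ⟨hpp, hi, hj, hk, hij, hkj, hik, hl⟩ => by
    have hi' : (c i).val (intVec p) = 0 := by rw [PlaneForm.val_intVec, hi, Int.cast_zero]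
    have hj' : (c j).val (intVec p) = 0 := by rw [PlaneForm.val_intVec, hj, Int.cast_zero]
    have hk' : (c k).val (intVec p) = 0 := by rw [PlaneForm.val_intVec, hk, Int.cast_zero]
    have hδ : ∀ {i j}, det3 p ((c i).grad p) ((c j).grad p) ≠ 0 →
        det3 (intVec p) ((c i).grad (intVec p)) ((c j).grad (intVec p)) ≠ 0 := by
      intro i j hij
      rw [PlaneForm.grad_intVec, PlaneForm.grad_intVec, det3_intVec]
      exact_mod_cast hij
    have hpp' : dot3 (intVec p) (intVec p) ≠ 0 := by
      rw [dot3_intVec]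
      exact_mod_cast hpp
    have hli := fun x => (c i).eval_poly_add
      (τ := cross3 ((c j).grad (intVec p)) (intVec p))
      (ν := cross3 (intVec p) ((c i).grad (intVec p))) hi' x
    have hlj := fun x => (c j).eval_poly_add
      (τ := cross3 ((c j).grad (intVec p)) (intVec p))
      (ν := cross3 (intVec p) ((c i).grad (intVec p))) hj' x
    rw [dot3_self_cross3_right] at hli
    rw [dot3_self_cross3_left] at hlj
    refine hasLocalModel_triple (fun i => (c i).isHomogeneous_poly) hp ?_ ?_ ?_ ?_ ?_ hli hlj
      ((c k).eval_poly_add hk') fun l h1 h2 h3 => ?_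
    · rw [det3_cross3]
      exact mul_ne_zero hpp' (hδ hij)
    · rw [dot3_cross3, ← det3_rotate]
      exact hδ hij
    · rw [dot3_cross3, det3_rotate]
      exact hδ hij
    · rw [dot3_cross3, ← det3_rotate]
      exact hδ hkj
    · rw [dot3_cross3, det3_rotate]
      exact hδ hik
    · rw [PlaneForm.eval_poly, PlaneForm.val_intVec]
      exact_mod_cast hl l h1 h2 h3

/-! ## Lines and smooth conics -/

theorem cross3_eq_zero_iff {a b : Fin 3 → ℂ} :
    cross3 a b = 0 ↔ ¬ LinearIndependent ℂ ![a, b] := by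
  rw [← crossProduct_ne_zero_iff_linearIndependent, not_not]
  rfl

theorem cross3_smul_smul (s t : ℂ) (a b : Fin 3 → ℂ) :
    cross3 (s • a) (t • b) = (s * t) • cross3 a b := by
  funext i
  fin_cases i <;> simp [cross3] <;> ring

theorem exists_eq_smul_of_cross3_eq_zero {a b : Fin 3 → ℂ} (ha : a ≠ 0) (h : cross3 a b = 0) :
    ∃ t : ℂ, b = t • a := by
  rw [cross3_eq_zero_iff, LinearIndependent.pair_iff' ha, not_forall_not] at h
  obtain ⟨t, ht⟩ := h
  exact ⟨t, ht.symm⟩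

theorem eq_mk_of_eq_smul {x : PP2} {v : Fin 3 → ℂ} (hv : v ≠ 0) {t : ℂ} (h : x.rep = t • v) :
    x = Projectivization.mk ℂ v hv := by
  rw [← x.mk_rep, Projectivization.mk_eq_mk_iff']
  exact ⟨t, h.symm⟩

/-- The component of degree two of `A * B` is the product of the components of degree one. -/
theorem exists_linear_factors {P : PolyS} (hP : P.IsHomogeneous 2) {A B : PolyS} (h : P = A * B)
    (hA : A.totalDegree ≤ 1) (hB : B.totalDegree ≤ 1) :
    ∃ a b : PolyS, a.IsHomogeneous 1 ∧ b.IsHomogeneous 1 ∧ P = a * b := by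
  refine ⟨homogeneousComponent 1 A, homogeneousComponent 1 B,
    homogeneousComponent_isHomogeneous _ _, homogeneousComponent_isHomogeneous _ _, ?_⟩
  have hsum : ∀ {Q : PolyS}, Q.totalDegree ≤ 1 →
      Q = homogeneousComponent 0 Q + homogeneousComponent 1 Q := by
    intro Q hQ
    have h1 := sum_homogeneousComponent Q
    rw [Finset.sum_subset (s₁ := Finset.range (Q.totalDegree + 1)) (s₂ := Finset.range 2)
      (Finset.range_subset_range.mpr (by omega))
      (fun i _ hi => homogeneousComponent_eq_zero _ _ (by simpa using hi))] at h1
    rw [Finset.sum_range_succ, Finset.sum_range_one] at h1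
    exact h1.symm
  have hcomp : ∀ {Q : PolyS} {n : ℕ}, Q.IsHomogeneous n → n ≠ 2 → homogeneousComponent 2 Q = 0 := by
    intro Q n hQ hn
    rw [homogeneousComponent_of_mem hQ, if_neg (by omega)]
  have h2 : P = homogeneousComponent 2 P := by rw [homogeneousComponent_of_mem hP, if_pos rfl]
  rw [h2, h]
  conv_lhs => rw [hsum hA, hsum hB]
  have i0 := fun Q : PolyS => homogeneousComponent_isHomogeneous 0 Q
  have i1 := fun Q : PolyS => homogeneousComponent_isHomogeneous 1 Q
  rw [add_mul, mul_add, mul_add, map_add, map_add, map_add, hcomp ((i0 A).mul (i0 B)) (by simp),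
    hcomp ((i0 A).mul (i1 B)) (by simp), hcomp ((i1 A).mul (i0 B)) (by simp),
    homogeneousComponent_of_mem ((i1 A).mul (i1 B)), if_pos rfl]
  simp

theorem exists_common_zero {a b : PolyS} (ha : a.IsHomogeneous 1) (hb : b.IsHomogeneous 1) :
    ∃ w : Fin 3 → ℂ, w ≠ 0 ∧ eval w a = 0 ∧ eval w b = 0 := by
  have hlin : ∀ {a : PolyS}, a.IsHomogeneous 1 → ∀ w : Fin 3 → ℂ,
      eval w a = dot3 (fun i => eval 0 (pderiv i a)) w := by
    intro a ha w
    have hc : ∀ i, eval w (pderiv i a) = eval 0 (pderiv i a) := by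
      intro i
      have := ha.pderiv (i := i)
      rw [Nat.sub_self, ← totalDegree_zero_iff_isHomogeneous, totalDegree_eq_zero_iff_eq_C] at this
      rw [this]
      simp
    have := ha.sum_X_mul_pderiv
    rw [Fin.sum_univ_three, one_smul] at this
    rw [← this, map_add, map_add, map_mul, map_mul, map_mul, hc, hc, hc, eval_X, eval_X, eval_X,
      this, dot3]
    ring
  -- A third row of zeros makes the system of two linear equations square and singular.
  obtain ⟨w, hw, hMw⟩ := Matrix.exists_mulVec_eq_zero_iff.mpr
    (show (Matrix.of ![fun i => eval 0 (pderiv i a), fun i => eval 0 (pderiv i b),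
      (0 : Fin 3 → ℂ)]).det = 0 from Matrix.det_eq_zero_of_row_eq_zero 2 (by simp))
  refine ⟨w, hw, ?_, ?_⟩
  · rw [hlin ha, dot3]
    simpa [Matrix.mulVec, dotProduct, Fin.sum_univ_three] using congrFun hMw 0
  · rw [hlin hb, dot3]
    simpa [Matrix.mulVec, dotProduct, Fin.sum_univ_three] using congrFun hMw 1

/-- A form of degree two without singular points is irreducible. -/
theorem irreducible_of_smooth {P : PolyS} (hP : P.IsHomogeneous 2)
    (h : ∀ w : Fin 3 → ℂ, w ≠ 0 → ∃ i, eval w (pderiv i P) ≠ 0) : Irreducible P := by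
  have hP0 : P ≠ 0 := by
    rintro rfl
    obtain ⟨i, hi⟩ := h (fun _ => 1) (fun h0 => one_ne_zero (congrFun h0 0))
    simp at hi
  have hunit : ∀ {A : PolyS}, A ≠ 0 → A.totalDegree = 0 → IsUnit A := by
    intro A hA hA0
    rw [totalDegree_eq_zero_iff_eq_C] at hA0
    rw [hA0] at hA ⊢
    exact (IsUnit.mk0 _ fun h0 => hA (by rw [h0, C_0])).map C
  refine ⟨fun hu => ?_, fun A B hAB => ?_⟩
  · have := (isUnit_iff_totalDegree_of_isReduced.mp hu).2
    rw [hP.totalDegree hP0] at this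
    omega
  · have hA0 : A ≠ 0 := left_ne_zero_of_mul (hAB ▸ hP0)
    have hB0 : B ≠ 0 := right_ne_zero_of_mul (hAB ▸ hP0)
    have hdeg : A.totalDegree + B.totalDegree = 2 := by
      rw [← totalDegree_mul_of_isDomain hA0 hB0, ← hAB, hP.totalDegree hP0]
    by_contra! hne
    have hA1 : A.totalDegree ≠ 0 := fun h0 => hne.1 (hunit hA0 h0)
    have hB1 : B.totalDegree ≠ 0 := fun h0 => hne.2 (hunit hB0 h0)
    -- A reducible conic is a union of two lines and is singular where they meet.
    obtain ⟨a, b, ha, hb, hab⟩ := exists_linear_factors hP hAB (by omega) (by omega)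
    obtain ⟨w, hw, hwa, hwb⟩ := exists_common_zero ha hb
    obtain ⟨i, hi⟩ := h w hw
    refine hi ?_
    rw [hab, pderiv_mul, map_add, map_mul, map_mul, hwa, hwb]
    ring

namespace PlaneForm

/-- The form is nonzero and, in degree two, has no singular zero. -/
def Nondegenerate : PlaneForm → Prop
  | line a b c => a ≠ 0 ∨ b ≠ 0 ∨ c ≠ 0
  | conic a b c d e f => det3 ![2 * a, d, e] ![d, 2 * b, f] ![e, f, 2 * c] ≠ 0

instance : (f : PlaneForm) → Decidable f.Nondegenerate
  | line _ _ _ => by unfold Nondegenerate; infer_instance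
  | conic _ _ _ _ _ _ => by unfold Nondegenerate; infer_instance

theorem Nondegenerate.grad_ne_zero {f : PlaneForm} (hf : f.Nondegenerate) {w : Fin 3 → ℂ}
    (hw : w ≠ 0) : f.grad w ≠ 0 := by
  intro h
  cases f with
  | line a b c =>
    have h0 := congrFun h 0
    have h1 := congrFun h 1
    have h2 := congrFun h 2
    simp only [grad, Matrix.cons_val_zero, Matrix.cons_val_one, Matrix.cons_val, Pi.zero_apply,
      Int.cast_eq_zero] at h0 h1 h2
    rcases hf with hf | hf | hf <;> contradiction
  | conic a b c d e f =>
    have h0 := congrFun h 0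
    have h1 := congrFun h 1
    have h2 := congrFun h 2
    simp only [grad, Matrix.cons_val_zero, Matrix.cons_val_one, Matrix.cons_val,
      Pi.zero_apply] at h0 h1 h2
    have hdet : ((det3 ![2 * a, d, e] ![d, 2 * b, f] ![e, f, 2 * c] : ℤ) : ℂ) ≠ 0 :=
      Int.cast_ne_zero.mpr hf
    simp only [det3, Matrix.cons_val_zero, Matrix.cons_val_one, Matrix.cons_val] at hdet
    push_cast at hdet
    -- The gradient is the symmetric matrix of second derivatives applied to `w`. The coefficients
    -- in the three cases are the rows of its adjugate.
    refine hw (funext fun i => (mul_eq_zero.mp ?_).resolve_left hdet)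
    fin_cases i
    · simp only [Fin.zero_eta, Fin.isValue]
      linear_combination (4 * b * c - f ^ 2) * h0 + (e * f - 2 * c * d) * h1 +
        (d * f - 2 * b * e) * h2
    · simp only [Fin.mk_one, Fin.isValue]
      linear_combination (e * f - 2 * c * d) * h0 + (4 * a * c - e ^ 2) * h1 +
        (d * e - 2 * a * f) * h2
    · simp only [Fin.reduceFinMk, Fin.isValue]
      linear_combination (d * f - 2 * b * e) * h0 + (d * e - 2 * a * f) * h1 +
        (4 * a * b - d ^ 2) * h2

theorem mem_locus (f : PlaneForm) (x : PP2) : x ∈ locus f.poly ↔ f.val x.rep = 0 := by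
  rw [← eval_poly]
  rfl

theorem gradAt_poly (f : PlaneForm) (x : PP2) : gradAt f.poly x = f.grad x.rep := by
  funext i
  rw [← eval_pderiv_poly, gradAt]

theorem Nondegenerate.gradAt_ne_zero {f : PlaneForm} (hf : f.Nondegenerate) (x : PP2) :
    gradAt f.poly x ≠ 0 := by
  rw [gradAt_poly]
  exact hf.grad_ne_zero x.rep_nonzero

theorem Nondegenerate.poly_ne_zero {f : PlaneForm} (hf : f.Nondegenerate) : f.poly ≠ 0 := by
  intro h
  refine hf.grad_ne_zero (w := fun _ => 1) (fun h0 => one_ne_zero (congrFun h0 0)) ?_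
  funext i
  rw [← eval_pderiv_poly, h]
  simp

theorem Nondegenerate.totalDegree_poly {f : PlaneForm} (hf : f.Nondegenerate) :
    f.poly.totalDegree = f.degree := f.isHomogeneous_poly.totalDegree hf.poly_ne_zero

theorem Nondegenerate.isLine {f : PlaneForm} (hf : f.Nondegenerate) (h : f.degree = 1) :
    IsLine f.poly := ⟨h ▸ f.isHomogeneous_poly, hf.poly_ne_zero⟩

theorem Nondegenerate.isSmoothConic {f : PlaneForm} (hf : f.Nondegenerate) (h : f.degree = 2) :
    IsSmoothConic f.poly :=
  ⟨h ▸ f.isHomogeneous_poly, hf.poly_ne_zero,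
    Set.eq_empty_of_forall_notMem fun x hx => hf.gradAt_ne_zero x hx.2⟩

theorem degree_eq (f : PlaneForm) : f.degree = 1 ∨ f.degree = 2 := by cases f <;> simp [degree]

theorem Nondegenerate.irreducible {f : PlaneForm} (hf : f.Nondegenerate) : Irreducible f.poly := by
  rcases f.degree_eq with h | h
  · refine irreducible_of_totalDegree_eq_one (hf.totalDegree_poly.trans h) fun t ht => ?_
    obtain ⟨m, hm⟩ := ne_zero_iff.mp hf.poly_ne_zero
    exact (IsUnit.mk0 t fun h0 => hm (zero_dvd_iff.mp (h0 ▸ ht m)))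
  · refine irreducible_of_smooth (h ▸ f.isHomogeneous_poly) fun w hw => ?_
    obtain ⟨i, hi⟩ := Function.ne_iff.mp (hf.grad_ne_zero hw)
    exact ⟨i, by rw [eval_pderiv_poly]; exact hi⟩

end PlaneForm

/-! ## Intersections of lines and conics -/

/-- The line `l` contains the point `p` of `f`, and the restriction of `f` to the line is either
tangent to it at `p` or vanishes at `q` too. -/
def ChordCheck {N : ℕ} (f : PlaneForm) (pt : Fin N → Fin 3 → ℤ) (l : Fin 3 → ℤ) (k : Fin N)
    (q : Fin 3 → ℤ) : Prop :=
  l ≠ 0 ∧ dot3 l (pt k) = 0 ∧ dot3 l q = 0 ∧ cross3 (pt k) q ≠ 0 ∧ f.val (pt k) = 0 ∧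
    (((∃ k', pt k' = q) ∧ f.val q = 0 ∧ f.polar (pt k) q ≠ 0) ∨
      (f.polar (pt k) q = 0 ∧ f.val q ≠ 0))

instance {N : ℕ} (f : PlaneForm) (pt : Fin N → Fin 3 → ℤ) (l : Fin 3 → ℤ) (k : Fin N)
    (q : Fin 3 → ℤ) : Decidable (ChordCheck f pt l k q) := by
  unfold ChordCheck
  infer_instance

/-- Cramer's rule for the basis `p × q, p, q`, whose determinant is the square of the length of `p ×
q`. -/
theorem dot3_self_cross3_smul {R : Type*} [CommRing R] (p q w : Fin 3 → R) :
    dot3 (cross3 p q) (cross3 p q) • w = dot3 w (cross3 p q) • cross3 p q +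
      dot3 (cross3 w q) (cross3 p q) • p + dot3 (cross3 p w) (cross3 p q) • q := by
  funext i
  simp only [dot3, cross3, Pi.add_apply, Pi.smul_apply, smul_eq_mul, Matrix.cons_val_zero,
    Matrix.cons_val_one, Matrix.cons_val]
  fin_cases i <;> simp only [Fin.zero_eta, Fin.mk_one, Fin.reduceFinMk, Fin.isValue,
    Matrix.cons_val_zero, Matrix.cons_val_one, Matrix.cons_val] <;> ring

theorem exists_combination {l p q : Fin 3 → ℤ} (hl : l ≠ 0) (hp : dot3 l p = 0) (hq : dot3 l q = 0)
    (hpq : cross3 p q ≠ 0) {w : Fin 3 → ℂ} (hw : dot3 (intVec l) w = 0) :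
    ∃ a b : ℂ, w = a • intVec p + b • intVec q := by
  have hp' : dot3 (intVec l) (intVec p) = 0 := by rw [dot3_intVec, hp, Int.cast_zero]
  have hq' : dot3 (intVec l) (intVec q) = 0 := by rw [dot3_intVec, hq, Int.cast_zero]
  set n : Fin 3 → ℤ := cross3 p q with hn
  -- Integrality is essential: a nonzero complex vector may be isotropic, but a sum of squares of
  -- integers vanishes only trivially.
  have hnn : ((dot3 n n : ℤ) : ℂ) ≠ 0 := by
    rw [Int.cast_ne_zero]
    intro h0
    refine hpq (funext fun i => ?_)
    simp only [dot3] at h0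
    have h1 := mul_self_nonneg (n 0)
    have h2 := mul_self_nonneg (n 1)
    have h3 := mul_self_nonneg (n 2)
    fin_cases i
    · exact mul_self_eq_zero.mp (by change n 0 * n 0 = 0; linarith)
    · exact mul_self_eq_zero.mp (by change n 1 * n 1 = 0; linarith)
    · exact mul_self_eq_zero.mp (by change n 2 * n 2 = 0; linarith)
  -- Both `l` and `n` are orthogonal to `p` and `q`; hence `n` is a multiple of `l`, and `w` is
  -- orthogonal to `n`.
  have hcross : cross3 (intVec l) (intVec n) = 0 := by
    rw [hn, ← cross3_intVec]
    simp only [dot3] at hp' hq'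
    funext i
    fin_cases i <;> simp [cross3]
    · linear_combination intVec p 0 * hq' - intVec q 0 * hp'
    · linear_combination intVec p 1 * hq' - intVec q 1 * hp'
    · linear_combination intVec p 2 * hq' - intVec q 2 * hp'
  obtain ⟨t, ht⟩ := exists_eq_smul_of_cross3_eq_zero (intVec_ne_zero hl) hcross
  have hwn : dot3 w (intVec n) = 0 := by
    rw [ht]
    simp only [dot3, Pi.smul_apply, smul_eq_mul] at hw ⊢
    linear_combination t * hw
  have hid : dot3 (intVec n) (intVec n) • w = dot3 w (intVec n) • intVec n +
      dot3 (cross3 w (intVec q)) (intVec n) • intVec p +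
      dot3 (cross3 (intVec p) w) (intVec n) • intVec q := by
    rw [hn, ← cross3_intVec]
    exact dot3_self_cross3_smul _ _ _
  rw [hwn, zero_smul, zero_add, dot3_intVec] at hid
  refine ⟨((dot3 n n : ℤ) : ℂ)⁻¹ * dot3 (cross3 w (intVec q)) (intVec n),
    ((dot3 n n : ℤ) : ℂ)⁻¹ * dot3 (cross3 (intVec p) w) (intVec n), ?_⟩
  rw [mul_smul, mul_smul, ← smul_add, ← hid, smul_smul, inv_mul_cancel₀ hnn, one_smul]

theorem PlaneForm.polar_intVec (f : PlaneForm) (p q : Fin 3 → ℤ) :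
    f.polar (intVec p) (intVec q) = (f.polar p q : ℤ) := by
  cases f with
  | line a b c => simp [polar]
  | conic a b c d e f =>
    change dot3 (grad (intVec p) (conic a b c d e f)) (intVec q) = _
    rw [grad_intVec, dot3_intVec]
    rfl

/-- A point of the line is `w = a p + b q`. For a conic, `f p = 0` implies `f w = b (a * polar + b *
f q)`. Either `f q = 0` and the polar value is nonzero, so that `a` or `b` vanishes, or the polar
value is zero and `f q ≠ 0`, so that `b = 0` and the line is tangent at `p`. A linear `f` falls
under the second alternative, its polar value being zero by definition. -/
theorem ChordCheck.exists_eq_smul {N : ℕ} {f : PlaneForm} {pt : Fin N → Fin 3 → ℤ}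
    {l : Fin 3 → ℤ} {k : Fin N} {q : Fin 3 → ℤ} (h : ChordCheck f pt l k q) {w : Fin 3 → ℂ}
    (hl : dot3 (intVec l) w = 0) (hf : f.val w = 0) :
    ∃ (k : Fin N) (t : ℂ), w = t • intVec (pt k) := by
  obtain ⟨hl0, hp, hq, hpq, hfp, h⟩ := h
  obtain ⟨a, b, rfl⟩ := exists_combination hl0 hp hq hpq hl
  have hfp' : f.val (intVec (pt k)) = 0 := by rw [PlaneForm.val_intVec, hfp, Int.cast_zero]
  have hval : (f.degree = 1 ∧ b * f.val (intVec q) = 0 ∧ f.polar (pt k) q = 0) ∨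
      b * (a * f.polar (intVec (pt k)) (intVec q) + b * f.val (intVec q)) = 0 := by
    cases f with
    | line A B C =>
      left
      simp only [PlaneForm.val, Pi.add_apply, Pi.smul_apply, smul_eq_mul] at hf hfp' ⊢
      exact ⟨rfl, by linear_combination hf - a * hfp', rfl⟩
    | conic A B C D E F =>
      right
      simp only [PlaneForm.val, PlaneForm.polar, PlaneForm.grad, dot3, Pi.add_apply, Pi.smul_apply,
        smul_eq_mul, Matrix.cons_val_zero, Matrix.cons_val_one, Matrix.cons_val] at hf hfp' ⊢
      linear_combination hf - a ^ 2 * hfp'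
  rw [PlaneForm.polar_intVec, PlaneForm.val_intVec] at hval
  rcases h with ⟨⟨k', rfl⟩, hfq, hpol⟩ | ⟨hpol, hfq⟩
  · rcases hval with hval | hval
    · exact absurd hval.2.2 hpol
    · rw [hfq, Int.cast_zero, mul_zero, add_zero] at hval
      rcases mul_eq_zero.mp hval with rfl | hval
      · exact ⟨k, a, by simp⟩
      · rcases mul_eq_zero.mp hval with rfl | h0
        · exact ⟨k', b, by simp⟩
        · exact absurd h0 (Int.cast_ne_zero.mpr hpol)
  · have hfq' : ((f.val q : ℤ) : ℂ) ≠ 0 := Int.cast_ne_zero.mpr hfq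
    have hb : b = 0 := by
      rcases hval with hval | hval
      · exact (mul_eq_zero.mp hval.2.1).resolve_right hfq'
      · rw [hpol, Int.cast_zero, mul_zero, zero_add] at hval
        rcases mul_eq_zero.mp hval with h0 | h0
        · exact h0
        · exact (mul_eq_zero.mp h0).resolve_right hfq'
    exact ⟨k, a, by simp [hb]⟩

/-- Data for the intersection of a line or conic with a line, or of two conics in whose pencil
there is the union of the lines `l` and `m`. -/
inductive Meeting (N : ℕ) : Type
  | line (k : Fin N) (q : Fin 3 → ℤ)
  | pencil (a b : ℤ) (l : Fin 3 → ℤ) (k : Fin N) (q : Fin 3 → ℤ) (m : Fin 3 → ℤ) (k' : Fin N)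
    (q' : Fin 3 → ℤ)

/-- The equation `a * f + b * g = l * m`. -/
def PencilCheck (a b : ℤ) (l m : Fin 3 → ℤ) : PlaneForm → PlaneForm → Prop
  | .conic A B C D E F, .conic A' B' C' D' E' F' =>
    a * A + b * A' = l 0 * m 0 ∧ a * B + b * B' = l 1 * m 1 ∧ a * C + b * C' = l 2 * m 2 ∧
      a * D + b * D' = l 0 * m 1 + l 1 * m 0 ∧ a * E + b * E' = l 0 * m 2 + l 2 * m 0 ∧
      a * F + b * F' = l 1 * m 2 + l 2 * m 1
  | _, _ => False

instance (a b : ℤ) (l m : Fin 3 → ℤ) : (f g : PlaneForm) → Decidable (PencilCheck a b l m f g)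
  | .conic _ _ _ _ _ _, .conic _ _ _ _ _ _ => by unfold PencilCheck; infer_instance
  | .line _ _ _, _ => isFalse fun h => h
  | .conic _ _ _ _ _ _, .line _ _ _ => isFalse fun h => h

/-- The data verify that all intersections of `f` and `g` are among the points `pt`. -/
def MeetingCheck {N : ℕ} (pt : Fin N → Fin 3 → ℤ) (f : PlaneForm) :
    PlaneForm → Meeting N → Prop
  | .line a b c, .line k q => ChordCheck f pt ![a, b, c] k q
  | g, .pencil a b l k q m k' q' =>
    PencilCheck a b l m f g ∧ ChordCheck f pt l k q ∧ ChordCheck f pt m k' q'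
  | .conic _ _ _ _ _ _, .line _ _ => False

instance {N : ℕ} (pt : Fin N → Fin 3 → ℤ) (f : PlaneForm) : (g : PlaneForm) → (m : Meeting N) →
    Decidable (MeetingCheck pt f g m)
  | .line _ _ _, .line _ _ => by unfold MeetingCheck; infer_instance
  | .line _ _ _, .pencil _ _ _ _ _ _ _ _ => by unfold MeetingCheck; infer_instance
  | .conic _ _ _ _ _ _, .pencil _ _ _ _ _ _ _ _ => by unfold MeetingCheck; infer_instance
  | .conic _ _ _ _ _ _, .line _ _ => isFalse fun h => h

/-- The common points of two conics lie on every member of their pencil, in particular on the line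
pair `l * m`. So the intersection of two conics reduces to that of `f` with two lines. -/
theorem MeetingCheck.exists_eq_smul {N : ℕ} {pt : Fin N → Fin 3 → ℤ} {f g : PlaneForm}
    {m : Meeting N} (h : MeetingCheck pt f g m) {w : Fin 3 → ℂ} (hf : f.val w = 0)
    (hg : g.val w = 0) : ∃ (k : Fin N) (t : ℂ), w = t • intVec (pt k) := by
  have hpencil : ∀ {a b : ℤ} {l m : Fin 3 → ℤ} {k k' : Fin N} {q q' : Fin 3 → ℤ},
      PencilCheck a b l m f g → ChordCheck f pt l k q → ChordCheck f pt m k' q' →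
      ∃ (k : Fin N) (t : ℂ), w = t • intVec (pt k) := by
    intro a b l m k k' q q' hp hl hm
    have hlm : dot3 (intVec l) w * dot3 (intVec m) w = 0 := by
      match f, g, hp with
      | .conic A B C D E F, .conic A' B' C' D' E' F', ⟨h1, h2, h3, h4, h5, h6⟩ =>
        simp only [PlaneForm.val] at hf hg
        simp only [dot3, intVec]
        have h1' := congrArg (Int.cast : ℤ → ℂ) h1
        have h2' := congrArg (Int.cast : ℤ → ℂ) h2
        have h3' := congrArg (Int.cast : ℤ → ℂ) h3
        have h4' := congrArg (Int.cast : ℤ → ℂ) h4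
        have h5' := congrArg (Int.cast : ℤ → ℂ) h5
        have h6' := congrArg (Int.cast : ℤ → ℂ) h6
        push_cast at h1' h2' h3' h4' h5' h6'
        linear_combination a * hf + b * hg - w 0 ^ 2 * h1' - w 1 ^ 2 * h2' - w 2 ^ 2 * h3' -
          w 0 * w 1 * h4' - w 0 * w 2 * h5' - w 1 * w 2 * h6'
    rcases mul_eq_zero.mp hlm with h0 | h0
    · exact hl.exists_eq_smul h0 hf
    · exact hm.exists_eq_smul h0 hf
  match g, m, h with
  | .line a b c, .line k q, h =>
    refine ChordCheck.exists_eq_smul h ?_ hf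
    simpa [dot3, intVec, PlaneForm.val] using hg
  | .line _ _ _, .pencil _ _ _ _ _ _ _ _, h => exact hpencil h.1 h.2.1 h.2.2
  | .conic _ _ _ _ _ _, .pencil _ _ _ _ _ _ _ _, h => exact hpencil h.1 h.2.1 h.2.2

/-! ## Arrangements of lines and conics -/

/-- The equation of an arrangement. -/
noncomputable def arrangement {n : ℕ} (c : Fin n → PlaneForm) : PolyS := ∏ i, (c i).poly

theorem prodPoly_ofFn {n : ℕ} (c : Fin n → PlaneForm) :
    PlaneForm.prodPoly (List.ofFn c) = arrangement c := by
  rw [PlaneForm.prodPoly, List.map_ofFn, List.prod_ofFn]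
  rfl

/-- The arrangement `c` consists of curves of the degrees `deg`, and its singular points are the
points `pt`, of the types `T`. -/
structure Realizes {n N : ℕ} (deg : Fin n → ℕ) (T : Fin N → PointType n) (c : Fin n → PlaneForm)
    (pt : Fin N → Fin 3 → ℤ) (meetings : List (Meeting N)) : Prop where
  degree : ∀ i, (c i).degree = deg i
  nondegenerate : ∀ i, (c i).Nondegenerate
  ne_zero : ∀ k, pt k ≠ 0
  distinct : ∀ k l, k ≠ l → cross3 (pt k) (pt l) ≠ 0
  incidence : ∀ k i, (c i).val (pt k) = 0 ↔ i ∈ (T k).curves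
  tangency : ∀ k i j, i ≠ j → i ∈ (T k).curves → j ∈ (T k).curves →
    (cross3 ((c i).grad (pt k)) ((c j).grad (pt k)) = 0 ↔ (T k).tangent i j = true)
  local_check : ∀ k, LocalCheck c (pt k) (T k)
  -- Guarantees that no two components have proportional equations, hence that the product is
  -- squarefree.
  separated : ∀ i j, i ≠ j → ∃ k, i ∈ (T k).curves ∧ j ∉ (T k).curves
  multiple : ∀ k, ∃ i j, i ≠ j ∧ i ∈ (T k).curves ∧ j ∈ (T k).curves
  meeting : ∀ i j, i < j → ∃ m ∈ meetings, MeetingCheck pt (c i) (c j) m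

theorem PointType.mem_curves_of_tangent {n : ℕ} {T : PointType n} {i j : Fin n}
    (h : T.tangent i j = true) : i ∈ T.curves ∧ j ∈ T.curves := by
  cases T with
  | node => simp [tangent] at h
  | tacnode k l =>
    simp only [tangent, Bool.or_eq_true, Bool.and_eq_true, beq_iff_eq] at h
    rcases h with ⟨rfl, rfl⟩ | ⟨rfl, rfl⟩ <;> simp [curves]
  | triple => simp [tangent] at h

theorem isHomogeneous_arrangement {n : ℕ} (c : Fin n → PlaneForm) :
    (arrangement c).IsHomogeneous (∑ i, (c i).degree) :=
  IsHomogeneous.prod _ _ _ fun i _ => (c i).isHomogeneous_poly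

theorem pderiv_arrangement {n : ℕ} (c : Fin n → PlaneForm) (i : Fin n) (m : Fin 3) :
    pderiv m (arrangement c) = pderiv m (c i).poly * ∏ j ∈ Finset.univ.erase i, (c j).poly +
      (c i).poly * pderiv m (∏ j ∈ Finset.univ.erase i, (c j).poly) := by
  rw [arrangement, ← Finset.mul_prod_erase _ _ (Finset.mem_univ i), pderiv_mul]

/-! ### Incidences, tangencies and singular points read off from the point types. -/

namespace Realizes

variable {n N : ℕ} {deg : Fin n → ℕ} {T : Fin N → PointType n} {c : Fin n → PlaneForm}
  {pt : Fin N → Fin 3 → ℤ} {meetings : List (Meeting N)}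

section

variable (h : Realizes deg T c pt meetings)
include h

/-- The singular points as points of the projective plane. -/
noncomputable def point (k : Fin N) : PP2 :=
  Projectivization.mk ℂ (intVec (pt k)) (intVec_ne_zero (h.ne_zero k))

theorem mem_locus_point (k : Fin N) (i : Fin n) :
    h.point k ∈ locus (c i).poly ↔ i ∈ (T k).curves := by
  rw [point, mem_locus_mk (c i).isHomogeneous_poly, PlaneForm.eval_poly, PlaneForm.val_intVec,
    Int.cast_eq_zero, h.incidence]

theorem point_injective : Function.Injective h.point := by
  intro k l hkl
  by_contra hne
  rw [point, point, Projectivization.mk_eq_mk_iff'] at hkl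
  obtain ⟨t, ht⟩ := hkl
  refine intVec_ne_zero (h.distinct k l hne) ?_
  rw [← cross3_intVec, ← ht]
  funext m
  fin_cases m <;> simp [cross3] <;> ring

theorem exists_eq_point {i j : Fin n} (hij : i ≠ j) {x : PP2} (hi : x ∈ locus (c i).poly)
    (hj : x ∈ locus (c j).poly) : ∃ k, x = h.point k := by
  wlog hlt : i < j generalizing i j
  · exact this hij.symm hj hi (lt_of_le_of_ne (not_lt.mp hlt) hij.symm)
  obtain ⟨m, _, hm⟩ := h.meeting i j hlt
  obtain ⟨k, t, ht⟩ := hm.exists_eq_smul ((PlaneForm.mem_locus _ _).mp hi)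
    ((PlaneForm.mem_locus _ _).mp hj)
  exact ⟨k, eq_mk_of_eq_smul _ ht⟩

/-- The bridge from geometry to the table `T`: incidence and tangency conditions between distinct
components become statements about finitely many labels, which are decidable without reference to
the equations. -/
theorem mem_inter_iff {i j : Fin n} (hij : i ≠ j) (x : PP2) :
    x ∈ locus (c i).poly ∧ x ∈ locus (c j).poly ↔
      ∃ k, (i ∈ (T k).curves ∧ j ∈ (T k).curves) ∧ x = h.point k := by
  constructor
  · rintro ⟨hi, hj⟩
    obtain ⟨k, rfl⟩ := h.exists_eq_point hij hi hj
    exact ⟨k, ⟨(h.mem_locus_point k i).mp hi, (h.mem_locus_point k j).mp hj⟩, rfl⟩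
  · rintro ⟨k, ⟨hi, hj⟩, rfl⟩
    exact ⟨(h.mem_locus_point k i).mpr hi, (h.mem_locus_point k j).mpr hj⟩

theorem ncard_eq (p : Fin N → Prop) [DecidablePred p] :
    {x | ∃ k, p k ∧ x = h.point k}.ncard = (Finset.univ.filter p).card := by
  have : {x | ∃ k, p k ∧ x = h.point k} = h.point '' (Finset.univ.filter p : Finset (Fin N)) := by
    ext x
    simp [eq_comm]
  rw [this, Set.ncard_image_of_injective _ h.point_injective, Set.ncard_coe_finset]

theorem linearIndependent_iff {i j : Fin n} (hij : i ≠ j) {k : Fin N} (hi : i ∈ (T k).curves)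
    (hj : j ∈ (T k).curves) :
    LinearIndependent ℂ ![gradAt (c i).poly (h.point k), gradAt (c j).poly (h.point k)] ↔
      ¬ (T k).tangent i j = true := by
  rw [← h.tangency k i j hij hi hj, ← not_iff_not, ← cross3_eq_zero_iff, not_not]
  obtain ⟨a, ha, hga⟩ := gradAt_mk (c i).isHomogeneous_poly (intVec_ne_zero (h.ne_zero k))
  obtain ⟨b, hb, hgb⟩ := gradAt_mk (c j).isHomogeneous_poly (intVec_ne_zero (h.ne_zero k))
  simp only [PlaneForm.eval_pderiv_poly, PlaneForm.grad_intVec] at hga hgb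
  rw [point, hga, hgb, cross3_smul_smul]
  change (a * b) • cross3 (intVec ((c i).grad (pt k))) (intVec ((c j).grad (pt k))) = 0 ↔ _
  rw [cross3_intVec, smul_eq_zero, or_iff_right (mul_ne_zero ha hb)]
  refine ⟨fun h0 => ?_, fun h0 => ?_⟩
  · by_contra hne
    exact intVec_ne_zero hne h0
  · rw [h0]
    funext m
    simp [intVec]

theorem transversal {i j : Fin n} (hij : i ≠ j) (hT : ∀ k, (T k).tangent i j = false) :
    Transversal (c i).poly (c j).poly := by
  rintro x ⟨hi, hj⟩
  obtain ⟨k, ⟨hik, hjk⟩, rfl⟩ := (h.mem_inter_iff hij x).mp ⟨hi, hj⟩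
  rw [h.linearIndependent_iff hij hik hjk, hT]
  simp

theorem tangencyPoints_eq {i j : Fin n} (hij : i ≠ j) :
    tangencyPoints (c i).poly (c j).poly =
      {x | ∃ k, (T k).tangent i j = true ∧ x = h.point k} := by
  ext x
  constructor
  · rintro ⟨hi, hj, -, -, hx⟩
    obtain ⟨k, ⟨hik, hjk⟩, rfl⟩ := (h.mem_inter_iff hij x).mp ⟨hi, hj⟩
    rw [h.linearIndependent_iff hij hik hjk, not_not] at hx
    exact ⟨k, hx, rfl⟩
  · rintro ⟨k, hk, rfl⟩
    obtain ⟨hik, hjk⟩ := PointType.mem_curves_of_tangent hk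
    refine ⟨(h.mem_locus_point k i).mpr hik, (h.mem_locus_point k j).mpr hjk,
      (h.nondegenerate i).gradAt_ne_zero _, (h.nondegenerate j).gradAt_ne_zero _, ?_⟩
    rw [h.linearIndependent_iff hij hik hjk, not_not]
    exact hk

theorem ncard_tangencyPoints {i j : Fin n} (hij : i ≠ j) :
    (tangencyPoints (c i).poly (c j).poly).ncard =
      (Finset.univ.filter fun k => (T k).tangent i j = true).card := by
  rw [h.tangencyPoints_eq hij, h.ncard_eq]

theorem isTangentTo {i j : Fin n} (hij : i ≠ j) (hT : ∃ k, (T k).tangent i j = true) :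
    IsTangentTo (c i).poly (c j).poly := by
  obtain ⟨k, hk⟩ := hT
  rw [IsTangentTo, h.tangencyPoints_eq hij]
  exact ⟨_, k, hk, rfl⟩

theorem tangencyPoints_diff_nonempty {i j l : Fin n} (hij : i ≠ j)
    (hT : ∃ k, (T k).tangent i j = true ∧ l ∉ (T k).curves) :
    (tangencyPoints (c i).poly (c j).poly \ locus (c l).poly).Nonempty := by
  obtain ⟨k, hk, hl⟩ := hT
  rw [h.tangencyPoints_eq hij]
  exact ⟨_, ⟨k, hk, rfl⟩, fun hx => hl ((h.mem_locus_point k l).mp hx)⟩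

theorem inter_inter_eq {i j l : Fin n} (hij : i ≠ j) :
    locus (c i).poly ∩ locus (c j).poly ∩ locus (c l).poly =
      {x | ∃ k, (i ∈ (T k).curves ∧ j ∈ (T k).curves ∧ l ∈ (T k).curves) ∧ x = h.point k} := by
  ext x
  constructor
  · rintro ⟨hx, hl⟩
    obtain ⟨k, ⟨hi, hj⟩, rfl⟩ := (h.mem_inter_iff hij x).mp hx
    exact ⟨k, ⟨hi, hj, (h.mem_locus_point k l).mp hl⟩, rfl⟩
  · rintro ⟨k, ⟨hi, hj, hl⟩, rfl⟩
    exact ⟨(h.mem_inter_iff hij _).mpr ⟨k, ⟨hi, hj⟩, rfl⟩, (h.mem_locus_point k l).mpr hl⟩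

theorem ncard_inter_inter {i j l : Fin n} (hij : i ≠ j) :
    (locus (c i).poly ∩ locus (c j).poly ∩ locus (c l).poly).ncard =
      (Finset.univ.filter fun k =>
        i ∈ (T k).curves ∧ j ∈ (T k).curves ∧ l ∈ (T k).curves).card := by
  rw [h.inter_inter_eq hij, h.ncard_eq]

theorem inter_inter_eq_empty {i j l : Fin n} (hij : i ≠ j)
    (hT : ∀ k, ¬ (i ∈ (T k).curves ∧ j ∈ (T k).curves ∧ l ∈ (T k).curves)) :
    locus (c i).poly ∩ locus (c j).poly ∩ locus (c l).poly = ∅ := by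
  rw [h.inter_inter_eq hij]
  exact Set.eq_empty_of_forall_notMem fun x ⟨k, hk, _⟩ => hT k hk

theorem inter_subset {i j l : Fin n} (hij : i ≠ j)
    (hT : ∀ k, i ∈ (T k).curves → j ∈ (T k).curves → l ∈ (T k).curves) :
    locus (c i).poly ∩ locus (c j).poly ⊆ locus (c l).poly := by
  intro x hx
  obtain ⟨k, ⟨hi, hj⟩, rfl⟩ := (h.mem_inter_iff hij x).mp hx
  exact (h.mem_locus_point k l).mpr (hT k hi hj)

theorem inter_nonempty {i j l : Fin n}
    (hT : ∃ k, i ∈ (T k).curves ∧ j ∈ (T k).curves ∧ l ∈ (T k).curves) :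
    (locus (c i).poly ∩ (locus (c j).poly ∩ locus (c l).poly)).Nonempty := by
  obtain ⟨k, hi, hj, hl⟩ := hT
  exact ⟨h.point k, (h.mem_locus_point k i).mpr hi, (h.mem_locus_point k j).mpr hj,
    (h.mem_locus_point k l).mpr hl⟩

theorem isSmoothConic (i : Fin n) (hi : deg i = 2) : IsSmoothConic (c i).poly :=
  (h.nondegenerate i).isSmoothConic ((h.degree i).trans hi)

theorem isLine (i : Fin n) (hi : deg i = 1) : IsLine (c i).poly :=
  (h.nondegenerate i).isLine ((h.degree i).trans hi)

/-- The components are smooth. On exactly one component, the gradient of the product is the nonzero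
gradient of that component times nonzero values; on two or more, every term of the product rule
vanishes. -/
theorem singLocus_eq : singLocus (arrangement c) = Set.range h.point := by
  have hmem : ∀ x, x ∈ locus (arrangement c) ↔ ∃ i, x ∈ locus (c i).poly := by
    intro x
    change eval x.rep (∏ i, (c i).poly) = 0 ↔ _
    rw [map_prod, Finset.prod_eq_zero_iff]
    simp [locus]
  ext x
  constructor
  · rintro ⟨hx, hgrad⟩
    obtain ⟨i, hi⟩ := (hmem x).mp hx
    by_contra hne
    have hother : ∀ j, j ≠ i → eval x.rep (c j).poly ≠ 0 := by
      intro j hj hj0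
      obtain ⟨k, rfl⟩ := h.exists_eq_point hj.symm hi hj0
      exact hne ⟨k, rfl⟩
    obtain ⟨m, hm⟩ := Function.ne_iff.mp ((h.nondegenerate i).gradAt_ne_zero x)
    have h0 : eval x.rep (pderiv m (arrangement c)) = 0 := congrFun hgrad m
    have hi' : eval x.rep (c i).poly = 0 := hi
    rw [pderiv_arrangement c i, map_add, map_mul, map_mul, hi', zero_mul, add_zero,
      map_prod] at h0
    rcases mul_eq_zero.mp h0 with h1 | h1
    · exact hm h1
    · obtain ⟨j, hj, hj0⟩ := Finset.prod_eq_zero_iff.mp h1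
      exact hother j (Finset.ne_of_mem_erase hj) hj0
  · rintro ⟨k, rfl⟩
    obtain ⟨i, j, hij, hi, hj⟩ := h.multiple k
    have hi' : eval (h.point k).rep (c i).poly = 0 := (h.mem_locus_point k i).mpr hi
    have hj' : eval (h.point k).rep (c j).poly = 0 := (h.mem_locus_point k j).mpr hj
    refine ⟨(hmem _).mpr ⟨i, hi'⟩, funext fun m => ?_⟩
    rw [gradAt, pderiv_arrangement c i, map_add, map_mul, map_mul, hi', map_prod,
      Finset.prod_eq_zero (Finset.mem_erase.mpr ⟨hij.symm, Finset.mem_univ j⟩) hj']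
    simp

theorem not_associated {i j : Fin n} (hij : i ≠ j) : ¬ Associated (c i).poly (c j).poly := by
  rintro ⟨u, hu⟩
  obtain ⟨k, hi, hj⟩ := h.separated i j hij
  refine hj ((h.mem_locus_point k j).mp ?_)
  have hi' : eval (h.point k).rep (c i).poly = 0 := (h.mem_locus_point k i).mpr hi
  change eval _ _ = 0
  rw [← hu, map_mul, hi', zero_mul]

theorem isConicLineArrangement (hn : 0 < ∑ i, deg i) :
    IsConicLineArrangement (∑ i, deg i) (arrangement c) where
  pos := hn
  homogeneous := by
    have := isHomogeneous_arrangement c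
    simpa only [h.degree] using this
  squarefree := by
    refine Finset.squarefree_prod_of_pairwise_isCoprime (fun i _ j _ hij => ?_)
      fun i _ => (h.nondegenerate i).irreducible.squarefree
    exact ((h.nondegenerate i).irreducible.isRelPrime_iff_not_dvd).mpr fun hdvd =>
      h.not_associated hij ((h.nondegenerate i).irreducible.associated_of_dvd
        (h.nondegenerate j).irreducible hdvd)
  degree_le_two := by
    intro g hg hdvd
    obtain ⟨i, _, hi⟩ := (hg.prime.dvd_finsetProd_iff _).mp hdvd
    refine (totalDegree_le_of_dvd_of_isDomain hi (h.nondegenerate i).poly_ne_zero).trans ?_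
    rw [(h.nondegenerate i).totalDegree_poly]
    rcases (c i).degree_eq with h1 | h1 <;> omega

end

/-- The bijection of singular points matches equal labels `k`. Both points have the type `T k`,
hence the same local model with the same labelling of components. -/
theorem sameCombinatorics {c' : Fin n → PlaneForm} {pt' : Fin N → Fin 3 → ℤ}
    {meetings' : List (Meeting N)} (h : Realizes deg T c pt meetings)
    (h' : Realizes deg T c' pt' meetings') :
    SameCombinatorics (arrangement c) (arrangement c') := by
  let e := (Equiv.ofInjective _ h.point_injective).trans (Equiv.setCongr h.singLocus_eq.symm)
  let e' := (Equiv.ofInjective _ h'.point_injective).trans (Equiv.setCongr h'.singLocus_eq.symm)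
  refine ⟨n, fun i => (c i).poly, fun i => (c' i).poly, rfl, rfl,
    fun i => (h.nondegenerate i).irreducible, fun i => (h'.nondegenerate i).irreducible,
    fun i => ?_, e.symm.trans e', fun P => ?_⟩
  · rw [(h.nondegenerate i).totalDegree_poly, (h'.nondegenerate i).totalDegree_poly, h.degree,
      h'.degree]
  · obtain ⟨k, hk⟩ := e.surjective P
    have hψ : (e.symm.trans e') P = e' k := by
      rw [Equiv.trans_apply, ← hk, Equiv.symm_apply_apply]
    rw [hψ, ← hk]
    exact ((h.local_check k).hasLocalModel _).exists_homeomorph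
      ((h'.local_check k).hasLocalModel _)

theorem isStrongZieglerPair {c' : Fin n → PlaneForm} {pt' : Fin N → Fin 3 → ℤ}
    {meetings' : List (Meeting N)} (h : Realizes deg T c pt meetings)
    (h' : Realizes deg T c' pt' meetings') (hn : 0 < ∑ i, deg i)
    (h3 : HasThreeGenerators (arrangement c)) (h3' : ¬ HasThreeGenerators (arrangement c')) :
    IsStrongZieglerPair (arrangement c) (arrangement c') where
  left := ⟨_, (h.isConicLineArrangement hn).toIsReducedCurve⟩
  right := ⟨_, (h'.isConicLineArrangement hn).toIsReducedCurve⟩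
  sameCombinatorics := h.sameCombinatorics h'
  not_isomorphic := fun hiso => h3' (HasThreeGenerators.of_isomorphic hiso h3)

end Realizes

/-- A point of `C` lies on at most one of `L` and `M`, and there the gradient of `L * M` is a
nonzero multiple of the gradient of the factor that vanishes. -/
theorem transversal_mul {C L M : PolyS} (hL : Transversal C L) (hM : Transversal C M)
    (h : locus L ∩ locus M ∩ locus C = ∅) : Transversal C (L * M) := by
  rintro x ⟨hC, hLM⟩
  have hLM' : eval x.rep L * eval x.rep M = 0 := by
    rw [← map_mul]
    exact hLM
  have hne : ¬ (eval x.rep L = 0 ∧ eval x.rep M = 0) := fun ⟨h1, h2⟩ =>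
    Set.notMem_empty x (h ▸ ⟨⟨h1, h2⟩, hC⟩)
  have hgrad : gradAt (L * M) x =
      eval x.rep M • gradAt L x + eval x.rep L • gradAt M x := by
    funext i
    simp only [gradAt, pderiv_mul, map_add, map_mul, Pi.add_apply, Pi.smul_apply, smul_eq_mul]
    ring
  have hsmul : ∀ {a b : Fin 3 → ℂ} {t : ℂ}, t ≠ 0 → LinearIndependent ℂ ![a, b] →
      LinearIndependent ℂ ![a, t • b] := by
    intro a b t ht hab
    by_contra h0
    rw [← cross3_eq_zero_iff, ← one_smul ℂ a, cross3_smul_smul, smul_eq_zero,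
      or_iff_right (by simpa using ht), cross3_eq_zero_iff] at h0
    exact h0 hab
  rw [hgrad]
  rcases mul_eq_zero.mp hLM' with h0 | h0
  · rw [h0, zero_smul, add_zero]
    exact hsmul (fun h1 => hne ⟨h0, h1⟩) (hL x ⟨hC, h0⟩)
  · rw [h0, zero_smul, zero_add]
    exact hsmul (fun h1 => hne ⟨h1, h0⟩) (hM x ⟨hC, h0⟩)

/-! ## The five combinatorics -/

namespace Realizes

/-- The singular points of an arrangement with combinatorics `Cmb₁₂₃`. -/
def type123 : Fin 10 → PointType 5 :=
  ![.node 0 3, .node 0 3, .node 1 4, .node 1 4, .tacnode 0 1, .tacnode 0 4, .tacnode 1 3,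
    .triple 0 1 2, .triple 0 1 2, .triple 2 3 4]

/-- The singular points of an arrangement with combinatorics `Cmb₁₂₄`. -/
def type124 : Fin 11 → PointType 5 :=
  ![.node 0 2, .node 0 3, .node 1 4, .node 1 4, .node 2 3, .tacnode 0 1, .tacnode 0 1,
    .tacnode 1 2, .tacnode 1 3, .triple 0 2 4, .triple 0 3 4]

/-- The singular points of an arrangement with combinatorics `Cmb₂₁₂`. -/
def type212 : Fin 11 → PointType 5 :=
  ![.node 0 1, .node 0 1, .node 2 3, .node 2 4, .node 3 4, .tacnode 0 3, .tacnode 0 4,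
    .tacnode 1 3, .tacnode 1 4, .triple 0 1 2, .triple 0 1 2]

/-- The singular points of an arrangement with combinatorics `Cmb₂₂₄`. -/
def type224 : Fin 10 → PointType 4 :=
  ![.node 0 1, .node 0 1, .node 2 3, .node 2 3, .tacnode 0 2, .tacnode 0 2, .tacnode 1 2,
    .tacnode 1 2, .triple 0 1 3, .triple 0 1 3]

/-- The singular points of an arrangement with combinatorics `Cmb₂₂₃` plus another bitangent. -/
def type223 : Fin 15 → PointType 5 :=
  ![.node 0 1, .node 0 1, .node 2 3, .node 2 3, .node 2 4, .node 2 4, .node 3 4, .tacnode 0 2,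
    .tacnode 0 3, .tacnode 0 4, .tacnode 1 2, .tacnode 1 3, .tacnode 1 4, .triple 0 1 2,
    .triple 0 1 2]

theorem exists_tangencyPoints_eq_singleton {n N : ℕ} {deg : Fin n → ℕ} {T : Fin N → PointType n}
    {c : Fin n → PlaneForm} {pt : Fin N → Fin 3 → ℤ} {meetings : List (Meeting N)}
    (h : Realizes deg T c pt meetings) {i j l : Fin n} (hij : i ≠ j)
    (hT : ∃ k, (∀ k', (T k').tangent i j = true ↔ k' = k) ∧ l ∉ (T k).curves) :
    ∃ p, tangencyPoints (c i).poly (c j).poly = {p} ∧ p ∉ locus (c l).poly := by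
  obtain ⟨k, hk, hl⟩ := hT
  refine ⟨h.point k, ?_, fun hx => hl ((h.mem_locus_point k l).mp hx)⟩
  rw [h.tangencyPoints_eq hij]
  ext x
  simp [hk]

/-- The components are numbered in the order `C, D, L₁, L₂, M`. Every condition is evaluated on the
table `type123`, so it holds for both members of the pair at once. -/
theorem hasCmb123 {c : Fin 5 → PlaneForm} {pt : Fin 10 → Fin 3 → ℤ} {meetings : List (Meeting 10)}
    (h : Realizes ![2, 2, 1, 1, 1] type123 c pt meetings) : HasCmb123 (arrangement c) := by
  have hempty : locus (c 2).poly ∩ locus (c 3).poly ∩ locus (c 0).poly = ∅ :=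
    h.inter_inter_eq_empty (by decide) (by decide +kernel)
  refine ⟨(c 0).poly, (c 1).poly, (c 2).poly, (c 3).poly, (c 4).poly, Fin.prod_univ_five _,
    h.isSmoothConic 0 rfl, h.isSmoothConic 1 rfl, h.isLine 2 rfl, h.isLine 3 rfl, h.isLine 4 rfl,
    transversal_mul (h.transversal (by decide) (by decide +kernel))
      (h.transversal (by decide) (by decide +kernel)) hempty, hempty,
    h.transversal (by decide) (by decide +kernel),
    h.exists_tangencyPoints_eq_singleton (by decide) (by decide +kernel),
    h.isTangentTo (by decide) (by decide +kernel), ?_,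
    h.inter_subset (by decide) (by decide +kernel), h.isTangentTo (by decide) (by decide +kernel)⟩
  rw [h.ncard_inter_inter (by decide)]
  decide +kernel

theorem hasCmb124 {c : Fin 5 → PlaneForm} {pt : Fin 11 → Fin 3 → ℤ} {meetings : List (Meeting 11)}
    (h : Realizes ![2, 2, 1, 1, 1] type124 c pt meetings) : HasCmb124 (arrangement c) := by
  have hempty : locus (c 2).poly ∩ locus (c 3).poly ∩ locus (c 0).poly = ∅ :=
    h.inter_inter_eq_empty (by decide) (by decide +kernel)
  refine ⟨(c 0).poly, (c 1).poly, (c 2).poly, (c 3).poly, (c 4).poly, Fin.prod_univ_five _,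
    h.isSmoothConic 0 rfl, h.isSmoothConic 1 rfl, h.isLine 2 rfl, h.isLine 3 rfl, h.isLine 4 rfl,
    transversal_mul (h.transversal (by decide) (by decide +kernel))
      (h.transversal (by decide) (by decide +kernel)) hempty, hempty,
    h.transversal (by decide) (by decide +kernel), ?_,
    h.tangencyPoints_diff_nonempty (by decide) (by decide +kernel),
    h.tangencyPoints_diff_nonempty (by decide) (by decide +kernel),
    h.inter_nonempty (by decide +kernel), h.inter_nonempty (by decide +kernel)⟩
  rw [h.ncard_tangencyPoints (by decide)]
  decide +kernel

theorem hasCmb212 {c : Fin 5 → PlaneForm} {pt : Fin 11 → Fin 3 → ℤ} {meetings : List (Meeting 11)}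
    (h : Realizes ![2, 2, 1, 1, 1] type212 c pt meetings) : HasCmb212 (arrangement c) := by
  refine ⟨(c 0).poly, (c 1).poly, (c 2).poly, (c 3).poly, (c 4).poly, Fin.prod_univ_five _,
    h.isSmoothConic 0 rfl, h.isSmoothConic 1 rfl, h.isLine 2 rfl, h.isLine 3 rfl, h.isLine 4 rfl,
    h.transversal (by decide) (by decide +kernel),
    h.inter_inter_eq_empty (by decide) (by decide +kernel), ?_,
    h.isTangentTo (by decide) (by decide +kernel), h.isTangentTo (by decide) (by decide +kernel),
    h.isTangentTo (by decide) (by decide +kernel), h.isTangentTo (by decide) (by decide +kernel)⟩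
  rw [h.ncard_inter_inter (by decide)]
  decide +kernel

theorem hasCmb224 {c : Fin 4 → PlaneForm} {pt : Fin 10 → Fin 3 → ℤ} {meetings : List (Meeting 10)}
    (h : Realizes ![2, 2, 2, 1] type224 c pt meetings) : HasCmb224 (arrangement c) := by
  refine ⟨(c 0).poly, (c 1).poly, (c 2).poly, (c 3).poly, Fin.prod_univ_four _,
    h.isSmoothConic 0 rfl, h.isSmoothConic 1 rfl, h.isSmoothConic 2 rfl, h.isLine 3 rfl,
    h.transversal (by decide) (by decide +kernel), ?_, ?_, ?_,
    h.transversal (by decide) (by decide +kernel)⟩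
  · rw [h.ncard_tangencyPoints (by decide)]
    decide +kernel
  · rw [h.ncard_tangencyPoints (by decide)]
    decide +kernel
  · rw [h.ncard_inter_inter (by decide)]
    decide +kernel

end Realizes

/-! ### Bitangents of two conics, including those outside the arrangement. -/

/-- The line with the given coefficients. -/
def lineOf (l : Fin 3 → ℤ) : PlaneForm := .line (l 0) (l 1) (l 2)

/-- The line `l` is tangent to `f` at `p`, and is not tangent to it at any point of `g`. -/
structure TangentLineCheck (f g : PlaneForm) (l p : Fin 3 → ℤ) : Prop where
  ne_zero : p ≠ 0
  -- The vector `cross3 l p` is an auxiliary second point of the line. With `p` as the only listed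
  -- point, the check can succeed only through its second alternative, so that the line meets `f`
  -- nowhere else.
  chord : ChordCheck f (fun _ : Fin 1 => p) l 0 (cross3 l p)
  tangent : cross3 l (f.grad p) = 0
  off : g.val p ≠ 0

instance (f g : PlaneForm) (l p : Fin 3 → ℤ) : Decidable (TangentLineCheck f g l p) :=
  decidable_of_iff (p ≠ 0 ∧ ChordCheck f (fun _ : Fin 1 => p) l 0 (cross3 l p) ∧
    cross3 l (f.grad p) = 0 ∧ g.val p ≠ 0)
    ⟨fun h => ⟨h.1, h.2.1, h.2.2.1, h.2.2.2⟩, fun h => ⟨h.1, h.2, h.3, h.4⟩⟩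

namespace TangentLineCheck

variable {f g : PlaneForm} {l p : Fin 3 → ℤ}

theorem mem_locus (h : TangentLineCheck f g l p) :
    Projectivization.mk ℂ (intVec p) (intVec_ne_zero h.ne_zero) ∈ locus (lineOf l).poly := by
  rw [mem_locus_mk (lineOf l).isHomogeneous_poly, PlaneForm.eval_poly, PlaneForm.val_intVec,
    Int.cast_eq_zero]
  exact h.chord.2.1

theorem isTangentTo (h : TangentLineCheck f g l p) (hf : f.Nondegenerate) :
    IsTangentTo (lineOf l).poly f.poly := by
  have hl : (lineOf l).Nondegenerate := by
    by_contra h0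
    simp only [lineOf, PlaneForm.Nondegenerate, not_or, not_not] at h0
    refine h.chord.1 (funext fun i => ?_)
    fin_cases i
    · exact h0.1
    · exact h0.2.1
    · exact h0.2.2
  refine ⟨_, h.mem_locus, ?_, hl.gradAt_ne_zero _, hf.gradAt_ne_zero _, ?_⟩
  · rw [mem_locus_mk f.isHomogeneous_poly, PlaneForm.eval_poly, PlaneForm.val_intVec,
      Int.cast_eq_zero]
    exact h.chord.2.2.2.2.1
  · obtain ⟨a, _, ha⟩ := gradAt_mk (lineOf l).isHomogeneous_poly (intVec_ne_zero h.ne_zero)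
    obtain ⟨b, _, hb⟩ := gradAt_mk f.isHomogeneous_poly (intVec_ne_zero h.ne_zero)
    simp only [PlaneForm.eval_pderiv_poly] at ha hb
    rw [← cross3_eq_zero_iff, ha, hb, cross3_smul_smul]
    change (a * b) • cross3 ((lineOf l).grad (intVec p)) (f.grad (intVec p)) = 0
    have hgl : (lineOf l).grad p = l := by
      funext i
      fin_cases i <;> rfl
    rw [PlaneForm.grad_intVec, PlaneForm.grad_intVec, cross3_intVec, hgl, h.tangent]
    funext i
    simp [intVec]

theorem inter_inter_eq_empty (h : TangentLineCheck f g l p) :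
    locus f.poly ∩ locus (lineOf l).poly ∩ locus g.poly = ∅ := by
  refine Set.eq_empty_of_forall_notMem fun x ⟨⟨hf, hl⟩, hg⟩ => h.off ?_
  rw [PlaneForm.mem_locus] at hf hl
  obtain ⟨_, t, ht⟩ := h.chord.exists_eq_smul
    (by simpa [lineOf, PlaneForm.val, dot3, intVec] using hl) hf
  rw [eq_mk_of_eq_smul (intVec_ne_zero h.ne_zero) ht, mem_locus_mk g.isHomogeneous_poly,
    PlaneForm.eval_poly, PlaneForm.val_intVec, Int.cast_eq_zero] at hg
  exact hg

end TangentLineCheck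

/-- The lines `m` are the four bitangents of `f` and `f'`, with the points of contact `t` and
`t'`. -/
structure BitangentCheck (f f' g : PlaneForm) (m t t' : Fin 4 → Fin 3 → ℤ) : Prop where
  left : ∀ k, TangentLineCheck f g (m k) (t k)
  right : ∀ k, TangentLineCheck f' g (m k) (t' k)
  distinct : ∀ k l, k ≠ l → dot3 (m l) (t k) ≠ 0

/-- Only two of the four bitangents are components. The conditions on the other two are not visible
in the table of singular points and come from `BitangentCheck`. -/
theorem Realizes.hasCmb223PlusBitangent {c : Fin 5 → PlaneForm} {pt : Fin 15 → Fin 3 → ℤ}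
    {meetings : List (Meeting 15)} (h : Realizes ![2, 2, 2, 1, 1] type223 c pt meetings)
    {m t t' : Fin 4 → Fin 3 → ℤ} (hb : BitangentCheck (c 0) (c 1) (c 2) m t t')
    (h3 : c 3 = lineOf (m 0)) (h4 : c 4 = lineOf (m 1)) :
    HasCmb223PlusBitangent (arrangement c) := by
  have hpos : ∀ i : Fin 5, i = 3 ∨ i = 4 →
      Cmb223Position (c 0).poly (c 1).poly (c 2).poly (c i).poly := by
    intro i hi
    have h2 : (locus (c 2).poly ∩ (locus (c 0).poly ∩ locus (c 1).poly)).ncard = 2 := by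
      rw [← Set.inter_assoc, h.ncard_inter_inter (by decide)]
      decide +kernel
    rcases hi with rfl | rfl
    · exact ⟨h.isSmoothConic 0 rfl, h.isSmoothConic 1 rfl, h.isSmoothConic 2 rfl, h.isLine 3 rfl,
        h.transversal (by decide) (by decide +kernel), h2,
        h.tangencyPoints_diff_nonempty (by decide) (by decide +kernel),
        h.tangencyPoints_diff_nonempty (by decide) (by decide +kernel),
        h.isTangentTo (by decide) (by decide +kernel),
        h.isTangentTo (by decide) (by decide +kernel),
        h.transversal (by decide) (by decide +kernel)⟩
    · exact ⟨h.isSmoothConic 0 rfl, h.isSmoothConic 1 rfl, h.isSmoothConic 2 rfl, h.isLine 4 rfl,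
        h.transversal (by decide) (by decide +kernel), h2,
        h.tangencyPoints_diff_nonempty (by decide) (by decide +kernel),
        h.tangencyPoints_diff_nonempty (by decide) (by decide +kernel),
        h.isTangentTo (by decide) (by decide +kernel),
        h.isTangentTo (by decide) (by decide +kernel),
        h.transversal (by decide) (by decide +kernel)⟩
  have hpos3 := hpos 3 (Or.inl rfl)
  have hpos4 := hpos 4 (Or.inr rfl)
  have hprod : arrangement c = (c 0).poly * (c 1).poly * (c 2).poly * (c 3).poly * (c 4).poly :=
    Fin.prod_univ_five _
  have hempty : locus (c 2).poly ∩ locus (c 3).poly ∩ locus (c 4).poly = ∅ :=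
    h.inter_inter_eq_empty (by decide) (by decide +kernel)
  rw [h3] at hpos3
  rw [h4] at hpos4
  rw [h3, h4] at hprod hempty
  refine ⟨(c 0).poly, (c 1).poly, (c 2).poly, fun k => (lineOf (m k)).poly, 0, 1, by decide, hprod,
    fun k => ⟨⟨(lineOf (m k)).isHomogeneous_poly, fun h0 => ?_⟩,
      (hb.left k).isTangentTo (h.nondegenerate 0), (hb.right k).isTangentTo (h.nondegenerate 1)⟩,
    fun k l hkl heq => ?_, hpos3, hpos4,
    fun k => ⟨(hb.left k).inter_inter_eq_empty, (hb.right k).inter_inter_eq_empty⟩, hempty⟩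
  · obtain ⟨x, -, -, hx, -⟩ := (hb.left k).isTangentTo (h.nondegenerate 0)
    refine hx (funext fun i => ?_)
    have h0' : (lineOf (m k)).poly = 0 := h0
    rw [gradAt, h0']
    simp
  · have hmem := (hb.left k).mem_locus
    rw [heq, mem_locus_mk (lineOf (m l)).isHomogeneous_poly, PlaneForm.eval_poly,
      PlaneForm.val_intVec, Int.cast_eq_zero] at hmem
    exact hb.distinct k l hkl hmem

/-! ## The singular points of the ten arrangements -/

/-! ### The pair for `Cmb123`. -/

/-- The components of an arrangement. -/
def special123 : Fin 5 → PlaneForm :=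
  -- The involution `(x : y : z) ↦ (2z - x : 2z - y : z)` exchanges the two conics and the last two
  -- lines, and preserves the line `z = 0`.
  ![.conic 0 0 1 (-1) 0 0, .conic 0 0 3 1 (-2) (-2), .line 0 0 1, .line 9 16 (-26), .line 9 16
    (-24)]

/-- The singular points of `special123`. -/
def special123Points : Fin 10 → Fin 3 → ℤ :=
  ![![4, 1, 2], ![64, 81, 72], ![0, 3, 2], ![80, 63, 72], ![1, 1, 1], ![16, 9, 12], ![8, 15, 12],
    ![0, 1, 0], ![1, 0, 0], ![16, -9, 0]]

/-- The intersections of the components of `special123`. -/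
def special123Meetings : List (Meeting 10) :=
  [.pencil (-1) (-1) ![0, 0, 2] 7 ![1, 0, 0] ![1, 1, -2] 4 ![1, -1, 0], .line 7 ![1, 0, 0], .line 0
    ![64, 81, 72], .line 5 ![408, -492, -175], .line 6 ![582, -316, 7], .line 2 ![80, 63, 72], .line
    9 ![234, 416, 337], .line 9 ![216, 384, 337]]

theorem special123_realizes :
    Realizes ![2, 2, 1, 1, 1] Realizes.type123 special123 special123Points special123Meetings where
  degree := by decide +kernel
  nondegenerate := by decide +kernel
  ne_zero := by decide +kernel
  distinct := by decide +kernel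
  incidence := by decide +kernel
  tangency := by decide +kernel
  local_check := by decide +kernel
  separated := by decide +kernel
  multiple := by decide +kernel
  meeting := by decide +kernel

/-- The components of an arrangement. -/
def generic123 : Fin 5 → PlaneForm :=
  ![.conic 0 0 1 (-1) 0 0, .conic 0 0 1 (-3) 1 1, .line 0 0 1, .line 3 12 (-13), .line 1 4 4]

/-- The singular points of `generic123`. -/
def generic123Points : Fin 10 → Fin 3 → ℤ :=
  ![![9, 1, 3], ![16, 9, 12], ![0, 1, -1], ![20, -1, -4], ![1, 1, 1], ![4, 1, -2], ![5, 2, 3], ![0,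
    1, 0], ![1, 0, 0], ![4, -1, 0]]

/-- The intersections of the components of `generic123`. -/
def generic123Meetings : List (Meeting 10) :=
  [.pencil (-3) 1 ![0, 0, 1] 7 ![1, 0, 0] ![1, 1, -2] 4 ![1, -1, 0], .line 7 ![1, 0, 0], .line 0
    ![16, 9, 12], .line 5 ![4, -6, 5], .line 6 ![31, -37, -27], .line 2 ![20, -1, -4], .line 9 ![13,
    52, 51], .line 9 ![4, 16, -17]]

theorem generic123_realizes :
    Realizes ![2, 2, 1, 1, 1] Realizes.type123 generic123 generic123Points generic123Meetings where
  degree := by decide +kernel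
  nondegenerate := by decide +kernel
  ne_zero := by decide +kernel
  distinct := by decide +kernel
  incidence := by decide +kernel
  tangency := by decide +kernel
  local_check := by decide +kernel
  separated := by decide +kernel
  multiple := by decide +kernel
  meeting := by decide +kernel

/-! ### The pair for `Cmb124`. -/

/-- The components of an arrangement. -/
def special124 : Fin 5 → PlaneForm :=
  ![.conic 0 0 4 1 0 0, .conic 0 0 25 4 0 0, .line 1 (-4) 10, .line 4 (-1) (-10), .line 1 1 0]

/-- The singular points of `special124`. -/
def special124Points : Fin 11 → Fin 3 → ℤ :=
  ![![16, -1, -2], ![1, -16, 2], ![5, -5, -2], ![5, -5, 2], ![10, 10, 3], ![0, 1, 0], ![1, 0, 0],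
    ![20, -5, -4], ![5, -20, 4], ![2, -2, -1], ![2, -2, 1]]

/-- The intersections of the components of `special124`. -/
def special124Meetings : List (Meeting 11) :=
  [.pencil (-4) 1 ![0, 0, 9] 5 ![1, 0, 0] ![0, 0, 1] 5 ![1, 0, 0], .line 0 ![2, -2, -1], .line 1
    ![2, -2, 1], .line 9 ![2, -2, 1], .line 7 ![22, 68, 25], .line 8 ![68, 22, 25], .line 2 ![5, -5,
    2], .line 4 ![97, -112, 50], .line 9 ![1, -1, 4], .line 10 ![1, -1, -4]]

theorem special124_realizes :
    Realizes ![2, 2, 1, 1, 1] Realizes.type124 special124 special124Points special124Meetings where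
  degree := by decide +kernel
  nondegenerate := by decide +kernel
  ne_zero := by decide +kernel
  distinct := by decide +kernel
  incidence := by decide +kernel
  tangency := by decide +kernel
  local_check := by decide +kernel
  separated := by decide +kernel
  multiple := by decide +kernel
  meeting := by decide +kernel

/-- The components of an arrangement. -/
def generic124 : Fin 5 → PlaneForm :=
  -- In both arrangements the conics touch at `(1 : 0 : 0)` and `(0 : 1 : 0)`. Here `z ↦ -z`
  -- exchanges the tangent lines `L₁`, `L₂` and fixes the points of contact of the conics; in
  -- `special124` the tangent lines are exchanged by `x ↔ y`, which also exchanges the points of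
  -- contact.
  ![.conic 0 0 2 (-1) 0 0, .conic 0 0 25 (-8) 0 0, .line 1 2 (-5), .line 1 2 5, .line 2 (-1) 0]

/-- The singular points of `generic124`. -/
def generic124Points : Fin 11 → Fin 3 → ℤ :=
  ![![8, 1, 2], ![8, 1, -2], ![5, 10, -4], ![5, 10, 4], ![2, -1, 0], ![0, 1, 0], ![1, 0, 0], ![10,
    5, 4], ![10, 5, -4], ![1, 2, 1], ![1, 2, -1]]

/-- The intersections of the components of `generic124`. -/
def generic124Meetings : List (Meeting 11) :=
  [.pencil (-8) 1 ![0, 0, 9] 5 ![1, 0, 0] ![0, 0, 1] 5 ![1, 0, 0], .line 0 ![1, 2, 1], .line 1 ![1,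
    2, -1], .line 9 ![1, 2, -1], .line 7 ![11, -18, -5], .line 8 ![11, -18, 5], .line 2 ![5, 10, 4],
    .line 4 ![1, 2, -1], .line 9 ![1, 2, -5], .line 10 ![1, 2, 5]]

theorem generic124_realizes :
    Realizes ![2, 2, 1, 1, 1] Realizes.type124 generic124 generic124Points generic124Meetings where
  degree := by decide +kernel
  nondegenerate := by decide +kernel
  ne_zero := by decide +kernel
  distinct := by decide +kernel
  incidence := by decide +kernel
  tangency := by decide +kernel
  local_check := by decide +kernel
  separated := by decide +kernel
  multiple := by decide +kernel
  meeting := by decide +kernel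

/-! ### The pair for `Cmb212`. -/

/-- The components of an arrangement. -/
def special212 : Fin 5 → PlaneForm :=
  ![.conic 4 1 (-5) 0 0 0, .conic 1 4 (-5) 0 0 0, .line 1 (-1) 0, .line 2 2 5, .line 2 2 (-5)]

/-- The singular points of `special212`. -/
def special212Points : Fin 11 → Fin 3 → ℤ :=
  ![![1, -1, -1], ![1, -1, 1], ![5, 5, -4], ![5, 5, 4], ![1, -1, 0], ![1, 4, -2], ![1, 4, 2], ![4,
    1, -2], ![4, 1, 2], ![1, 1, -1], ![1, 1, 1]]

/-- The intersections of the components of `special212`. -/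
def special212Meetings : List (Meeting 11) :=
  [.pencil 1 (-1) ![3, 3, 0] 0 ![1, -1, 1] ![1, -1, 0] 9 ![1, 1, 1], .line 9 ![1, 1, 1], .line 5
    ![8, -3, -2], .line 6 ![8, -3, 2], .line 7 ![3, -8, 2], .line 8 ![3, -8, -2], .line 2 ![1, -1,
    0], .line 3 ![1, -1, 0], .line 4 ![5, 5, 4]]

theorem special212_realizes :
    Realizes ![2, 2, 1, 1, 1] Realizes.type212 special212 special212Points special212Meetings where
  degree := by decide +kernel
  nondegenerate := by decide +kernel
  ne_zero := by decide +kernel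
  distinct := by decide +kernel
  incidence := by decide +kernel
  tangency := by decide +kernel
  local_check := by decide +kernel
  separated := by decide +kernel
  multiple := by decide +kernel
  meeting := by decide +kernel

/-- The components of an arrangement. -/
def generic212 : Fin 5 → PlaneForm :=
  -- The same conics and the same first line as in `special212`. There the two bitangents are
  -- exchanged by `z ↦ -z`, which preserves the other components; here one of them is replaced by a
  -- bitangent of the other pair.
  ![.conic 4 1 (-5) 0 0 0, .conic 1 4 (-5) 0 0 0, .line 1 (-1) 0, .line 2 2 5, .line 2 (-2) 5]

/-- The singular points of `generic212`. -/
def generic212Points : Fin 11 → Fin 3 → ℤ :=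
  ![![1, -1, -1], ![1, -1, 1], ![5, 5, -4], ![1, 1, 0], ![5, 0, -2], ![1, 4, -2], ![1, -4, -2], ![4,
    1, -2], ![4, -1, -2], ![1, 1, -1], ![1, 1, 1]]

/-- The intersections of the components of `generic212`. -/
def generic212Meetings : List (Meeting 11) :=
  [.pencil 1 (-1) ![3, 3, 0] 0 ![1, -1, 1] ![1, -1, 0] 9 ![1, 1, 1], .line 9 ![1, 1, 1], .line 5
    ![8, -3, -2], .line 6 ![8, 3, -2], .line 7 ![3, -8, 2], .line 8 ![3, 8, 2], .line 2 ![1, -1, 0],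
    .line 3 ![5, -5, -4], .line 4 ![4, 29, 10]]

theorem generic212_realizes :
    Realizes ![2, 2, 1, 1, 1] Realizes.type212 generic212 generic212Points generic212Meetings where
  degree := by decide +kernel
  nondegenerate := by decide +kernel
  ne_zero := by decide +kernel
  distinct := by decide +kernel
  incidence := by decide +kernel
  tangency := by decide +kernel
  local_check := by decide +kernel
  separated := by decide +kernel
  multiple := by decide +kernel
  meeting := by decide +kernel

/-! ### The pair for `Cmb224`. -/

/-- The components of an arrangement. -/
def special224 : Fin 4 → PlaneForm :=
  ![.conic 7 (-5) (-2) 0 0 0, .conic 5 (-7) 2 0 0 0, .conic 29 29 (-8) 14 0 0, .line 1 (-1) 0]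

/-- The singular points of `special224`. -/
def special224Points : Fin 10 → Fin 3 → ℤ :=
  ![![1, -1, -1], ![1, -1, 1], ![1, 1, -3], ![1, 1, 3], ![7, -1, -13], ![7, -1, 13], ![1, -7, -13],
    ![1, -7, 13], ![1, 1, -1], ![1, 1, 1]]

/-- The intersections of the components of `special224`. -/
def special224Meetings : List (Meeting 10) :=
  [.pencil 1 1 ![12, 12, 0] 0 ![1, -1, 1] ![1, -1, 0] 8 ![1, 1, 1], .pencil (-4) 1 ![1, 7, 0] 4 ![7,
    -1, 13] ![1, 7, 0] 4 ![7, -1, 13], .line 8 ![1, 1, 1], .pencil 4 1 ![7, 1, 0] 6 ![1, -7, 13]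
    ![7, 1, 0] 6 ![1, -7, 13], .line 2 ![1, 1, 3]]

theorem special224_realizes :
    Realizes ![2, 2, 2, 1] Realizes.type224 special224 special224Points special224Meetings where
  degree := by decide +kernel
  nondegenerate := by decide +kernel
  ne_zero := by decide +kernel
  distinct := by decide +kernel
  incidence := by decide +kernel
  tangency := by decide +kernel
  local_check := by decide +kernel
  separated := by decide +kernel
  multiple := by decide +kernel
  meeting := by decide +kernel

/-- The components of an arrangement. -/
def generic224 : Fin 4 → PlaneForm :=
  -- In both arrangements `C₁` and `C₂` meet at `(1 : ±1 : ±1)` and `z ↦ -z` preserves the three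
  -- conics. It preserves the line of `special224`, but not the one chosen here.
  ![.conic 5 (-4) (-1) 0 0 0, .conic 5 11 (-16) 0 0 0, .conic 105 36 (-16) 100 0 0, .line 0 1 (-1)]

/-- The singular points of `generic224`. -/
def generic224Points : Fin 10 → Fin 3 → ℤ :=
  ![![1, -1, 1], ![1, 1, -1], ![2, -7, -7], ![2, -3, -3], ![2, -1, -4], ![2, -1, 4], ![4, -8, -7],
    ![4, -8, 7], ![1, -1, -1], ![1, 1, 1]]

/-- The intersections of the components of `generic224`. -/
def generic224Meetings : List (Meeting 10) :=
  [.pencil 16 (-1) ![75, 75, 0] 0 ![1, -1, -1] ![1, -1, 0] 1 ![1, 1, 1], .pencil (-16) 1 ![25, 50,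
    0] 4 ![2, -1, 4] ![1, 2, 0] 4 ![2, -1, 4], .line 8 ![1, 1, 1], .pencil (-1) 1 ![50, 25, 0] 6
    ![4, -8, 7] ![2, 1, 0] 6 ![4, -8, 7], .line 2 ![2, -3, -3]]

theorem generic224_realizes :
    Realizes ![2, 2, 2, 1] Realizes.type224 generic224 generic224Points generic224Meetings where
  degree := by decide +kernel
  nondegenerate := by decide +kernel
  ne_zero := by decide +kernel
  distinct := by decide +kernel
  incidence := by decide +kernel
  tangency := by decide +kernel
  local_check := by decide +kernel
  separated := by decide +kernel
  multiple := by decide +kernel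
  meeting := by decide +kernel

/-! ### The pair for `Cmb223` plus another bitangent. -/

/-- The components of an arrangement. -/
def special223 : Fin 5 → PlaneForm :=
  ![.conic 7 2 (-9) 0 0 0, .conic 7 18 (-25) 0 0 0, .conic 105 (-90) 88 (-103) 247 (-247), .line 7 6
    15, .line 7 6 (-15)]

/-- The singular points of `special223`. -/
def special223Points : Fin 15 → Fin 3 → ℤ :=
  ![![1, -1, -1], ![1, -1, 1], ![6, 13, -8], ![39, 7, -21], ![9, -13, -1], ![39, 37, 33], ![6, -7,
    0], ![223, 317, -247], ![3, 9, -5], ![3, 9, 5], ![463, 37, -247], ![15, 5, -9], ![15, 5, 9],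
    ![1, 1, -1], ![1, 1, 1]]

/-- The intersections of the components of `special223`. -/
def special223Meetings : List (Meeting 15) :=
  [.pencil 25 (-9) ![112, 112, 0] 0 ![1, -1, 1] ![1, -1, 0] 13 ![1, 1, 1], .pencil 88 9 ![1, -1, 0]
    13 ![1, 1, 1] ![1561, 634, 2223] 7 ![861289, -881296, -353455], .line 8 ![33, -16, -9], .line 9
    ![33, -16, 9], .pencil 88 25 ![1, -1, 0] 13 ![1, 1, 1] ![3241, 666, 6175] 10 ![392977, -3659552,
    188441], .line 11 ![129, -288, 55], .line 12 ![129, -288, -55], .line 2 ![39, 7, -21], .line 4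
    ![39, 37, 33], .line 6 ![21, 18, 17]]

theorem special223_realizes :
    Realizes ![2, 2, 2, 1, 1] Realizes.type223 special223 special223Points special223Meetings where
  degree := by decide +kernel
  nondegenerate := by decide +kernel
  ne_zero := by decide +kernel
  distinct := by decide +kernel
  incidence := by decide +kernel
  tangency := by decide +kernel
  local_check := by decide +kernel
  separated := by decide +kernel
  multiple := by decide +kernel
  meeting := by decide +kernel

theorem special223_bitangents : BitangentCheck (special223 0) (special223 1) (special223 2)
    ![![7, 6, 15], ![7, 6, -15], ![7, -6, 15], ![7, -6, -15]]
    ![![3, 9, -5], ![3, 9, 5], ![3, -9, -5], ![3, -9, 5]]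
    ![![15, 5, -9], ![15, 5, 9], ![15, -5, -9], ![15, -5, 9]] where
  left := by decide +kernel
  right := by decide +kernel
  distinct := by decide +kernel

/-- The components of an arrangement. -/
def generic223 : Fin 5 → PlaneForm :=
  -- In both arrangements `C₁` and `C₂` meet at `(1 : ±1 : ±1)`, the conic `D` passes through `(1 :
  -- 1 : ±1)`, and `z ↦ -z` exchanges the two bitangents used.
  ![.conic 4 1 (-5) 0 0 0, .conic 1 4 (-5) 0 0 0, .conic 8 8 (-7) (-9) (-15) 15, .line 2 2 5, .line
    2 2 (-5)]

/-- The singular points of `generic223`. -/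
def generic223Points : Fin 15 → Fin 3 → ℤ :=
  ![![1, -1, -1], ![1, -1, 1], ![2, 23, -10], ![11, 14, -10], ![14, 11, 10], ![23, 2, 10], ![1, -1,
    0], ![1, -11, 5], ![1, 4, -2], ![1, 4, 2], ![11, -1, 5], ![4, 1, -2], ![4, 1, 2], ![1, 1, -1],
    ![1, 1, 1]]

/-- The intersections of the components of `generic223`. -/
def generic223Meetings : List (Meeting 15) :=
  [.pencil 1 (-1) ![3, 3, 0] 0 ![1, -1, 1] ![1, -1, 0] 13 ![1, 1, 1], .pencil (-7) 5 ![3, -3, 0] 13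
    ![1, 1, 1] ![4, -11, -25] 7 ![110, 15, 11], .line 8 ![8, -3, -2], .line 9 ![8, -3, 2], .pencil
    (-7) 5 ![3, -3, 0] 13 ![1, 1, 1] ![11, -4, -25] 10 ![15, 110, -11], .line 11 ![3, -8, 2], .line
    12 ![3, -8, -2], .line 2 ![11, 14, -10], .line 4 ![23, 2, 10], .line 6 ![5, 5, 4]]

theorem generic223_realizes :
    Realizes ![2, 2, 2, 1, 1] Realizes.type223 generic223 generic223Points generic223Meetings where
  degree := by decide +kernel
  nondegenerate := by decide +kernel
  ne_zero := by decide +kernel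
  distinct := by decide +kernel
  incidence := by decide +kernel
  tangency := by decide +kernel
  local_check := by decide +kernel
  separated := by decide +kernel
  multiple := by decide +kernel
  meeting := by decide +kernel

theorem generic223_bitangents : BitangentCheck (generic223 0) (generic223 1) (generic223 2)
    ![![2, 2, 5], ![2, 2, -5], ![2, -2, 5], ![2, -2, -5]]
    ![![1, 4, -2], ![1, 4, 2], ![1, -4, -2], ![1, -4, 2]]
    ![![4, 1, -2], ![4, 1, 2], ![4, -1, -2], ![4, -1, 2]] where
  left := by decide +kernel
  right := by decide +kernel
  distinct := by decide +kernel

/-! ## Syzygies of the ten arrangements -/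

section Arrangements

open PlaneForm

/-! ### Syzygies for `Cmb123`. -/

/-- The gradient of the equation of `special123`. -/
def special123Grad : Fin 3 → CoeffList :=
  ![[[-2598, 2116, 1760, -2112, 512, 0, 0], [2286, 2820, -7400, 3776, -512, 0, 0], [-486, -3186,
    3564, -864, 0, 0], [0, 648, -324, 0, 0], [0, 0, 0, 0], [0, 0, 0], [0, 0], [0]], [[-3648, 4736,
    -1536, 0, 0, 0, 0], [2116, 3520, -6336, 2048, 0, 0, 0], [1410, -7400, 5664, -1024, 0, 0],
    [-1062, 2376, -864, 0, 0], [162, -162, 0, 0], [0, 0, 0], [0, 0], [0]], [[13104, -21888, 11840,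
    -2048, 0, 0, 0], [-15588, 10580, 7040, -6336, 1024, 0, 0], [5715, 5640, -11100, 3776, -256, 0],
    [-648, -3186, 2376, -288, 0], [0, 324, -81, 0], [0, 0, 0], [0, 0], [0]]]

theorem special123_grad : ∀ i, prodGradCoeffs i (List.ofFn special123) = special123Grad i := by decide +kernel

/-- The gradient of the equation of `generic123`. -/
def generic123Grad : Fin 3 → CoeffList :=
  ![[[-53, 227, 140, -188, -48, 0, 0], [4, 166, -494, -168, 288, 0, 0], [9, -33, -90, 216, 0, 0],
    [0, -12, 36, 0, 0], [0, 0, 0, 0], [0, 0, 0], [0, 0], [0]], [[-56, 88, 144, 0, 0, 0, 0], [227,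
    280, -564, -192, 0, 0, 0], [83, -494, -252, 576, 0, 0], [-11, -60, 216, 0, 0], [-3, 18, 0, 0],
    [0, 0, 0], [0, 0], [0]], [[-364, -336, 220, 192, 0, 0, 0], [-318, 1135, 560, -564, -96, 0, 0],
    [10, 332, -741, -168, 144, 0], [12, -33, -60, 72, 0], [0, -6, 9, 0], [0, 0, 0], [0, 0], [0]]]

theorem generic123_grad : ∀ i, prodGradCoeffs i (List.ofFn generic123) = generic123Grad i := by decide +kernel

/-- Generators of the Jacobian syzygies of `special123`. -/
def special123Generators : ThreeGenerators where
  deg := ![3, 4, 5]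
  ρ :=
    ![![[[-672, 448], [1490, -1256, 256], [-675, 324], [81]], [[651, -1646, 1096, -192], [-189, 648,
      -264], [0, -108]], [[48, -416, 256], [312, -96], [-108]]], ![[[336, -224], [-210, -192, 192],
      [-18, 196, -80], [18, -18]], [[-189, 140, 32, -32], [126, 108, -154, 32], [0, -108, 45]],
      [[14, 32, -32], [-18, -28, 32], [18, -18]]], ![[[-192, -16, 96], [538, -392, -200, 192], [263,
      -73, -216, 112], [-306, 3, 102], [54, 27]], [[-165, -76, -258, 392, -96], [471, -23, -396,
      374, -96], [-54, 27, 138, -111], [0, -108, -27]], [[-84, -74, -64, 96], [198, 70, -268, 160],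
      [150, -90, 6], [-54, -54]]]]
  total := 6
  h :=
    ![[[7, 9, 12], [-16, -7, 16], [-12, -9]], [[18, 5, 12], [-51, 27], [-9]], [[7, -28], [21]]]
  factor := -1
  point := ![0, 0, -1]
  power := 4
  coefficient := ![49357350, 19499200, 5484150]
  u :=
    ![![[[-18506880, -31268160], [35735616]], [[7197120, 19414080, 17781120], [-9955904, -3849496],
      [-5908245]], [[0, 0, 0, 7620480], [0, -5227568, 3344136], [1865526, 21019455], [-181755]]],
      ![[[-9496116, -14882742], [19991538]], [[3692934, 9509976, 8668499], [-5752166, -2930746],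
      [-3438897]], [[0, 0, 0, 3018671], [0, -2529530, 862455], [1098186, 9768123], [-1473813]]],
      ![[[-2878722, -4279464], [7158186]], [[1424178, 2707992, 2357208], [-1307432, -2481472],
      [41601]], [[0, 0, 0, 1010232], [0, -312530, -478200], [3625152, 1974591], [17829]]]]

theorem special123_hasThreeGenerators (h : IsReducedCurve 7 (arrangement special123)) :
    HasThreeGenerators (arrangement special123) := by
  rw [← prodPoly_ofFn] at h ⊢
  exact hasThreeGenerators_of_check h special123_grad rfl special123Generators (by decide +kernel) (by decide +kernel)
    (by decide +kernel)

/-- Data for the absence of syzygies of degree 3 of `generic123`. -/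
def generic123NoSyzygies : NoSyzygies where
  -- A ternary cubic has 10 coefficients, so a syzygy of degree 3 has 30, and 30 points are used.
  -- The prime 97 is one modulo which the resulting matrix is invertible, as the inverse `B` shows.
  p := 97
  pts :=
    [![0, 0, 1], ![1, 0, -1], ![1, -1, -1], ![1, -1, 1], ![1, 1, 0], ![0, 1, 1], ![1, -1, 0], ![1,
      0, 1], ![1, 1, -1], ![2, 1, 1], ![1, -1, 2], ![0, 2, -1], ![1, -2, 0], ![1, 2, 2], ![1, 0, 2],
      ![2, -1, -2], ![1, -2, -2], ![1, -2, 1], ![1, -1, -2], ![2, 1, -2], ![1, -2, -1], ![1, -2, 2],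
      ![2, -1, -1], ![1, 2, 0], ![2, 0, -1], ![2, -1, 2], ![2, 1, -1], ![1, 2, 1], ![1, 0, -2], ![0,
      1, 2]]
  A :=
    [[44, 0, 0, 0, 0, 0, 0, 0, 0, 0, 41, 0, 0, 0, 0, 0, 0, 0, 0, 0, 24, 0, 0, 0, 0, 0, 0, 0, 0, 0],
      [48, 0, 0, 0, 49, 0, 0, 48, 0, 49, 95, 0, 0, 0, 2, 0, 0, 95, 0, 2, 48, 0, 0, 0, 49, 0, 0, 48,
      0, 49], [28, 28, 28, 28, 69, 69, 69, 28, 28, 69, 83, 83, 83, 83, 14, 14, 14, 83, 83, 14, 58,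
      58, 58, 58, 39, 39, 39, 58, 58, 39], [69, 28, 69, 28, 69, 28, 69, 69, 28, 69, 53, 44, 53, 44,
      53, 44, 53, 53, 44, 53, 13, 84, 13, 84, 13, 84, 13, 13, 84, 13], [0, 0, 0, 0, 0, 0, 0, 0, 0,
      0, 0, 0, 0, 0, 0, 0, 0, 0, 0, 0, 0, 0, 0, 31, 0, 0, 31, 0, 31, 31], [78, 78, 78, 78, 0, 0, 0,
      0, 0, 0, 79, 79, 79, 79, 0, 0, 0, 0, 0, 0, 3, 3, 3, 3, 0, 0, 0, 0, 0, 0], [0, 0, 0, 0, 0, 0,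
      0, 0, 0, 0, 0, 0, 0, 0, 0, 0, 0, 0, 0, 0, 0, 0, 0, 16, 0, 0, 81, 0, 16, 81], [57, 0, 0, 0, 57,
      0, 0, 57, 0, 57, 46, 0, 0, 0, 46, 0, 0, 46, 0, 46, 19, 0, 0, 0, 19, 0, 0, 19, 0, 19], [15, 82,
      15, 82, 82, 15, 82, 15, 82, 82, 15, 82, 15, 82, 82, 15, 82, 15, 82, 82, 30, 67, 30, 67, 67,
      30, 67, 30, 67, 67], [76, 76, 76, 76, 55, 55, 55, 13, 13, 26, 51, 51, 51, 51, 5, 5, 5, 10, 10,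
      20, 12, 12, 12, 12, 24, 24, 24, 48, 48, 96], [80, 57, 20, 87, 40, 77, 10, 20, 87, 10, 52, 71,
      13, 42, 26, 84, 55, 13, 42, 55, 75, 11, 43, 27, 86, 54, 70, 43, 27, 70], [84, 26, 45, 7, 0, 0,
      0, 0, 0, 0, 44, 9, 79, 36, 0, 0, 0, 0, 0, 0, 57, 80, 34, 29, 0, 0, 0, 0, 0, 0], [0, 0, 0, 0,
      0, 0, 0, 0, 0, 0, 0, 0, 0, 0, 0, 0, 0, 0, 0, 0, 0, 0, 0, 50, 0, 0, 72, 0, 61, 18], [73, 73,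
      73, 73, 85, 85, 85, 91, 91, 94, 63, 63, 63, 63, 80, 80, 80, 40, 40, 20, 96, 96, 96, 96, 48,
      48, 48, 24, 24, 12], [66, 0, 0, 0, 33, 0, 0, 65, 0, 81, 76, 0, 0, 0, 38, 0, 0, 19, 0, 58, 52,
      0, 0, 0, 26, 0, 0, 13, 0, 55], [94, 47, 72, 36, 3, 50, 25, 94, 47, 3, 62, 31, 64, 32, 35, 66,
      33, 62, 31, 35, 89, 93, 95, 96, 8, 4, 2, 89, 93, 8], [13, 13, 13, 13, 42, 42, 42, 76, 76, 59,
      37, 37, 37, 37, 30, 30, 30, 82, 82, 56, 69, 69, 69, 69, 14, 14, 14, 90, 90, 52], [70, 54, 86,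
      22, 70, 54, 86, 70, 54, 70, 45, 7, 83, 28, 45, 7, 83, 45, 7, 45, 68, 58, 78, 38, 68, 58, 78,
      68, 58, 68], [47, 72, 36, 18, 25, 61, 79, 36, 18, 79, 55, 76, 38, 19, 21, 59, 78, 38, 19, 78,
      50, 25, 61, 79, 72, 36, 18, 61, 79, 18], [72, 61, 18, 88, 25, 36, 79, 72, 61, 25, 82, 56, 69,
      14, 15, 41, 28, 82, 56, 15, 29, 34, 80, 57, 68, 63, 17, 29, 34, 68], [95, 93, 89, 81, 2, 4, 8,
      95, 93, 2, 27, 54, 11, 22, 70, 43, 86, 27, 54, 70, 1, 2, 4, 8, 96, 95, 93, 1, 2, 96], [45, 52,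
      45, 52, 71, 26, 71, 84, 13, 42, 5, 92, 5, 92, 51, 46, 51, 74, 23, 37, 86, 11, 86, 11, 43, 54,
      43, 70, 27, 35], [74, 74, 74, 74, 46, 46, 46, 5, 5, 87, 12, 12, 12, 12, 73, 73, 73, 48, 48, 1,
      93, 93, 93, 93, 8, 8, 8, 81, 81, 32], [0, 0, 0, 0, 0, 0, 0, 0, 0, 0, 0, 0, 0, 0, 0, 0, 0, 0,
      0, 0, 0, 0, 0, 48, 0, 0, 24, 0, 12, 6], [25, 0, 0, 0, 47, 0, 0, 3, 0, 91, 41, 0, 0, 0, 15, 0,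
      0, 67, 0, 60, 75, 0, 0, 0, 44, 0, 0, 9, 0, 79], [57, 20, 87, 5, 57, 20, 87, 57, 20, 57, 9, 44,
      75, 11, 9, 44, 75, 9, 44, 9, 9, 44, 75, 11, 9, 44, 75, 9, 44, 9], [70, 27, 70, 27, 54, 43, 54,
      86, 11, 22, 88, 9, 88, 9, 18, 79, 18, 61, 36, 72, 54, 43, 54, 43, 86, 11, 86, 22, 75, 53],
      [95, 93, 89, 81, 95, 93, 89, 95, 93, 95, 85, 73, 49, 1, 85, 73, 49, 85, 73, 85, 52, 7, 14, 28,
      52, 7, 14, 52, 7, 52], [42, 0, 0, 0, 76, 0, 0, 59, 0, 19, 86, 0, 0, 0, 54, 0, 0, 70, 0, 62,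
      76, 0, 0, 0, 59, 0, 0, 19, 0, 39], [20, 10, 5, 51, 0, 0, 0, 0, 0, 0, 66, 33, 65, 81, 0, 0, 0,
      0, 0, 0, 88, 44, 22, 11, 0, 0, 0, 0, 0, 0]]
  B :=
    [[83, 78, 7, 67, 50, 58, 35, 61, 95, 7, 56, 76, 73, 45, 40, 35, 93, 84, 94, 80, 89, 54, 25, 77,
      67, 86, 47, 56, 57, 77], [46, 54, 26, 32, 1, 76, 81, 2, 87, 51, 3, 18, 77, 49, 44, 72, 27, 80,
      94, 29, 96, 30, 76, 91, 6, 67, 95, 39, 37, 91], [93, 50, 60, 49, 35, 59, 43, 42, 17, 39, 22,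
      68, 17, 44, 92, 7, 40, 51, 60, 58, 32, 72, 80, 37, 47, 38, 38, 34, 30, 72], [33, 45, 57, 84,
      4, 33, 91, 20, 80, 28, 64, 31, 50, 85, 35, 74, 12, 66, 10, 24, 33, 49, 10, 21, 71, 29, 82, 77,
      45, 72], [19, 2, 29, 96, 38, 90, 18, 27, 78, 11, 60, 22, 74, 26, 35, 3, 56, 90, 71, 96, 35,
      90, 20, 92, 96, 34, 82, 64, 26, 57], [4, 21, 35, 64, 50, 29, 75, 74, 47, 35, 14, 21, 33, 9,
      73, 27, 60, 7, 43, 65, 1, 31, 30, 50, 38, 27, 50, 18, 83, 32], [84, 61, 72, 95, 11, 93, 53,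
      87, 61, 43, 79, 80, 64, 77, 86, 30, 31, 79, 56, 15, 40, 43, 0, 96, 6, 20, 27, 62, 34, 27],
      [63, 67, 74, 19, 96, 76, 42, 53, 25, 9, 92, 81, 45, 23, 51, 21, 92, 12, 78, 64, 1, 81, 42, 29,
      19, 87, 51, 64, 24, 73], [32, 86, 54, 52, 34, 2, 1, 15, 90, 79, 69, 66, 88, 55, 1, 64, 34, 34,
      83, 35, 71, 26, 64, 5, 12, 34, 74, 24, 7, 6], [41, 93, 72, 15, 9, 63, 47, 12, 43, 59, 79, 96,
      77, 90, 43, 56, 52, 45, 6, 34, 57, 60, 2, 44, 28, 57, 65, 0, 19, 93], [32, 66, 45, 78, 58, 13,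
      79, 56, 29, 73, 1, 74, 23, 91, 86, 72, 42, 48, 5, 36, 77, 8, 91, 11, 15, 40, 57, 11, 58, 45],
      [56, 55, 80, 62, 14, 80, 36, 80, 82, 57, 23, 22, 19, 17, 0, 38, 80, 4, 79, 50, 2, 90, 46, 62,
      36, 87, 11, 36, 76, 90], [48, 87, 0, 18, 52, 2, 94, 19, 88, 90, 69, 11, 37, 39, 44, 93, 54,
      58, 54, 77, 92, 46, 30, 79, 88, 35, 39, 19, 93, 3], [15, 53, 31, 45, 79, 45, 74, 46, 67, 43,
      90, 29, 22, 62, 87, 60, 9, 23, 91, 12, 90, 31, 37, 65, 8, 40, 47, 61, 61, 1], [82, 37, 95, 18,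
      34, 76, 89, 54, 74, 48, 6, 11, 51, 8, 0, 17, 10, 95, 6, 74, 78, 14, 93, 64, 55, 7, 79, 96, 13,
      14], [89, 17, 4, 26, 23, 82, 44, 88, 13, 81, 74, 31, 89, 61, 33, 79, 29, 31, 84, 21, 59, 77,
      21, 36, 24, 42, 62, 44, 63, 32], [36, 80, 92, 25, 51, 36, 0, 79, 23, 12, 47, 71, 62, 1, 91,
      75, 94, 82, 43, 80, 30, 1, 39, 95, 67, 39, 57, 79, 82, 5], [21, 42, 23, 64, 37, 69, 61, 26,
      64, 62, 12, 19, 14, 37, 70, 33, 22, 41, 1, 73, 8, 77, 34, 58, 58, 13, 36, 40, 63, 91], [46,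
      79, 41, 11, 4, 74, 54, 82, 11, 35, 96, 26, 4, 47, 90, 67, 3, 75, 38, 90, 41, 86, 95, 92, 45,
      52, 43, 18, 41, 17], [91, 51, 7, 43, 60, 10, 88, 1, 92, 35, 47, 80, 33, 10, 92, 96, 89, 90,
      17, 57, 80, 71, 82, 60, 39, 9, 47, 10, 70, 28], [64, 11, 76, 43, 76, 21, 7, 35, 39, 12, 29, 1,
      33, 49, 95, 23, 73, 55, 1, 2, 65, 49, 21, 30, 90, 65, 63, 20, 47, 77], [36, 70, 16, 66, 9, 22,
      84, 39, 3, 50, 43, 82, 52, 6, 87, 83, 53, 16, 23, 7, 56, 4, 55, 86, 65, 78, 93, 27, 72, 37],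
      [93, 45, 48, 24, 66, 30, 53, 16, 23, 12, 69, 80, 95, 57, 96, 76, 4, 17, 74, 52, 86, 32, 62,
      32, 29, 5, 67, 15, 28, 77], [0, 0, 0, 0, 85, 0, 1, 0, 0, 0, 0, 0, 22, 0, 0, 0, 0, 0, 0, 0, 0,
      0, 0, 31, 0, 0, 0, 0, 0, 0], [73, 15, 15, 32, 57, 94, 46, 51, 77, 67, 88, 6, 46, 70, 76, 26,
      26, 65, 95, 63, 21, 28, 64, 50, 60, 49, 58, 85, 92, 79], [11, 0, 16, 1, 39, 5, 19, 55, 44, 2,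
      33, 86, 31, 42, 75, 66, 67, 34, 15, 39, 17, 78, 89, 71, 19, 17, 58, 85, 58, 83], [0, 0, 0, 0,
      85, 0, 96, 0, 0, 0, 0, 0, 53, 0, 0, 0, 0, 0, 0, 0, 0, 0, 0, 62, 0, 0, 0, 0, 0, 0], [15, 66,
      95, 78, 23, 11, 82, 27, 40, 95, 16, 55, 84, 17, 3, 38, 16, 45, 67, 38, 56, 91, 4, 14, 92, 45,
      79, 35, 51, 14], [0, 0, 0, 0, 48, 0, 93, 0, 0, 0, 0, 0, 75, 0, 0, 0, 0, 0, 0, 0, 0, 0, 0, 66,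
      0, 0, 0, 0, 0, 0], [0, 0, 0, 0, 48, 0, 4, 0, 0, 0, 0, 0, 44, 0, 0, 0, 0, 0, 0, 0, 0, 0, 0, 35,
      0, 0, 0, 0, 0, 0]]

theorem generic123NoSyzygies_valid : generic123NoSyzygies.Valid (List.ofFn generic123) 3 where
  prime := by norm_num [generic123NoSyzygies]
  length := by decide +kernel
  rows := by decide +kernel
  inverse := by decide +kernel

/-- Independent syzygies of degree 4 of `generic123`. -/
def generic123Syzygies : Independence 4 where
  ρ :=
    ![![[[28, 28], [25, -96, -24], [-4, -22, 60], [-1, 6]], [[-7, -10, 16, 4], [-7, 24, 13, -24],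
      [0, 6, -15]], [[-3, 16, 4], [-4, 6, -24], [-1, 6]]], ![[[-28, 140, 168], [80, -47, -210, 96],
      [34, 30, -198], [-2, -15]], [[98, -130, 65, 126, -72], [70, -246, 2, 96], [0, -30, 69]],
      [[-11, 16, 28, 96], [48, 2, -72], [19, -78]]], ![[[-168, 0, 168], [74, 187, -330, 96], [0,
      -58, 54], [-2, 3]], [[42, -255, 47, 202, -72], [-14, 21, 131, -72], [0, 12, -18]], [[18, -72,
      -64, 96], [0, -72, 96], [-2, 24]]], ![[[-84, -252, -168], [415, 161, 66, -96], [-231, -206,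
      222], [-25, 93], [9]], [[203, -33, -259, -46, 72], [-14, 70, 46, -72], [-21, 45, -75], [0,
      -12]], [[-19, 56, -116, -96], [84, 130, -72], [3, -54], [-12]]]]
  idx := ![0, 1, 0, 1]
  pts := ![![-1, 0, 0], ![0, -1, 0], ![0, 0, -1], ![0, 0, -1]]
  p := 97
  A := [[0, 0, 28, 90], [0, 25, 69, 1], [0, 25, 26, 42], [9, 72, 13, 9]]
  B := [[56, 86, 65, 54], [8, 0, 66, 0], [32, 4, 93, 0], [17, 16, 81, 0]]

theorem generic123Syzygies_valid : generic123Syzygies.Valid generic123Grad 4 where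
  syzygy := by decide +kernel
  prime := by norm_num [generic123Syzygies]
  rows := by decide +kernel
  inverse := by decide +kernel

theorem generic123_not_hasThreeGenerators : ¬ HasThreeGenerators (arrangement generic123) := by
  rw [← prodPoly_ofFn]
  exact not_hasThreeGenerators_of_independence generic123_grad generic123NoSyzygies_valid generic123Syzygies_valid

/-! ### Syzygies for `Cmb124`. -/

/-- The gradient of the equation of `special124`. -/
def special124Grad : Fin 3 → CoeffList :=
  ![[[-10000, 6000, -5400, 1230, 164, 0, 0], [6000, -10800, 4920, -1866, 240, 32, 0], [1200, 3690,
    -2799, 720, -156, 0], [0, 656, 480, -208, 0], [0, 0, 80, 0], [0, 0, 0], [0, 0], [0]], [[-10000,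
    6000, 1200, 0, 0, 0, 0], [6000, -10800, 3690, 656, 0, 0, 0], [-5400, 4920, -2799, 480, 80, 0],
    [1230, -1866, 720, -208, 0], [164, 240, -156, 0], [0, 32, 0], [0, 0], [0]], [[0, -60000, 15000,
    1600, 0, 0, 0], [-60000, 30000, -21600, 3690, 328, 0, 0], [15000, -21600, 7380, -1866, 120, 0],
    [1600, 3690, -1866, 240, 0], [0, 328, 120, 0], [0, 0, 0], [0, 0], [0]]]

theorem special124_grad : ∀ i, prodGradCoeffs i (List.ofFn special124) = special124Grad i := by decide +kernel

/-- The gradient of the equation of `generic124`. -/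
def generic124Grad : Fin 3 → CoeffList :=
  ![[[-2500, 0, -825, 0, 164, 0, 0], [0, 4800, 0, 72, 0, -64, 0], [300, 0, -2061, 0, 96, 0], [0,
    -328, 0, 224, 0], [0, 0, 80, 0], [0, 0, 0], [0, 0], [0]], [[1250, 0, -600, 0, 0, 0, 0], [0,
    -1650, 0, 656, 0, 0, 0], [2400, 0, 108, 0, -160, 0], [0, -1374, 0, 128, 0], [-82, 0, 168, 0],
    [0, 32, 0], [0, 0], [0]], [[0, 7500, 0, -800, 0, 0, 0], [-15000, 0, -3300, 0, 328, 0, 0], [0,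
    9600, 0, 72, 0, 0], [400, 0, -1374, 0, 0], [0, -164, 0, 0], [0, 0, 0], [0, 0], [0]]]

theorem generic124_grad : ∀ i, prodGradCoeffs i (List.ofFn generic124) = generic124Grad i := by decide +kernel

/-- Generators of the Jacobian syzygies of `special124`. -/
def special124Generators : ThreeGenerators where
  deg := ![3, 4, 5]
  ρ :=
    ![![[[3500], [0, 425, -60], [-180, -84], [-24]], [[-3500, 0, 180, 24], [0, -425, 84], [0, 60]],
      [[0, -415, -18], [415, 0, -70], [18, 70]]], ![[[0, 700], [700, 160, 31, -20], [120, -35, -8],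
      [-66, -6], [-8]], [[0, -700, -120, 66, 8], [-700, -160, 35, 6], [0, -31, 8], [0, 20]], [[0,
      20, -95, -6], [-20, 0, -1, -14], [95, 1], [6, 14]]], ![[[0, 3500, -700], [2500, -900, 135,
      219, 60], [-300, 485, 114, -36], [320, -288, 52], [-158, 62], [-16]], [[0, 2500, -200, 590,
      -208, -24], [3500, -300, 1185, -467, 48], [0, 565, 6, 38], [0, 290, -64], [0, 40]], [[-1000,
      500, -355, 149, 18], [400, -600, 254, -64, 14], [-275, 146, -95, 42], [66, -71, 28], [12]]]]
  total := 6
  h :=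
    ![[[0, -10, -2, -1], [-10, -5], [-3], [-1]], [[50, 5, 6], [10, -3], [5]], [[0, 1], [-1]]]
  factor := 7
  point := ![-1, 0, -1]
  power := 4
  coefficient := ![68, 68, 680000]
  u :=
    ![![[[50, 15], [15]], [[0, 10, 4], [10, 8], [4]], [[0, 0, 0, -9], [0, -5, -30], [-5, -50],
      [-63]]], ![[[50, 15], [15]], [[0, 10, 4], [10, 8], [4]], [[0, 0, 0, 59], [0, -5, 38], [-5,
      18], [5]]], ![[[15950, -10855], [8695]], [[13600, 1830, -3348], [470, 1566], [1242]], [[0, 0,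
      0, 9233], [0, -8565, -1512], [-27265, 12474], [-2485]]]]

theorem special124_hasThreeGenerators (h : IsReducedCurve 7 (arrangement special124)) :
    HasThreeGenerators (arrangement special124) := by
  rw [← prodPoly_ofFn] at h ⊢
  exact hasThreeGenerators_of_check h special124_grad rfl special124Generators (by decide +kernel) (by decide +kernel)
    (by decide +kernel)

/-- Data for the absence of syzygies of degree 3 of `generic124`. -/
def generic124NoSyzygies : NoSyzygies where
  p := 97
  pts :=
    [![0, 0, 1], ![1, 0, -1], ![1, -1, -1], ![0, 1, -1], ![1, -1, 1], ![1, 1, 0], ![0, 1, 1], ![1,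
      -1, 0], ![1, 1, 1], ![1, 0, 1], ![1, 1, -1], ![2, 1, 1], ![1, -1, 2], ![0, 2, -1], ![1, -2,
      0], ![1, 2, 2], ![1, 0, 2], ![2, -1, -2], ![1, -2, -2], ![1, -2, 1], ![1, -1, -2], ![2, 1,
      -2], ![1, -2, -1], ![1, -2, 2], ![2, -1, -1], ![1, 2, 0], ![2, 0, -1], ![2, -1, 2], ![2, 1,
      -1], ![1, 0, -2]]
  A :=
    [[22, 0, 0, 0, 0, 0, 0, 0, 0, 0, 86, 0, 0, 0, 0, 0, 0, 0, 0, 0, 0, 0, 0, 0, 0, 0, 0, 0, 0, 0],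
      [66, 0, 0, 0, 31, 0, 0, 66, 0, 31, 21, 0, 0, 0, 76, 0, 0, 21, 0, 76, 47, 0, 0, 0, 50, 0, 0,
      47, 0, 50], [41, 41, 41, 41, 56, 56, 56, 41, 41, 56, 43, 43, 43, 43, 54, 54, 54, 43, 43, 54,
      57, 57, 57, 57, 40, 40, 40, 57, 57, 40], [57, 40, 57, 40, 0, 0, 0, 0, 0, 0, 29, 68, 29, 68, 0,
      0, 0, 0, 0, 0, 7, 90, 7, 90, 0, 0, 0, 0, 0, 0], [56, 41, 56, 41, 56, 41, 56, 56, 41, 56, 54,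
      43, 54, 43, 54, 43, 54, 54, 43, 54, 57, 40, 57, 40, 57, 40, 57, 57, 40, 57], [0, 0, 0, 45, 0,
      0, 45, 0, 45, 45, 0, 0, 0, 71, 0, 0, 71, 0, 71, 71, 0, 0, 0, 0, 0, 0, 0, 0, 0, 0], [40, 40,
      40, 40, 0, 0, 0, 0, 0, 0, 68, 68, 68, 68, 0, 0, 0, 0, 0, 0, 7, 7, 7, 7, 0, 0, 0, 0, 0, 0], [0,
      0, 0, 81, 0, 0, 16, 0, 81, 16, 0, 0, 0, 55, 0, 0, 42, 0, 55, 42, 0, 0, 0, 0, 0, 0, 0, 0, 0,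
      0], [55, 55, 55, 55, 55, 55, 55, 55, 55, 55, 3, 3, 3, 3, 3, 3, 3, 3, 3, 3, 75, 75, 75, 75, 75,
      75, 75, 75, 75, 75], [31, 0, 0, 0, 31, 0, 0, 31, 0, 31, 76, 0, 0, 0, 76, 0, 0, 76, 0, 76, 47,
      0, 0, 0, 47, 0, 0, 47, 0, 47], [42, 55, 42, 55, 55, 42, 55, 42, 55, 55, 94, 3, 94, 3, 3, 94,
      3, 94, 3, 3, 75, 22, 75, 22, 22, 75, 22, 75, 22, 22], [49, 49, 49, 49, 1, 1, 1, 2, 2, 4, 1, 1,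
      1, 1, 2, 2, 2, 4, 4, 8, 95, 95, 95, 95, 93, 93, 93, 89, 89, 81], [27, 35, 31, 33, 62, 66, 64,
      31, 33, 64, 41, 28, 83, 7, 69, 14, 90, 83, 7, 90, 59, 19, 39, 29, 78, 58, 68, 39, 29, 68],
      [72, 50, 94, 6, 0, 0, 0, 0, 0, 0, 83, 28, 41, 15, 0, 0, 0, 0, 0, 0, 64, 66, 62, 70, 0, 0, 0,
      0, 0, 0], [0, 0, 0, 79, 0, 0, 9, 0, 44, 75, 0, 0, 0, 43, 0, 0, 27, 0, 35, 31, 0, 0, 0, 0, 0,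
      0, 0, 0, 0, 0], [92, 92, 92, 92, 46, 46, 46, 23, 23, 60, 51, 51, 51, 51, 74, 74, 74, 37, 37,
      67, 0, 0, 0, 0, 0, 0, 0, 0, 0, 0], [0, 0, 0, 0, 0, 0, 0, 0, 0, 0, 87, 0, 0, 0, 92, 0, 0, 46,
      0, 23, 28, 0, 0, 0, 14, 0, 0, 7, 0, 52], [48, 24, 12, 6, 49, 73, 85, 48, 24, 49, 4, 2, 1, 49,
      93, 95, 96, 4, 2, 93, 77, 87, 92, 46, 20, 10, 5, 77, 87, 20], [12, 12, 12, 12, 91, 91, 91, 3,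
      3, 47, 14, 14, 14, 14, 90, 90, 90, 52, 52, 71, 20, 20, 20, 20, 87, 87, 87, 5, 5, 46], [96, 2,
      93, 8, 96, 2, 93, 96, 2, 96, 6, 85, 24, 49, 6, 85, 24, 6, 85, 6, 67, 60, 74, 46, 67, 60, 74,
      67, 60, 67], [70, 35, 66, 33, 62, 31, 64, 66, 33, 64, 56, 28, 14, 7, 69, 83, 90, 14, 7, 90,
      59, 78, 39, 68, 19, 58, 29, 39, 68, 29], [22, 86, 54, 70, 75, 11, 43, 22, 86, 75, 30, 82, 56,
      69, 67, 15, 41, 30, 82, 67, 27, 35, 31, 33, 70, 62, 66, 27, 35, 70], [1, 2, 4, 8, 96, 95, 93,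
      1, 2, 96, 91, 85, 73, 49, 6, 12, 24, 91, 85, 6, 67, 37, 74, 51, 30, 60, 23, 67, 37, 30], [85,
      12, 85, 12, 91, 6, 91, 94, 3, 47, 83, 14, 83, 14, 90, 7, 90, 45, 52, 71, 20, 77, 20, 77, 10,
      87, 10, 5, 92, 51], [59, 59, 59, 59, 76, 76, 76, 42, 42, 13, 57, 57, 57, 57, 80, 80, 80, 34,
      34, 29, 24, 24, 24, 24, 49, 49, 49, 96, 96, 2], [0, 0, 0, 93, 0, 0, 95, 0, 96, 48, 0, 0, 0, 2,
      0, 0, 1, 0, 49, 73, 0, 0, 0, 0, 0, 0, 0, 0, 0, 0], [39, 0, 0, 0, 19, 0, 0, 59, 0, 76, 65, 0,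
      0, 0, 64, 0, 0, 66, 0, 62, 69, 0, 0, 0, 56, 0, 0, 82, 0, 30], [49, 24, 85, 6, 49, 24, 85, 49,
      24, 49, 93, 2, 96, 49, 93, 2, 96, 93, 2, 93, 77, 10, 92, 51, 77, 10, 92, 77, 10, 77], [48, 49,
      48, 49, 1, 96, 1, 95, 2, 4, 96, 1, 96, 1, 2, 95, 2, 93, 4, 8, 95, 2, 95, 2, 4, 93, 4, 89, 8,
      16], [0, 0, 0, 0, 0, 0, 0, 0, 0, 0, 10, 0, 0, 0, 92, 0, 0, 51, 0, 23, 28, 0, 0, 0, 83, 0, 0,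
      7, 0, 45]]
  B :=
    [[27, 62, 75, 35, 6, 84, 65, 74, 86, 76, 26, 17, 72, 53, 30, 29, 49, 20, 50, 44, 16, 60, 13, 53,
      60, 91, 80, 62, 89, 87], [27, 51, 84, 36, 82, 95, 36, 43, 40, 58, 63, 7, 21, 93, 67, 82, 49,
      51, 22, 94, 36, 70, 65, 65, 27, 43, 37, 66, 90, 26], [93, 93, 15, 0, 65, 82, 64, 38, 1, 42,
      76, 35, 14, 84, 78, 29, 38, 66, 25, 3, 30, 31, 20, 79, 49, 92, 77, 3, 14, 75], [57, 18, 11,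
      24, 40, 96, 94, 41, 4, 32, 43, 20, 8, 75, 25, 44, 75, 90, 8, 53, 87, 66, 15, 44, 50, 44, 21,
      59, 45, 51], [71, 26, 22, 79, 4, 94, 78, 61, 38, 34, 63, 23, 52, 76, 50, 40, 3, 46, 93, 40,
      92, 9, 62, 32, 42, 14, 86, 46, 88, 54], [62, 18, 70, 57, 62, 38, 61, 24, 87, 21, 7, 56, 29,
      79, 72, 73, 73, 1, 68, 74, 22, 40, 12, 53, 66, 31, 26, 36, 18, 38], [86, 77, 9, 15, 66, 85,
      18, 48, 1, 91, 37, 29, 39, 69, 79, 48, 57, 40, 23, 27, 42, 62, 53, 93, 76, 47, 26, 66, 49,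
      84], [33, 8, 51, 71, 60, 28, 79, 76, 58, 30, 1, 35, 47, 20, 42, 89, 76, 77, 59, 15, 9, 56, 22,
      17, 12, 26, 72, 33, 65, 12], [70, 76, 94, 95, 35, 5, 20, 54, 62, 86, 40, 76, 32, 37, 78, 24,
      43, 49, 95, 1, 91, 13, 49, 16, 29, 76, 75, 18, 20, 42], [55, 32, 83, 0, 16, 30, 32, 72, 46,
      38, 93, 74, 71, 65, 34, 57, 54, 44, 80, 2, 73, 4, 14, 94, 13, 82, 74, 65, 89, 0], [1, 27, 53,
      70, 12, 71, 33, 51, 75, 55, 52, 34, 47, 9, 60, 58, 1, 40, 3, 88, 32, 23, 26, 9, 23, 85, 63,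
      27, 81, 77], [13, 24, 29, 67, 72, 23, 29, 18, 18, 63, 28, 53, 41, 74, 73, 37, 85, 40, 48, 52,
      37, 20, 32, 93, 75, 93, 52, 68, 46, 53], [11, 78, 7, 28, 1, 94, 45, 20, 4, 31, 68, 60, 94, 40,
      44, 28, 79, 60, 3, 74, 61, 92, 21, 61, 15, 20, 46, 73, 59, 80], [9, 60, 76, 29, 15, 88, 55,
      23, 31, 6, 81, 33, 94, 70, 62, 85, 76, 4, 35, 59, 63, 45, 13, 45, 84, 69, 33, 43, 72, 87],
      [75, 53, 57, 1, 16, 15, 47, 13, 73, 59, 41, 13, 66, 4, 54, 33, 87, 25, 17, 43, 39, 28, 59, 21,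
      51, 92, 44, 92, 58, 18], [57, 27, 35, 95, 80, 26, 13, 25, 56, 70, 77, 24, 26, 23, 21, 47, 87,
      91, 4, 96, 72, 13, 88, 32, 29, 9, 25, 30, 34, 31], [61, 58, 12, 37, 2, 78, 58, 44, 91, 84, 51,
      90, 11, 53, 37, 33, 33, 53, 32, 36, 44, 5, 59, 52, 88, 55, 37, 53, 83, 29], [52, 0, 61, 14, 9,
      92, 31, 39, 16, 58, 95, 2, 71, 14, 47, 52, 51, 64, 19, 92, 0, 4, 29, 28, 59, 74, 4, 41, 6,
      85], [49, 17, 34, 62, 88, 91, 9, 82, 51, 17, 66, 28, 28, 30, 38, 77, 17, 72, 50, 38, 20, 20,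
      9, 74, 64, 44, 72, 78, 53, 53], [24, 41, 66, 89, 66, 31, 35, 3, 86, 78, 55, 33, 52, 34, 13,
      41, 95, 7, 53, 89, 63, 28, 45, 14, 10, 13, 48, 89, 65, 59], [29, 87, 46, 68, 44, 26, 15, 2, 8,
      89, 85, 80, 27, 15, 19, 45, 20, 8, 94, 87, 51, 40, 22, 61, 44, 95, 41, 46, 4, 91], [29, 50,
      42, 55, 84, 64, 32, 16, 87, 1, 35, 63, 51, 75, 82, 29, 11, 45, 16, 36, 0, 89, 34, 26, 68, 18,
      16, 61, 32, 72], [81, 33, 54, 77, 35, 63, 96, 62, 96, 29, 38, 25, 34, 65, 70, 73, 77, 6, 23,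
      4, 90, 48, 26, 68, 50, 79, 49, 46, 46, 49], [14, 12, 11, 47, 63, 59, 46, 40, 48, 69, 4, 57,
      14, 38, 92, 79, 45, 58, 93, 34, 67, 6, 83, 64, 7, 78, 65, 65, 1, 13], [9, 62, 20, 12, 68, 54,
      6, 45, 16, 22, 4, 12, 62, 49, 7, 76, 66, 86, 32, 5, 43, 58, 58, 9, 15, 90, 44, 14, 18, 89],
      [84, 27, 68, 3, 8, 35, 36, 20, 44, 15, 47, 66, 4, 64, 64, 80, 65, 84, 21, 45, 0, 89, 21, 90,
      71, 72, 46, 42, 36, 76], [39, 77, 64, 3, 83, 63, 87, 81, 77, 55, 57, 85, 12, 25, 84, 4, 91,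
      75, 10, 18, 85, 90, 35, 36, 93, 7, 76, 44, 13, 94], [25, 54, 14, 46, 62, 82, 11, 33, 84, 95,
      49, 52, 87, 39, 3, 83, 65, 46, 44, 0, 88, 59, 28, 16, 77, 31, 70, 5, 89, 44], [71, 87, 19, 95,
      65, 81, 27, 22, 60, 2, 50, 20, 44, 56, 13, 4, 43, 87, 84, 19, 59, 11, 86, 53, 34, 22, 17, 25,
      25, 15], [4, 37, 18, 65, 32, 11, 37, 49, 37, 69, 48, 9, 34, 6, 80, 79, 11, 10, 5, 20, 58, 86,
      57, 79, 34, 5, 90, 92, 39, 77]]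

theorem generic124NoSyzygies_valid : generic124NoSyzygies.Valid (List.ofFn generic124) 3 where
  prime := by norm_num [generic124NoSyzygies]
  length := by decide +kernel
  rows := by decide +kernel
  inverse := by decide +kernel

/-- Independent syzygies of degree 4 of `generic124`. -/
def generic124Syzygies : Independence 4 where
  ρ :=
    ![![[[], [0, -200, 0, 40], [300, 0, -32], [0, -42], [-8]], [[0, 0, 150, 0, -16], [0, -400, 0,
      24], [0, 0, 56], [0, 20]], [[0, -25, 0, 12], [-50, 0, -4], [0, 7], [6]]], ![[[], [800, 0,
      120], [0, -520], [30]], [[0, 450, 0, -48], [700, 0, 12], [0, -362]], [[-75, 0, 36], [0, 320],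
      [121, 0, -112], [0, -56]]], ![[[0, 700], [-450, 0, -212], [0, 78], [12]], [[0, 950, 0, -30],
      [0, 0, -265], [0, -30]], [[75, 0, 166], [0, 50, 0, -56], [-9, 0, -28]]], ![[[1750], [0, -230],
      [-690, 0, -60], [0, 78], [24]], [[3500, 0, -195], [0, -760, 0, 24], [0, 0, -48], [0, -60]],
      [[0, 505], [710, 0, -158], [0, -265], [-18]]]]
  idx := ![0, 1, 2, 2]
  pts := ![![-1, 0, 0], ![0, -1, 0], ![0, 0, -1], ![-1, -1, 0]]
  p := 97
  A := [[89, 81, 0, 0], [0, 0, 22, 26], [0, 0, 75, 13], [24, 0, 0, 0]]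
  B := [[0, 0, 0, 93], [6, 0, 0, 2], [0, 25, 47, 0], [0, 5, 5, 0]]

theorem generic124Syzygies_valid : generic124Syzygies.Valid generic124Grad 4 where
  syzygy := by decide +kernel
  prime := by norm_num [generic124Syzygies]
  rows := by decide +kernel
  inverse := by decide +kernel

theorem generic124_not_hasThreeGenerators : ¬ HasThreeGenerators (arrangement generic124) := by
  rw [← prodPoly_ofFn]
  exact not_hasThreeGenerators_of_independence generic124_grad generic124NoSyzygies_valid generic124Syzygies_valid

/-! ### Syzygies for `Cmb212`. -/

/-- The gradient of the equation of `special212`. -/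
def special212Grad : Fin 3 → CoeffList :=
  ![[[-625, 0, 525, 0, 0, 0, -16], [0, -1050, 0, 850, 0, -104, 0], [2175, 0, -1275, 0, -156, 0], [0,
    0, 0, 208, 0], [-1000, 0, 260, 0], [0, 96, 0], [112, 0], [0]], [[625, 0, -2175, 0, 1000, 0,
    -112], [0, 1050, 0, 0, 0, -96, 0], [-525, 0, 1275, 0, -260, 0], [0, -850, 0, -208, 0], [0, 0,
    156, 0], [0, 104, 0], [16, 0], [0]], [[0, 3750, 0, -2900, 0, 400, 0], [-3750, 0, 2100, 0, 0, 0,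
    0], [0, -2100, 0, 850, 0, 0], [2900, 0, -850, 0, 0], [0, 0, 0, 0], [-400, 0, 0], [0, 0], [0]]]

theorem special212_grad : ∀ i, prodGradCoeffs i (List.ofFn special212) = special212Grad i := by decide +kernel

/-- The gradient of the equation of `generic212`. -/
def generic212Grad : Fin 3 → CoeffList :=
  ![[[625, -500, -725, 500, 200, -80, -16], [1000, 1050, -1000, -850, 160, 104, 0], [-1575, 1500,
    1275, -1020, -156, 0], [-2000, 0, 1360, -208, 0], [0, -400, 260, 0], [480, -96, 0], [112, 0],
    [0]], [[-625, 0, 2175, 0, -1000, 0, 112], [-500, -1450, 1500, 800, -400, -96, 0], [525, -1000,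
    -1275, 320, 260, 0], [500, 850, -1020, -208, 0], [0, 680, -156, 0], [-80, 104, 0], [-16, 0],
    [0]], [[0, -3750, 0, 2900, 0, -400, 0], [3750, -2500, -2900, 1500, 400, -80, 0], [2500, 2100,
    -1500, -850, 80, 0], [-2100, 1500, 850, -340, 0], [-1500, 0, 340, 0], [0, -80, 0], [80, 0],
    [0]]]

theorem generic212_grad : ∀ i, prodGradCoeffs i (List.ofFn generic212) = generic212Grad i := by decide +kernel

/-- Generators of the Jacobian syzygies of `special212`. -/
def special212Generators : ThreeGenerators where
  deg := ![3, 4, 5]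
  ρ :=
    ![![[[175, 0, -56], [0, 27], [-92]], [[175, 0, -92], [0, 27], [-56]], [[0, 83, 0, -28], [83, 0,
      -28], [0, -28], [-28]]], ![[[0, 0, 0, 28], [-150, 0, -23], [0, -5], [96]], [[0, -150, 0, 96],
      [0, 0, -5], [0, -23], [28]], [[25, 0, -79, 0, 28], [0, -33, 0, 28], [-79], [0, 28], [28]]],
      ![[[0, 0, 0, 175, 0, -28], [0, 0, -150, 0, 4], [0, 0, 0, -69], [25, 0, 17], [0, 22], [4]],
      [[0, 0, 0, 25, 0, 4], [0, 0, 0, 0, 22], [0, -150, 0, 17], [175, 0, -69], [0, 4], [-28]], [[0,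
      0, 25, 0, 4], [0, 0, 0, 50], [25, 0, -158], [0, 50], [4]]]]
  total := 6
  h :=
    -- The relation has the coefficients `-(x³ + y³)`, `-(x² + y²)` and `z`, whose only common zero
    -- is visibly the origin.
    ![[[0, 0, 0, -1], [], [], [-1]], [[0, 0, -1], [], [-1]], [[1]]]
  factor := -7
  point := ![0, 0, -1]
  power := 4
  coefficient := ![2, 2, 1]
  u :=
    ![![[[0, -1], [-1]], [[0, 0, 1], [0, 1], [-1]], []], ![[[0, -1], [-1]], [[0, 0, -1], [0, 1],
      [1]], []], ![[], [], [[1]]]]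

theorem special212_hasThreeGenerators (h : IsReducedCurve 7 (arrangement special212)) :
    HasThreeGenerators (arrangement special212) := by
  rw [← prodPoly_ofFn] at h ⊢
  exact hasThreeGenerators_of_check h special212_grad rfl special212Generators (by decide +kernel) (by decide +kernel)
    (by decide +kernel)

/-- Data for the absence of syzygies of degree 3 of `generic212`. -/
def generic212NoSyzygies : NoSyzygies where
  p := 97
  pts :=
    [![0, 0, 1], ![1, 0, -1], ![0, 1, -1], ![0, 1, 1], ![1, -1, 0], ![0, 1, 0], ![1, 0, 1], ![1, 0,
      0], ![2, 1, 1], ![1, -1, 2], ![0, 2, -1], ![1, -2, 0], ![1, 2, 2], ![1, 0, 2], ![2, -1, -2],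
      ![1, -2, -2], ![1, -2, 1], ![1, -1, -2], ![2, 1, -2], ![1, -2, -1], ![1, -2, 2], ![2, -1, -1],
      ![1, 2, 0], ![2, 0, -1], ![2, -1, 2], ![2, 1, -1], ![1, 2, 1], ![1, 0, -2], ![0, 1, 2], ![1,
      1, 2]]
  A :=
    [[43, 0, 0, 0, 0, 0, 0, 0, 0, 0, 54, 0, 0, 0, 0, 0, 0, 0, 0, 0, 0, 0, 0, 0, 0, 0, 0, 0, 0, 0],
      [27, 0, 0, 0, 70, 0, 0, 27, 0, 70, 36, 0, 0, 0, 61, 0, 0, 36, 0, 61, 85, 0, 0, 0, 12, 0, 0,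
      85, 0, 12], [30, 67, 30, 67, 0, 0, 0, 0, 0, 0, 17, 80, 17, 80, 0, 0, 0, 0, 0, 0, 11, 86, 11,
      86, 0, 0, 0, 0, 0, 0], [4, 4, 4, 4, 0, 0, 0, 0, 0, 0, 80, 80, 80, 80, 0, 0, 0, 0, 0, 0, 11,
      11, 11, 11, 0, 0, 0, 0, 0, 0], [0, 0, 0, 85, 0, 0, 12, 0, 85, 12, 0, 0, 0, 85, 0, 0, 12, 0,
      85, 12, 0, 0, 0, 67, 0, 0, 30, 0, 67, 30], [0, 0, 0, 81, 0, 0, 0, 0, 0, 0, 0, 0, 0, 15, 0, 0,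
      0, 0, 0, 0, 0, 0, 0, 0, 0, 0, 0, 0, 0, 0], [0, 0, 0, 0, 0, 0, 0, 0, 0, 0, 95, 0, 0, 0, 95, 0,
      0, 95, 0, 95, 14, 0, 0, 0, 14, 0, 0, 14, 0, 14], [0, 0, 0, 0, 0, 0, 0, 0, 0, 15, 0, 0, 0, 0,
      0, 0, 0, 0, 0, 81, 0, 0, 0, 0, 0, 0, 0, 0, 0, 80], [14, 14, 14, 14, 28, 28, 28, 56, 56, 15,
      41, 41, 41, 41, 82, 82, 82, 67, 67, 37, 32, 32, 32, 32, 64, 64, 64, 31, 31, 62], [45, 26, 84,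
      55, 71, 13, 42, 84, 55, 42, 86, 54, 70, 62, 43, 27, 35, 70, 62, 35, 27, 35, 31, 33, 62, 66,
      64, 31, 33, 64], [54, 86, 22, 53, 0, 0, 0, 0, 0, 0, 78, 38, 21, 55, 0, 0, 0, 0, 0, 0, 87, 20,
      57, 80, 0, 0, 0, 0, 0, 0], [0, 0, 0, 68, 0, 0, 63, 0, 17, 40, 0, 0, 0, 7, 0, 0, 45, 0, 26, 84,
      0, 0, 0, 1, 0, 0, 48, 0, 73, 12], [24, 24, 24, 24, 12, 12, 12, 6, 6, 3, 3, 3, 3, 3, 50, 50,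
      50, 25, 25, 61, 68, 68, 68, 68, 34, 34, 34, 17, 17, 57], [60, 0, 0, 0, 30, 0, 0, 15, 0, 56,
      59, 0, 0, 0, 78, 0, 0, 39, 0, 68, 6, 0, 0, 0, 3, 0, 0, 50, 0, 25], [91, 94, 47, 72, 6, 3, 50,
      91, 94, 6, 69, 83, 90, 45, 28, 14, 7, 69, 83, 28, 67, 82, 41, 69, 30, 15, 56, 67, 82, 30],
      [56, 56, 56, 56, 69, 69, 69, 14, 14, 90, 23, 23, 23, 23, 37, 37, 37, 30, 30, 82, 45, 45, 45,
      45, 26, 26, 26, 84, 84, 55], [51, 92, 10, 77, 51, 92, 10, 51, 92, 51, 57, 80, 34, 29, 57, 80,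
      34, 57, 80, 57, 82, 30, 37, 23, 82, 30, 37, 82, 30, 82], [74, 37, 67, 82, 60, 30, 15, 67, 82,
      15, 93, 95, 96, 48, 2, 1, 49, 96, 48, 49, 21, 59, 78, 39, 38, 19, 58, 78, 39, 58], [62, 66,
      64, 65, 35, 31, 33, 62, 66, 35, 43, 27, 35, 31, 54, 70, 62, 43, 27, 54, 87, 5, 46, 74, 10, 92,
      51, 87, 5, 10], [4, 8, 16, 32, 93, 89, 81, 4, 8, 93, 78, 59, 21, 42, 19, 38, 76, 78, 59, 19,
      85, 73, 49, 1, 12, 24, 48, 85, 73, 12], [41, 56, 41, 56, 69, 28, 69, 83, 14, 90, 17, 80, 17,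
      80, 57, 40, 57, 77, 20, 87, 87, 10, 87, 10, 92, 5, 92, 46, 51, 23], [46, 46, 46, 46, 5, 5, 5,
      87, 87, 20, 50, 50, 50, 50, 94, 94, 94, 6, 6, 85, 5, 5, 5, 5, 87, 87, 87, 20, 20, 57], [0, 0,
      0, 10, 0, 0, 5, 0, 51, 74, 0, 0, 0, 4, 0, 0, 2, 0, 1, 49, 0, 0, 0, 65, 0, 0, 81, 0, 89, 93],
      [61, 0, 0, 0, 72, 0, 0, 50, 0, 94, 86, 0, 0, 0, 22, 0, 0, 53, 0, 88, 65, 0, 0, 0, 64, 0, 0,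
      66, 0, 62], [79, 9, 44, 75, 79, 9, 44, 79, 9, 79, 43, 27, 35, 31, 43, 27, 35, 43, 27, 43, 54,
      70, 62, 66, 54, 70, 62, 54, 70, 54], [55, 42, 55, 42, 84, 13, 84, 26, 71, 45, 1, 96, 1, 96,
      95, 2, 95, 4, 93, 89, 34, 63, 34, 63, 29, 68, 29, 39, 58, 19], [15, 30, 60, 23, 15, 30, 60,
      15, 30, 15, 3, 6, 12, 24, 3, 6, 12, 3, 6, 3, 5, 10, 20, 40, 5, 10, 20, 5, 10, 5], [88, 0, 0,
      0, 53, 0, 0, 22, 0, 86, 60, 0, 0, 0, 67, 0, 0, 15, 0, 41, 60, 0, 0, 0, 67, 0, 0, 15, 0, 41],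
      [4, 2, 1, 49, 0, 0, 0, 0, 0, 0, 46, 23, 60, 30, 0, 0, 0, 0, 0, 0, 50, 25, 61, 79, 0, 0, 0, 0,
      0, 0], [91, 94, 47, 72, 94, 47, 72, 47, 72, 72, 6, 3, 50, 25, 3, 50, 25, 50, 25, 25, 0, 0, 0,
      0, 0, 0, 0, 0, 0, 0]]
  B :=
    [[7, 38, 55, 59, 16, 68, 65, 29, 73, 78, 87, 24, 3, 42, 67, 11, 23, 61, 15, 22, 75, 58, 3, 61,
      52, 54, 33, 3, 67, 88], [91, 34, 28, 54, 61, 57, 33, 38, 85, 88, 37, 80, 33, 89, 30, 86, 81,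
      22, 88, 87, 30, 91, 63, 95, 84, 25, 40, 3, 4, 62], [73, 28, 74, 87, 60, 28, 88, 30, 63, 58, 4,
      20, 15, 90, 77, 77, 25, 78, 83, 36, 48, 2, 21, 57, 9, 33, 74, 2, 33, 30], [3, 91, 90, 35, 88,
      26, 47, 64, 8, 22, 12, 0, 36, 70, 8, 82, 90, 28, 44, 86, 55, 17, 9, 51, 37, 89, 4, 56, 42,
      73], [46, 90, 84, 86, 49, 92, 3, 11, 51, 30, 22, 26, 24, 71, 87, 1, 67, 68, 22, 42, 56, 90, 1,
      84, 60, 50, 15, 43, 90, 95], [85, 84, 24, 8, 12, 68, 35, 17, 88, 79, 51, 29, 26, 29, 66, 41,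
      72, 21, 93, 18, 27, 8, 25, 6, 49, 88, 70, 17, 21, 40], [81, 76, 51, 22, 15, 48, 30, 77, 45,
      18, 2, 90, 30, 87, 49, 80, 15, 3, 58, 48, 36, 0, 17, 47, 2, 64, 80, 68, 87, 43], [75, 35, 49,
      61, 95, 22, 27, 92, 26, 6, 28, 27, 40, 9, 56, 5, 69, 85, 28, 18, 57, 78, 64, 6, 44, 30, 20,
      53, 90, 65], [90, 48, 12, 14, 44, 60, 27, 22, 82, 62, 27, 18, 92, 1, 93, 48, 2, 63, 45, 57,
      59, 25, 45, 15, 54, 60, 58, 22, 27, 81], [3, 10, 26, 47, 36, 70, 24, 49, 47, 66, 39, 25, 9,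
      24, 61, 35, 3, 53, 75, 90, 10, 40, 72, 58, 25, 39, 74, 46, 5, 63], [16, 38, 55, 59, 16, 68,
      65, 29, 73, 78, 87, 24, 3, 42, 67, 11, 23, 61, 15, 22, 75, 58, 3, 61, 52, 54, 33, 3, 67, 88],
      [95, 11, 27, 54, 88, 9, 45, 14, 82, 4, 92, 83, 71, 92, 80, 90, 66, 58, 35, 67, 84, 77, 38, 55,
      65, 15, 43, 79, 57, 80], [1, 26, 41, 9, 1, 82, 69, 66, 64, 65, 47, 53, 29, 5, 47, 28, 5, 48,
      24, 44, 33, 71, 38, 20, 33, 28, 60, 72, 62, 86], [42, 13, 96, 5, 68, 86, 76, 23, 15, 17, 71,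
      0, 19, 10, 15, 81, 96, 4, 34, 40, 91, 44, 29, 35, 33, 82, 56, 8, 6, 52], [42, 70, 63, 88, 47,
      78, 27, 54, 68, 59, 65, 55, 67, 23, 38, 57, 15, 92, 63, 17, 58, 52, 51, 44, 70, 55, 10, 85,
      89, 22], [79, 56, 94, 58, 88, 66, 11, 6, 96, 61, 90, 30, 58, 17, 20, 96, 95, 16, 75, 77, 44,
      41, 36, 50, 91, 34, 17, 70, 53, 46], [33, 96, 3, 5, 50, 96, 65, 55, 52, 57, 91, 25, 87, 81,
      80, 91, 47, 95, 84, 24, 68, 65, 15, 95, 31, 89, 42, 88, 81, 14], [84, 49, 5, 9, 83, 79, 70,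
      76, 16, 87, 83, 39, 9, 27, 31, 76, 2, 94, 49, 55, 18, 63, 12, 41, 23, 21, 20, 53, 81, 70],
      [18, 22, 92, 39, 46, 95, 89, 17, 7, 79, 82, 27, 41, 76, 71, 49, 48, 71, 20, 83, 16, 10, 25,
      46, 35, 12, 72, 21, 49, 66], [53, 7, 90, 27, 6, 54, 45, 23, 54, 95, 43, 55, 54, 62, 49, 18,
      24, 80, 50, 9, 29, 94, 22, 37, 62, 31, 91, 36, 4, 86], [12, 83, 52, 73, 24, 17, 84, 25, 93,
      47, 16, 51, 13, 90, 62, 90, 88, 42, 78, 17, 43, 43, 83, 21, 49, 8, 68, 22, 14, 29], [4, 68,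
      20, 52, 77, 31, 67, 66, 94, 5, 47, 91, 67, 83, 30, 2, 6, 77, 40, 10, 10, 2, 38, 35, 72, 14,
      92, 91, 22, 91], [2, 88, 65, 8, 20, 9, 14, 88, 36, 64, 65, 95, 74, 78, 13, 34, 61, 48, 42, 78,
      32, 29, 95, 73, 63, 54, 51, 51, 89, 64], [95, 48, 94, 22, 91, 89, 65, 37, 73, 48, 42, 71, 47,
      41, 46, 79, 59, 55, 82, 96, 21, 22, 13, 4, 15, 57, 22, 19, 4, 47], [36, 88, 60, 37, 11, 52,
      80, 67, 89, 53, 68, 93, 52, 96, 80, 49, 12, 19, 86, 38, 84, 60, 35, 23, 0, 2, 44, 51, 52, 57],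
      [82, 50, 5, 35, 4, 65, 0, 6, 90, 3, 10, 34, 78, 48, 12, 30, 20, 73, 1, 72, 62, 11, 48, 46, 85,
      16, 92, 37, 35, 40], [17, 85, 73, 10, 48, 89, 56, 66, 35, 46, 70, 17, 85, 0, 42, 63, 91, 53,
      88, 73, 83, 91, 88, 96, 26, 32, 61, 24, 40, 27], [76, 23, 56, 68, 47, 83, 69, 38, 14, 55, 71,
      71, 14, 90, 21, 21, 0, 55, 81, 95, 15, 25, 27, 31, 78, 42, 73, 76, 55, 23], [71, 11, 29, 86,
      30, 49, 14, 92, 19, 44, 14, 79, 33, 93, 77, 60, 32, 24, 77, 67, 42, 73, 44, 93, 31, 35, 70,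
      39, 51, 96], [84, 65, 1, 56, 9, 68, 53, 90, 42, 43, 51, 73, 37, 37, 2, 71, 20, 0, 2, 31, 50,
      21, 20, 62, 55, 68, 31, 1, 52, 26]]

theorem generic212NoSyzygies_valid : generic212NoSyzygies.Valid (List.ofFn generic212) 3 where
  prime := by norm_num [generic212NoSyzygies]
  length := by decide +kernel
  rows := by decide +kernel
  inverse := by decide +kernel

/-- Independent syzygies of degree 4 of `generic212`. -/
def generic212Syzygies : Independence 4 where
  ρ :=
    ![![[[0, -175, -70, 28], [0, -60, -71], [-10, 72, 20], [-4]], [[0, -175, 10, 104], [0, -80, -47,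
      20], [-70, -4], [-28]], [[0, 10, -71, 0, 28], [-10, -75, -50], [-4, -70, -28]]], ![[[0, 0,
      175, 0, -28], [0, -150, 50, 24], [0, -40, -93], [-10, 76], [-4]], [[0, 0, 25, -20, -4], [0, 0,
      30, 26], [0, 60, -43], [-70, 24], [-28]], [[0, 25, -20, -4], [0, 30, 54], [-10, -71, 70], [-4,
      -70]]], ![[[0, 0, -70], [25, 60, -75], [10, 50, 20], [0, -20]], [[0, -150, -10, 100], [175,
      -60, -125, 20], [70, 0, -20]], [[25, -10, -75, 0, 28], [10, 50, -50, -28], [0, 50, -28], [0,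
      28]]], ![[[-875, 0, 70, -56], [-225, -195, -83], [530, -44, 20], [108, -20], [-40]], [[-875,
      -50, 470, 92], [-175, -275, 19, 20], [210, -242, -20], [56, -40]], [[125, -405, -83, 140, 28],
      [-345, -100, -50, -28], [-242, 50, -84], [100, 28], [56]]]]
  idx := ![0, 1, 2, 2]
  pts := ![![-1, 0, 0], ![-1, 0, 0], ![0, -1, 0], ![0, 0, -1]]
  p := 97
  A := [[0, 0, 28, 0], [93, 69, 0, 0], [0, 0, 28, 25], [57, 0, 28, 28]]
  B := [[29, 0, 85, 80], [79, 45, 71, 44], [52, 0, 0, 0], [31, 0, 66, 0]]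

theorem generic212Syzygies_valid : generic212Syzygies.Valid generic212Grad 4 where
  syzygy := by decide +kernel
  prime := by norm_num [generic212Syzygies]
  rows := by decide +kernel
  inverse := by decide +kernel

theorem generic212_not_hasThreeGenerators : ¬ HasThreeGenerators (arrangement generic212) := by
  rw [← prodPoly_ofFn]
  exact not_hasThreeGenerators_of_independence generic212_grad generic212NoSyzygies_valid generic212Syzygies_valid

/-! ### Syzygies for `Cmb224`. -/

/-- The gradient of the equation of `special224`. -/
def special224Grad : Fin 3 → CoeffList :=
  ![[[32, 0, -92, 0, -220, 0, 525], [0, 184, 0, -1536, 0, 3242, 0], [-444, 0, 2304, 0, -285, 0], [0,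
    880, 0, 380, 0], [-820, 0, -8105, 0], [0, -3150, 0], [7105, 0], [0]], [[-32, 0, 444, 0, 820, 0,
    -7105], [0, -184, 0, -880, 0, 3150, 0], [92, 0, -2304, 0, 8105, 0], [0, 1536, 0, -380, 0], [220,
    0, 285, 0], [0, -3242, 0], [-525, 0], [0]], [[0, -192, 0, 592, 0, 328, 0], [192, 0, -368, 0,
    -440, 0, 0], [0, 368, 0, -1536, 0, 0], [-592, 0, 1536, 0, 0], [0, 440, 0, 0], [-328, 0, 0], [0,
    0], [0]]]

theorem special224_grad : ∀ i, prodGradCoeffs i (List.ofFn special224) = special224Grad i := by decide +kernel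

/-- The gradient of the equation of `generic224`. -/
def generic224Grad : Fin 3 → CoeffList :=
  ![[[0, -1600, 1600, -5300, 5300, 4400, -4400], [-6080, 6080, -3890, 3890, 6720, -6720, 0], [0,
    25500, -25500, -10500, 10500, 0], [37300, -37300, -18300, 18300, 0], [0, -12500, 12500, 0],
    [-15750, 15750, 0], [0, 0], [0]], [[-256, 544, -816, -10448, 13060, 9504, -11088], [-1600, 3200,
    -15900, 21200, 22000, -26400, 0], [3040, -3890, 5835, 13440, -16800, 0], [8500, -17000, -10500,
    14000, 0], [-9325, -9150, 13725, 0], [-2500, 5000, 0], [2625, 0], [0]], [[1792, -1536, 1360,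
    -1088, -7836, 5224, 1584], [0, -8000, 6400, -15900, 10600, 4400, 0], [-15200, 12160, -5835,
    3890, 3360, 0], [0, 25500, -17000, -3500, 0], [27975, -18650, -4575, 0], [0, -2500, 0], [-2625,
    0], [0]]]

theorem generic224_grad : ∀ i, prodGradCoeffs i (List.ofFn generic224) = generic224Grad i := by decide +kernel

/-- Generators of the Jacobian syzygies of `special224`. -/
def special224Generators : ThreeGenerators where
  deg := ![3, 4, 6]
  ρ :=
    ![![[[28, 0, -126], [0, -96], [2]], [[28, 0, 2], [0, -96], [-126]], [[0, 30, 0, 245], [30, 0,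
      -371], [0, -371], [245]]], ![[[0, 56, 0, -203], [8, 0, -113], [0, -117], [-15]], [[0, 8, 0,
      -15], [56, 0, -117], [0, -113], [-203]], [[8, 0, -15], [0, 142, 0, -203], [-15, 0, -98], [0,
      -203]]], ![[[44, 0, -446, 0, -998, 0, 7105], [0, 240, 0, 452, 0, -3150], [-94, 0, 2012, 0,
      -8105], [0, -1644, 0, 380], [-238, 0, -285], [0, 3242], [525]], [[44, 0, -94, 0, -238, 0,
      525], [0, 240, 0, -1644, 0, 3242], [-446, 0, 2012, 0, -285], [0, 452, 0, 380], [-998, 0,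
      -8105], [0, -3150], [7105]], [[0, 22, 0, 75, 0, -105], [22, 0, -1, 0, 137], [0, -1, 0, -608],
      [75, 0, -608], [0, 137], [-105]]]]
  total := 7
  h :=
    ![[[-11, 0, 18], [0, -148, 0, 203], [18, 0, 98], [0, 203]], [[0, 22, 0, 245], [22, 0, -371], [0,
      -371], [245]], [[7]]]
  factor := 1
  point := ![0, 0, -1]
  power := 6
  coefficient := ![459098640, 459098640, 847]
  u :=
    ![![[[0, 0, -1640030], [0, 2226224], [2375674]], [[0, -820015], [1933127, 0, 1358882], [0,
      869162], [1873872]], [[0, 0, 0, 0, 32917745], [0, 0, 0, -155790508], [-2342340, 0, 97169592],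
      [0, 167039252], [-79657633]]], ![[[0, 0, 2375674], [0, 2226224], [-1640030]], [[0, 1187837, 0,
      1873872], [-74725, 0, 869162], [0, 1358882]], [[0, 0, 0, 0, -53572483], [0, 0, 0, 101453732],
      [-2342340, 0, 97169592], [0, -90204988], [6832595]]], ![[[-77]], [[0, 63], [-581]], [[0, 0, 0,
      0, -2205], [0, 0, 0, 25907], [2024, 0, -26376], [0, -30765], [20335]]]]

theorem special224_hasThreeGenerators (h : IsReducedCurve 7 (arrangement special224)) :
    HasThreeGenerators (arrangement special224) := by
  rw [← prodPoly_ofFn] at h ⊢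
  exact hasThreeGenerators_of_check h special224_grad rfl special224Generators (by decide +kernel) (by decide +kernel)
    (by decide +kernel)

/-- Data for the absence of syzygies of degree 3 of `generic224`. -/
def generic224NoSyzygies : NoSyzygies where
  p := 97
  pts :=
    [![0, 0, 1], ![1, 0, -1], ![0, 1, -1], ![1, 1, 0], ![0, 1, 1], ![1, -1, 0], ![0, 1, 0], ![1, 0,
      1], ![1, 0, 0], ![2, 1, 1], ![1, -1, 2], ![0, 2, -1], ![1, -2, 0], ![1, 2, 2], ![1, 0, 2],
      ![2, -1, -2], ![1, -2, 1], ![1, -1, -2], ![2, 1, -2], ![1, -2, -1], ![1, -2, 2], ![1, 2, 0],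
      ![2, 0, -1], ![2, -1, 2], ![2, 1, -1], ![1, 2, 1], ![1, 0, -2], ![0, 1, 2], ![1, 1, 2], ![2,
      -2, -1]]
  A :=
    [[0, 0, 0, 0, 0, 0, 0, 0, 0, 0, 35, 0, 0, 0, 0, 0, 0, 0, 0, 0, 46, 0, 0, 0, 0, 0, 0, 0, 0, 0],
      [47, 0, 0, 0, 50, 0, 0, 47, 0, 50, 71, 0, 0, 0, 26, 0, 0, 71, 0, 26, 86, 0, 0, 0, 11, 0, 0,
      86, 0, 11], [44, 53, 44, 53, 0, 0, 0, 0, 0, 0, 58, 39, 58, 39, 0, 0, 0, 0, 0, 0, 74, 23, 74,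
      23, 0, 0, 0, 0, 0, 0], [0, 0, 0, 49, 0, 0, 49, 0, 49, 49, 0, 0, 0, 74, 0, 0, 74, 0, 74, 74, 0,
      0, 0, 24, 0, 0, 24, 0, 24, 24], [0, 0, 0, 0, 0, 0, 0, 0, 0, 0, 15, 15, 15, 15, 0, 0, 0, 0, 0,
      0, 82, 82, 82, 82, 0, 0, 0, 0, 0, 0], [0, 0, 0, 0, 0, 0, 0, 0, 0, 0, 0, 0, 0, 64, 0, 0, 33, 0,
      64, 33, 0, 0, 0, 74, 0, 0, 23, 0, 74, 23], [0, 0, 0, 62, 0, 0, 0, 0, 0, 0, 0, 0, 0, 67, 0, 0,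
      0, 0, 0, 0, 0, 0, 0, 32, 0, 0, 0, 0, 0, 0], [47, 0, 0, 0, 47, 0, 0, 47, 0, 47, 96, 0, 0, 0,
      96, 0, 0, 96, 0, 96, 11, 0, 0, 0, 11, 0, 0, 11, 0, 11], [0, 0, 0, 0, 0, 0, 0, 0, 0, 0, 0, 0,
      0, 0, 0, 0, 0, 0, 0, 6, 0, 0, 0, 0, 0, 0, 0, 0, 0, 91], [0, 0, 0, 0, 0, 0, 0, 0, 0, 0, 52, 52,
      52, 52, 7, 7, 7, 14, 14, 28, 45, 45, 45, 45, 90, 90, 90, 83, 83, 69], [54, 70, 62, 66, 27, 35,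
      31, 62, 66, 31, 57, 20, 87, 5, 77, 10, 92, 87, 5, 92, 62, 66, 64, 65, 31, 33, 32, 64, 65, 32],
      [32, 33, 31, 35, 0, 0, 0, 0, 0, 0, 70, 54, 86, 22, 0, 0, 0, 0, 0, 0, 82, 30, 37, 23, 0, 0, 0,
      0, 0, 0], [0, 0, 0, 26, 0, 0, 84, 0, 55, 21, 0, 0, 0, 70, 0, 0, 62, 0, 66, 64, 0, 0, 0, 75, 0,
      0, 11, 0, 43, 27], [0, 0, 0, 0, 0, 0, 0, 0, 0, 0, 32, 32, 32, 32, 16, 16, 16, 8, 8, 4, 65, 65,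
      65, 65, 81, 81, 81, 89, 89, 93], [18, 0, 0, 0, 9, 0, 0, 53, 0, 75, 67, 0, 0, 0, 82, 0, 0, 41,
      0, 69, 43, 0, 0, 0, 70, 0, 0, 35, 0, 66], [83, 90, 45, 71, 14, 7, 52, 83, 90, 14, 4, 2, 1, 49,
      93, 95, 96, 4, 2, 93, 44, 22, 11, 54, 53, 75, 86, 44, 22, 53], [14, 69, 56, 82, 14, 69, 56,
      14, 69, 14, 60, 74, 46, 5, 60, 74, 46, 60, 74, 60, 24, 49, 96, 2, 24, 49, 96, 24, 49, 24],
      [18, 9, 53, 75, 88, 44, 22, 53, 75, 22, 39, 68, 34, 17, 29, 63, 80, 34, 17, 80, 34, 17, 57,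
      77, 80, 40, 20, 57, 77, 20], [44, 75, 11, 43, 53, 22, 86, 44, 75, 53, 58, 68, 63, 17, 39, 29,
      34, 58, 68, 39, 46, 74, 60, 67, 51, 23, 37, 46, 74, 51], [60, 23, 46, 92, 37, 74, 51, 60, 23,
      37, 59, 21, 42, 84, 38, 76, 55, 59, 21, 38, 44, 88, 79, 61, 53, 9, 18, 44, 88, 53], [19, 78,
      19, 78, 58, 39, 58, 29, 68, 63, 95, 2, 95, 2, 96, 1, 96, 48, 49, 24, 28, 69, 28, 69, 14, 83,
      14, 7, 90, 52], [0, 0, 0, 53, 0, 0, 75, 0, 86, 43, 0, 0, 0, 52, 0, 0, 26, 0, 13, 55, 0, 0, 0,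
      65, 0, 0, 81, 0, 89, 93], [5, 0, 0, 0, 87, 0, 0, 20, 0, 57, 74, 0, 0, 0, 46, 0, 0, 5, 0, 87,
      83, 0, 0, 0, 28, 0, 0, 41, 0, 15], [55, 21, 38, 78, 55, 21, 38, 55, 21, 55, 39, 29, 34, 80,
      39, 29, 34, 39, 29, 39, 27, 35, 31, 33, 27, 35, 31, 27, 35, 27], [10, 87, 10, 87, 77, 20, 77,
      40, 57, 17, 46, 51, 46, 51, 5, 92, 5, 87, 10, 20, 18, 79, 18, 79, 61, 36, 61, 72, 25, 50],
      [59, 21, 42, 84, 59, 21, 42, 59, 21, 59, 26, 52, 7, 14, 26, 52, 7, 26, 52, 26, 85, 73, 49, 1,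
      85, 73, 49, 85, 73, 85], [18, 0, 0, 0, 88, 0, 0, 53, 0, 22, 68, 0, 0, 0, 63, 0, 0, 17, 0, 40,
      54, 0, 0, 0, 70, 0, 0, 62, 0, 66], [9, 53, 75, 86, 0, 0, 0, 0, 0, 0, 77, 87, 92, 46, 0, 0, 0,
      0, 0, 0, 7, 52, 26, 13, 0, 0, 0, 0, 0, 0], [29, 63, 80, 40, 63, 80, 40, 80, 40, 40, 23, 60,
      30, 15, 60, 30, 15, 30, 15, 15, 36, 18, 9, 53, 18, 9, 53, 9, 53, 53], [86, 75, 53, 9, 22, 44,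
      88, 53, 9, 88, 79, 61, 25, 50, 36, 72, 47, 25, 50, 47, 16, 32, 64, 31, 65, 33, 66, 64, 31,
      66]]
  B :=
    [[8, 34, 44, 71, 52, 5, 9, 87, 90, 77, 47, 31, 31, 84, 42, 34, 12, 45, 34, 23, 34, 7, 54, 56,
      66, 95, 51, 26, 69, 43], [69, 16, 61, 47, 13, 88, 16, 74, 21, 92, 88, 65, 96, 71, 15, 83, 3,
      25, 66, 60, 96, 65, 65, 2, 84, 91, 20, 30, 61, 50], [21, 27, 31, 74, 1, 67, 83, 82, 40, 83,
      89, 95, 61, 66, 76, 7, 88, 53, 15, 86, 46, 86, 70, 25, 21, 10, 63, 78, 43, 46], [3, 83, 68,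
      73, 7, 30, 95, 76, 4, 74, 29, 66, 26, 76, 84, 80, 5, 62, 42, 21, 67, 80, 33, 53, 36, 41, 11,
      14, 44, 10], [27, 25, 6, 43, 35, 13, 66, 25, 3, 83, 37, 58, 45, 67, 89, 87, 2, 62, 46, 48, 17,
      21, 76, 7, 91, 8, 22, 37, 51, 46], [69, 67, 83, 4, 59, 18, 94, 37, 11, 38, 74, 40, 24, 92, 77,
      31, 32, 96, 58, 45, 30, 96, 84, 80, 90, 37, 65, 89, 17, 58], [16, 13, 7, 5, 12, 45, 29, 48,
      93, 70, 61, 10, 25, 38, 35, 84, 18, 89, 64, 5, 50, 41, 61, 12, 52, 1, 37, 96, 22, 94], [11,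
      51, 9, 20, 69, 38, 74, 34, 33, 34, 42, 41, 85, 39, 64, 32, 34, 17, 45, 3, 82, 35, 34, 95, 9,
      55, 29, 71, 81, 53], [38, 68, 12, 65, 78, 22, 76, 86, 35, 12, 12, 28, 90, 55, 47, 30, 89, 73,
      87, 76, 77, 12, 93, 33, 76, 94, 50, 49, 78, 88], [91, 81, 23, 94, 81, 72, 96, 64, 68, 41, 59,
      24, 36, 70, 1, 77, 86, 55, 36, 77, 61, 52, 77, 54, 18, 24, 39, 41, 71, 12], [88, 14, 61, 81,
      28, 38, 85, 13, 46, 80, 10, 1, 71, 30, 42, 33, 80, 30, 12, 23, 50, 72, 9, 83, 37, 10, 51, 69,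
      57, 14], [40, 74, 49, 6, 64, 78, 44, 44, 48, 94, 88, 90, 61, 53, 67, 4, 38, 3, 85, 16, 26, 83,
      89, 49, 0, 53, 77, 48, 2, 13], [64, 32, 55, 61, 32, 45, 65, 9, 17, 90, 39, 57, 48, 63, 13, 12,
      48, 31, 17, 5, 32, 83, 61, 36, 23, 10, 19, 50, 42, 22], [60, 50, 79, 88, 45, 91, 42, 93, 61,
      91, 63, 46, 14, 35, 47, 61, 77, 89, 65, 91, 13, 67, 4, 38, 82, 74, 29, 21, 2, 21], [94, 54,
      15, 89, 33, 38, 5, 69, 59, 7, 39, 60, 56, 51, 2, 92, 61, 69, 73, 73, 69, 36, 7, 2, 28, 58, 37,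
      50, 30, 84], [27, 14, 56, 21, 17, 51, 35, 68, 22, 24, 5, 15, 63, 64, 74, 71, 15, 47, 30, 58,
      61, 3, 88, 19, 29, 69, 40, 2, 14, 77], [71, 3, 37, 91, 32, 26, 21, 96, 54, 24, 72, 93, 66, 31,
      53, 31, 57, 25, 39, 44, 91, 14, 10, 12, 38, 35, 7, 76, 72, 43], [22, 35, 29, 7, 10, 49, 92,
      60, 40, 95, 30, 54, 46, 60, 26, 77, 30, 52, 62, 9, 13, 89, 18, 22, 24, 54, 39, 86, 42, 54],
      [79, 86, 80, 58, 54, 74, 11, 94, 30, 34, 43, 5, 73, 52, 22, 64, 59, 50, 1, 53, 83, 22, 78, 33,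
      13, 35, 15, 6, 52, 13], [46, 1, 32, 49, 66, 3, 70, 38, 1, 52, 73, 86, 19, 12, 56, 89, 19, 92,
      91, 96, 27, 84, 37, 86, 7, 72, 76, 32, 80, 8], [87, 2, 78, 67, 4, 47, 26, 85, 62, 53, 43, 14,
      24, 32, 6, 74, 53, 32, 71, 31, 21, 38, 29, 95, 33, 43, 35, 93, 22, 2], [5, 74, 9, 10, 39, 67,
      69, 60, 45, 96, 90, 35, 79, 50, 43, 43, 1, 35, 34, 53, 52, 19, 96, 6, 13, 59, 36, 44, 88, 1],
      [55, 20, 51, 30, 48, 32, 28, 68, 58, 64, 52, 60, 7, 74, 75, 12, 78, 56, 52, 67, 8, 31, 80, 69,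
      4, 49, 87, 16, 40, 0], [8, 74, 9, 32, 65, 9, 16, 43, 7, 45, 15, 85, 84, 25, 45, 78, 14, 30,
      22, 81, 40, 23, 55, 36, 92, 93, 18, 35, 50, 67], [78, 70, 94, 16, 61, 41, 16, 70, 68, 80, 77,
      15, 64, 26, 73, 83, 49, 59, 5, 59, 32, 5, 86, 34, 78, 38, 36, 43, 56, 81], [31, 63, 69, 81,
      83, 74, 5, 86, 49, 21, 60, 58, 25, 21, 39, 13, 70, 11, 61, 16, 28, 30, 77, 95, 55, 85, 18, 72,
      37, 43], [83, 35, 42, 7, 19, 0, 40, 77, 34, 88, 76, 95, 96, 10, 17, 1, 14, 71, 76, 3, 64, 18,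
      39, 1, 59, 39, 30, 13, 23, 80], [20, 11, 93, 96, 24, 88, 81, 2, 25, 5, 18, 83, 74, 94, 9, 94,
      38, 9, 75, 16, 5, 95, 24, 96, 4, 57, 45, 67, 48, 68], [81, 13, 16, 66, 27, 35, 22, 55, 5, 50,
      55, 73, 45, 14, 39, 47, 51, 93, 85, 46, 91, 16, 72, 56, 33, 32, 9, 25, 46, 96], [46, 1, 32,
      49, 66, 3, 70, 38, 17, 52, 73, 86, 19, 12, 56, 89, 19, 92, 91, 96, 27, 84, 37, 86, 7, 72, 76,
      32, 80, 8]]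

theorem generic224NoSyzygies_valid : generic224NoSyzygies.Valid (List.ofFn generic224) 3 where
  prime := by norm_num [generic224NoSyzygies]
  length := by decide +kernel
  rows := by decide +kernel
  inverse := by decide +kernel

/-- Independent syzygies of degree 4 of `generic224`. -/
def generic224Syzygies : Independence 3 where
  ρ :=
    ![![[[-112, 112, -98, 98], [16, -36, 89, -44], [315, -260, -30], [-55, 30], [-25]], [[112, -96,
      237, -184, -44], [0, 105, -50, -30], [-385, 330, 30], [0, -25]], [[16, -134, 187, 264, -308],
      [-280, 335, 180, -210], [-55, -180, 210], [150, -175]]], ![[[112, -112, -252, 252], [0, -250,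
      250], [-215, 110, 80], [-50, 50], [25]], [[0, 0, 100, -100], [0, -355, 250, 80], [-350, 300,
      50], [0, 25]], [[0, 100, -100], [380, -485, -480, 560], [-50, -300, 350], [-150, 175]]],
      ![[[-112, 0, 252], [0, 250, 350], [199, 375, -44], [-50, 50], [80]], [[0, 0, -100], [-112,
      339, -248, -44], [350, 300, 50], [735, 80]], [[0, -100], [-396, 123, 516, -308], [-50, 400,
      350], [255, 560]]]]
  idx := ![0, 1, 0]
  pts := ![![-1, 0, 0], ![0, -1, 0], ![0, 0, -1]]
  p := 97
  A := [[72, 53, 82], [25, 0, 15], [80, 0, 82]]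
  B := [[0, 85, 85], [11, 11, 0], [0, 33, 20]]

theorem generic224Syzygies_valid : generic224Syzygies.Valid generic224Grad 4 where
  syzygy := by decide +kernel
  prime := by norm_num [generic224Syzygies]
  rows := by decide +kernel
  inverse := by decide +kernel

/-- A further syzygy of `generic224`. -/
def generic224FurtherSyzygy : Fin 3 → CoeffList :=
  ![[[192, -352, -354, 1046, 712, -1584], [400, -90, 279, 2140, -3784], [1136, -330, 1394, -2380],
    [-1413, -1525, 1878], [-3830, 1650], [765]], [[-112, 128, -193, 66, -280, 616], [-528, -914,
    583, -456, 980], [-1001, 672, -94, -1622], [2565, 620, -2925], [2205, -1735], [-2625]], [[-16,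
    210, -411, -482, 1012, -88], [476, -808, -1361, 1218, 140], [797, 1384, -3372, -854], [4795,
    -2360, -2175], [115, 355], [-2625]]]

theorem generic224_not_hasThreeGenerators : ¬ HasThreeGenerators (arrangement generic224) := by
  rw [← prodPoly_ofFn]
  -- At `(1 : 0 : 0)` only the first entries of the three syzygies of degree 4 are nonzero, while
  -- the last two entries of the further syzygy, of degree 5, are equal and nonzero. Hence the
  -- choice of `κ`.
  exact not_hasThreeGenerators_of_value generic224_grad generic224NoSyzygies_valid generic224Syzygies_valid (m := 5)
    (τ := generic224FurtherSyzygy) (p := ![-1, 0, 0]) (κ := ![0, -1, -1]) (by decide +kernel) (by decide +kernel)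
    (by decide +kernel)

/-! ### Syzygies for `Cmb223` plus another bitangent. -/

/-- The gradient of the equation of `special223`. -/
def special223Grad : Fin 3 → CoeffList :=
  ![[[-12504375, 6877575, 9114300, -9015504, 512772, 3489228, -426816, -405648], [733950, -22563450,
    -12679156, 16128112, 10644312, -1867320, -1575504, 0], [47850075, -19278063, -22573824,
    18483864, -3672396, -4325076, 0], [19135676, 2662660, -1751848, 3098368, -5092080, 0],
    [-28018445, 2999045, 5567380, -119560, 0], [-13025082, 2541630, 1592892, 0], [4151329, 1294139,
    0], [2016840, 0], [0]], [[12504375, 18933300, -41347800, -25625664, 19429020, 9179568, -2240784,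
    -933120], [6877575, 18228600, -27046512, 2051088, 17446140, -2560896, -2839536, 0], [-11281725,
    -12679156, 24192168, 21288624, -4668300, -4726512, 0], [-6426021, -15049216, 18483864, -4896528,
    -7208460, 0], [665665, -875924, 2323776, -5092080, 0], [599809, 2226952, -71736, 0], [423605,
    530964, 0], [184877, 0], [0]], [[-35640000, 87530625, 56799900, -68913000, -25625664, 11657412,
    3059856, -320112], [-87530625, 41265450, 45571500, -36062016, 1538316, 6978456, -426816, 0],
    [2201850, -56408625, -25358312, 24192168, 10644312, -933660, 0], [79750125, -25704084,
    -22573824, 12322576, -1224132, 0], [19135676, 1996995, -875924, 774592, 0], [-16811067, 1199618,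
    1113476, 0], [-4341694, 423605, 0], [593047, 0], [0]]]

theorem special223_grad : ∀ i, prodGradCoeffs i (List.ofFn special223) = special223Grad i := by decide +kernel

/-- The gradient of the equation of `generic223`. -/
def generic223Grad : Fin 3 → CoeffList :=
  ![[[9375, 4225, -7875, -3525, 0, -24, 240, 112], [-20150, 15750, 28350, -12750, -10776, 1560,
    1024, 0], [-32625, -10575, 19125, 4419, 2340, 1764, 0], [28800, 0, -21552, -3120, 480, 0],
    [15000, -120, -3900, 2940, 0], [-10272, -1440, 3072, 0], [-1680, 784, 0], [1024, 0], [0]],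
    [[-9375, -20150, 32625, 28800, -15000, -10272, 1680, 1024], [4225, -15750, -10575, 0, -120,
    1440, 784, 0], [7875, 28350, -19125, -21552, 3900, 3072, 0], [-3525, 12750, 4419, 3120, 2940,
    0], [0, -10776, -2340, 480, 0], [-24, -1560, 1764, 0], [-240, 1024, 0], [112, 0], [0]], [[35000,
    -65625, -60450, 54375, 28800, -9000, -3424, 240], [65625, 25350, -39375, -14100, 0, -48, 240,
    0], [-60450, 39375, 56700, -19125, -10776, 780, 0], [-54375, -14100, 19125, 2946, 780, 0],
    [28800, 0, -10776, -780, 0], [9000, -48, -780, 0], [-3424, -240, 0], [-240, 0], [0]]]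

theorem generic223_grad : ∀ i, prodGradCoeffs i (List.ofFn generic223) = generic223Grad i := by decide +kernel

/-- Generators of the Jacobian syzygies of `special223`. -/
def special223Generators : ThreeGenerators where
  deg := ![4, 5, 5]
  ρ :=
    ![![[[7183800, 2667600, -3056400, -924768, 152064], [2389725, -80106, -496470, 257724],
      [-4434157, -1203384, 515046], [-1353807, 404166], [221431]], [[5124600, 1945125, -2747706,
      -1006278, 80316], [3112200, 643643, -1314040, -76314], [-1348200, -399399, -285754],
      [-1258712, 14455], [-241472]], [[-722475, 2080806, 1507194, -739620, -426816], [3164707,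
      2697240, -1239882, -995904], [1938209, -759402, -1078896], [-1343041, -1161888], [-677768]]],
      ![[[23850, 35100, 5232, -20208, -4680, 2160], [-35100, -22858, 15723, 10356, 162], [-25622,
      -17628, -5724, 3432], [22113, 12502, -1575], [6944, -2856], [-1323]], [[23850, 5850, -1962,
      -2509, -5172, -198], [-5850, -15890, 8788, 10500, -2448], [-25396, 1645, 2310, -2975], [-7924,
      5390, 4004], [6370, -1813], [3430]], [[0, 7010, 3003, 3732, -1134, -2160], [15356, 12012,
      -8844, -5544, 936], [-15015, -20258, 6825, 4032], [-14910, -6468, 4032], [6321, 7644],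
      [3430]]], ![[[-133200, 210600, 92208, 22848, 4032, -3456], [-155025, 170735, -95700, -53856,
      -3816], [38396, -118859, -89202, -6084], [136136, -70735, 12894], [41622, 5607], [-5145]],
      [[25200, -131625, -106041, 112892, 43776, -3240], [187200, -29596, -92755, 53326, 3324],
      [120176, -99456, -31479, 15134], [23744, -69874, -5369], [-5488, -4361], [-5488]], [[55575,
      4103, -63492, -41664, 26712, 13824], [-14300, 94549, 11646, 13020, 22464], [-86632, 108017,
      -83538, -22848], [-22666, 3087, -62496], [40719, -15288], [19208]]]]
  total := 7
  h :=
    ![[[53, 39, 30, -12], [-39, -48, 12], [-35, 21], [-21]], [[-12116, -5928, 336], [-6916],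
      [-2072]], [[689, 0, -318], [], [-371]]]
  factor := -2
  point := ![-1, 0, 0]
  power := 5
  coefficient := ![52250447090807319029760, 52250447090807319029760, 679255812180495147386880]
  u :=
    ![![[[0, -1339937196963946150128, -866045534780781852120], [-2606401577137905450436,
      -994272362345920382400], [-2358442839087237857500]], [[0, -5861395793916238524,
      -5233708299656642130, -1967045490644523198], [-11401393495238444113, 15930509282381550480,
      -6815297792250365358], [14242460117056745730, -7320227591789898006], [6468860260836084559]],
      [[0, 0, 0, 30602575888405101984], [0, 271375504420834334196, -2362321155391384896],
      [169894656499906742612, -36334416284040426708], [-43467994421637981748]]], ![[[0,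
      -12172333500529098338832, -9410025669719169666600], [-2864494615545632331964,
      -2461832206631807131200], [-12254411676448460149540]], [[0, -53246424193466673156,
      -54292469824767282030, -26058542163688886082], [-12530390774506315087, 118987093816905434640,
      22355523572216758638], [-39755362892356498530, -42421206669002496714],
      [85004540325444227761]], [[0, 0, 0, 163252172260450475616], [0, 1112607536849735707404,
      -238575049172275218624], [-44365211255135390932, -317378513875947547692],
      [218903605528563943988]]], ![[[12816147399631983912960, 86160533287723338056496,
      52747081542120393150840], [33347300808265975065652, 10729667616705935451840],
      [88679424175140140125420]], [[0, 418152691716324223308, 335220484107641180490,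
      111524988102412141446], [104620105171050619501, -882744063945238145040,
      -50759122539615980874], [197869081098552964230, 363230309404903360062],
      [-622558577557912860403]], [[0, 0, 0, -1872618183971805780768], [0, -7368615850799217937572,
      1531930509219064537152], [246784968331086846076, 2383643360216060744196],
      [-1542659123929777616924]]]]

theorem special223_hasThreeGenerators (h : IsReducedCurve 8 (arrangement special223)) :
    HasThreeGenerators (arrangement special223) := by
  rw [← prodPoly_ofFn] at h ⊢
  exact hasThreeGenerators_of_check h special223_grad rfl special223Generators (by decide +kernel) (by decide +kernel)
    (by decide +kernel)

/-- Data for the absence of syzygies of degree 4 of `generic223`. -/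
def generic223NoSyzygies : NoSyzygies where
  -- The curve has degree 8, and the degree to be excluded is 4: a ternary quartic has 15
  -- coefficients, which makes 45 unknowns and 45 points.
  p := 97
  pts :=
    [![0, 0, 1], ![1, 0, -1], ![0, 1, -1], ![1, 1, 0], ![0, 1, 1], ![0, 1, 0], ![1, 0, 1], ![1, 0,
      0], ![2, 1, 1], ![1, -1, 2], ![0, 2, -1], ![1, -2, 0], ![1, 2, 2], ![1, 0, 2], ![2, -1, -2],
      ![1, -2, -2], ![1, -2, 1], ![1, -1, -2], ![2, 1, -2], ![1, -2, -1], ![1, -2, 2], ![2, -1, -1],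
      ![1, 2, 0], ![2, 0, -1], ![2, -1, 2], ![2, 1, -1], ![1, 2, 1], ![1, 0, -2], ![0, 1, 2], ![1,
      1, 2], ![2, -2, -1], ![1, 1, -2], ![2, 2, -1], ![0, 1, -2], ![2, -1, 1], ![2, 1, 2], ![2, 2,
      1], ![0, 2, 1], ![1, 2, -1], ![1, 2, -2], ![2, 0, 1], ![2, 1, 0], ![2, -1, 0], ![2, -2, 1],
      ![0, 3, -1]]
  A :=
    [[63, 0, 0, 0, 0, 0, 0, 0, 0, 0, 0, 0, 0, 0, 0, 34, 0, 0, 0, 0, 0, 0, 0, 0, 0, 0, 0, 0, 0, 0,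
      80, 0, 0, 0, 0, 0, 0, 0, 0, 0, 0, 0, 0, 0, 0], [20, 0, 0, 0, 0, 77, 0, 0, 0, 20, 0, 0, 77, 0,
      20, 6, 0, 0, 0, 0, 91, 0, 0, 0, 6, 0, 0, 91, 0, 6, 5, 0, 0, 0, 0, 92, 0, 0, 0, 5, 0, 0, 92, 0,
      5], [18, 79, 18, 79, 18, 0, 0, 0, 0, 0, 0, 0, 0, 0, 0, 45, 52, 45, 52, 45, 0, 0, 0, 0, 0, 0,
      0, 0, 0, 0, 46, 51, 46, 51, 46, 0, 0, 0, 0, 0, 0, 0, 0, 0, 0], [0, 0, 0, 0, 45, 0, 0, 0, 45,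
      0, 0, 45, 0, 45, 45, 0, 0, 0, 0, 45, 0, 0, 0, 45, 0, 0, 45, 0, 45, 45, 0, 0, 0, 0, 0, 0, 0, 0,
      0, 0, 0, 0, 0, 0, 0], [6, 6, 6, 6, 6, 0, 0, 0, 0, 0, 0, 0, 0, 0, 0, 20, 20, 20, 20, 20, 0, 0,
      0, 0, 0, 0, 0, 0, 0, 0, 92, 92, 92, 92, 92, 0, 0, 0, 0, 0, 0, 0, 0, 0, 0], [0, 0, 0, 0, 15, 0,
      0, 0, 0, 0, 0, 0, 0, 0, 0, 0, 0, 0, 0, 54, 0, 0, 0, 0, 0, 0, 0, 0, 0, 0, 0, 0, 0, 0, 46, 0, 0,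
      0, 0, 0, 0, 0, 0, 0, 0], [45, 0, 0, 0, 0, 45, 0, 0, 0, 45, 0, 0, 45, 0, 45, 18, 0, 0, 0, 0,
      18, 0, 0, 0, 18, 0, 0, 18, 0, 18, 51, 0, 0, 0, 0, 51, 0, 0, 0, 51, 0, 0, 51, 0, 51], [0, 0, 0,
      0, 0, 0, 0, 0, 0, 0, 0, 0, 0, 0, 54, 0, 0, 0, 0, 0, 0, 0, 0, 0, 0, 0, 0, 0, 0, 15, 0, 0, 0, 0,
      0, 0, 0, 0, 0, 0, 0, 0, 0, 0, 51], [64, 64, 64, 64, 64, 31, 31, 31, 31, 62, 62, 62, 27, 27,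
      54, 7, 7, 7, 7, 7, 14, 14, 14, 14, 28, 28, 28, 56, 56, 15, 59, 59, 59, 59, 59, 21, 21, 21, 21,
      42, 42, 42, 84, 84, 71], [40, 77, 10, 92, 51, 20, 87, 5, 46, 10, 92, 51, 5, 46, 51, 57, 20,
      87, 5, 46, 77, 10, 92, 51, 87, 5, 46, 92, 51, 46, 31, 33, 32, 81, 8, 64, 65, 16, 89, 32, 81,
      8, 16, 89, 8], [1, 95, 4, 89, 16, 0, 0, 0, 0, 0, 0, 0, 0, 0, 0, 40, 17, 63, 68, 58, 0, 0, 0,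
      0, 0, 0, 0, 0, 0, 0, 63, 68, 58, 78, 38, 0, 0, 0, 0, 0, 0, 0, 0, 0, 0], [0, 0, 0, 0, 70, 0, 0,
      0, 62, 0, 0, 66, 0, 64, 65, 0, 0, 0, 0, 53, 0, 0, 0, 22, 0, 0, 86, 0, 54, 70, 0, 0, 0, 0, 6,
      0, 0, 0, 94, 0, 0, 50, 0, 72, 61], [1, 1, 1, 1, 1, 49, 49, 49, 49, 73, 73, 73, 85, 85, 91, 77,
      77, 77, 77, 77, 87, 87, 87, 87, 92, 92, 92, 46, 46, 23, 72, 72, 72, 72, 72, 36, 36, 36, 36,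
      18, 18, 18, 9, 9, 53], [75, 0, 0, 0, 0, 86, 0, 0, 0, 43, 0, 0, 70, 0, 35, 29, 0, 0, 0, 0, 63,
      0, 0, 0, 80, 0, 0, 40, 0, 20, 24, 0, 0, 0, 0, 12, 0, 0, 0, 6, 0, 0, 3, 0, 50], [28, 14, 7, 52,
      26, 69, 83, 90, 45, 28, 14, 7, 69, 83, 28, 66, 33, 65, 81, 89, 31, 64, 32, 16, 66, 33, 65, 31,
      64, 66, 62, 31, 64, 32, 16, 35, 66, 33, 65, 62, 31, 64, 35, 66, 62], [31, 31, 31, 31, 31, 33,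
      33, 33, 33, 32, 32, 32, 81, 81, 8, 69, 69, 69, 69, 69, 14, 14, 14, 14, 90, 90, 90, 52, 52, 71,
      62, 62, 62, 62, 62, 66, 66, 66, 66, 64, 64, 64, 65, 65, 16], [59, 76, 42, 13, 71, 59, 76, 42,
      13, 59, 76, 42, 59, 76, 59, 51, 92, 10, 77, 40, 51, 92, 10, 77, 51, 92, 10, 51, 92, 51, 33,
      31, 35, 27, 43, 33, 31, 35, 27, 33, 31, 35, 33, 31, 33], [21, 59, 78, 39, 68, 38, 19, 58, 29,
      78, 39, 68, 58, 29, 68, 76, 38, 19, 58, 29, 59, 78, 39, 68, 19, 58, 29, 39, 68, 29, 76, 38,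
      19, 58, 29, 59, 78, 39, 68, 19, 58, 29, 39, 68, 29], [77, 10, 92, 51, 23, 20, 87, 5, 46, 77,
      10, 92, 20, 87, 77, 1, 48, 73, 12, 91, 96, 49, 24, 85, 1, 48, 73, 96, 49, 1, 25, 36, 79, 9,
      44, 72, 61, 18, 88, 25, 36, 79, 72, 61, 25], [15, 30, 60, 23, 46, 82, 67, 37, 74, 15, 30, 60,
      82, 67, 15, 62, 27, 54, 11, 22, 35, 70, 43, 86, 62, 27, 54, 35, 70, 62, 51, 5, 10, 20, 40, 46,
      92, 87, 77, 51, 5, 10, 46, 92, 51], [11, 86, 11, 86, 11, 54, 43, 54, 43, 27, 70, 27, 62, 35,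
      31, 2, 95, 2, 95, 2, 1, 96, 1, 96, 49, 48, 49, 73, 24, 85, 30, 67, 30, 67, 30, 15, 82, 15, 82,
      56, 41, 56, 28, 69, 14], [35, 35, 35, 35, 35, 27, 27, 27, 27, 43, 43, 43, 11, 11, 75, 82, 82,
      82, 82, 82, 30, 30, 30, 30, 37, 37, 37, 23, 23, 51, 51, 51, 51, 51, 51, 92, 92, 92, 92, 10,
      10, 10, 77, 77, 40], [0, 0, 0, 0, 58, 0, 0, 0, 29, 0, 0, 63, 0, 80, 40, 0, 0, 0, 0, 40, 0, 0,
      0, 20, 0, 0, 10, 0, 5, 51, 0, 0, 0, 0, 79, 0, 0, 0, 88, 0, 0, 44, 0, 22, 11], [28, 0, 0, 0, 0,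
      41, 0, 0, 0, 15, 0, 0, 67, 0, 60, 51, 0, 0, 0, 0, 92, 0, 0, 0, 10, 0, 0, 77, 0, 40, 49, 0, 0,
      0, 0, 96, 0, 0, 0, 2, 0, 0, 93, 0, 8], [95, 1, 48, 73, 12, 95, 1, 48, 73, 95, 1, 48, 95, 1,
      95, 86, 54, 70, 62, 66, 86, 54, 70, 62, 86, 54, 70, 86, 54, 86, 30, 82, 56, 69, 14, 30, 82,
      56, 69, 30, 82, 56, 30, 82, 30], [92, 5, 92, 5, 92, 10, 87, 10, 87, 77, 20, 77, 40, 57, 17,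
      80, 17, 80, 17, 80, 34, 63, 34, 63, 29, 68, 29, 39, 58, 19, 90, 7, 90, 7, 90, 14, 83, 14, 83,
      69, 28, 69, 56, 41, 82], [80, 63, 29, 58, 19, 80, 63, 29, 58, 80, 63, 29, 80, 63, 80, 92, 87,
      77, 57, 17, 92, 87, 77, 57, 92, 87, 77, 92, 87, 92, 7, 14, 28, 56, 15, 7, 14, 28, 56, 7, 14,
      28, 7, 14, 7], [66, 0, 0, 0, 0, 64, 0, 0, 0, 65, 0, 0, 16, 0, 89, 89, 0, 0, 0, 0, 4, 0, 0, 0,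
      95, 0, 0, 1, 0, 48, 55, 0, 0, 0, 0, 21, 0, 0, 0, 38, 0, 0, 78, 0, 58], [89, 93, 95, 96, 48, 0,
      0, 0, 0, 0, 0, 0, 0, 0, 0, 66, 33, 65, 81, 89, 0, 0, 0, 0, 0, 0, 0, 0, 0, 0, 42, 21, 59, 78,
      39, 0, 0, 0, 0, 0, 0, 0, 0, 0, 0], [61, 79, 88, 44, 22, 79, 88, 44, 22, 88, 44, 22, 44, 22,
      22, 8, 4, 2, 1, 49, 4, 2, 1, 49, 2, 1, 49, 1, 49, 49, 30, 15, 56, 28, 14, 15, 56, 28, 14, 56,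
      28, 14, 28, 14, 14], [75, 53, 9, 18, 36, 44, 88, 79, 61, 9, 18, 36, 79, 61, 36, 22, 44, 88,
      79, 61, 53, 9, 18, 36, 88, 79, 61, 18, 36, 61, 46, 92, 87, 77, 57, 5, 10, 20, 40, 87, 77, 57,
      20, 40, 57], [8, 93, 2, 96, 49, 93, 2, 96, 49, 2, 96, 49, 96, 49, 49, 61, 18, 88, 53, 22, 18,
      88, 53, 22, 88, 53, 22, 53, 22, 22, 67, 15, 41, 28, 83, 15, 41, 28, 83, 41, 28, 83, 28, 83,
      83], [20, 57, 80, 34, 29, 57, 80, 34, 29, 80, 34, 29, 34, 29, 29, 28, 41, 15, 67, 60, 41, 15,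
      67, 60, 15, 67, 60, 67, 60, 60, 5, 87, 20, 57, 80, 87, 20, 57, 80, 20, 57, 80, 57, 80, 80],
      [29, 34, 80, 57, 20, 0, 0, 0, 0, 0, 0, 0, 0, 0, 0, 75, 11, 43, 27, 35, 0, 0, 0, 0, 0, 0, 0, 0,
      0, 0, 73, 12, 91, 3, 47, 0, 0, 0, 0, 0, 0, 0, 0, 0, 0], [46, 51, 46, 51, 46, 92, 5, 92, 5, 87,
      10, 87, 77, 20, 57, 38, 59, 38, 59, 38, 76, 21, 76, 21, 55, 42, 55, 13, 84, 26, 33, 64, 33,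
      64, 33, 66, 31, 66, 31, 35, 62, 35, 70, 27, 43], [31, 64, 32, 16, 8, 31, 64, 32, 16, 31, 64,
      32, 31, 64, 31, 30, 15, 56, 28, 14, 30, 15, 56, 28, 30, 15, 56, 30, 15, 30, 45, 71, 84, 42,
      21, 45, 71, 84, 42, 45, 71, 84, 45, 71, 45], [28, 56, 15, 30, 60, 56, 15, 30, 60, 15, 30, 60,
      30, 60, 60, 20, 40, 80, 63, 29, 40, 80, 63, 29, 80, 63, 29, 63, 29, 29, 92, 87, 77, 57, 17,
      87, 77, 57, 17, 77, 57, 17, 57, 17, 17], [51, 5, 10, 20, 40, 0, 0, 0, 0, 0, 0, 0, 0, 0, 0, 28,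
      56, 15, 30, 60, 0, 0, 0, 0, 0, 0, 0, 0, 0, 0, 48, 96, 95, 93, 89, 0, 0, 0, 0, 0, 0, 0, 0, 0,
      0], [7, 83, 28, 41, 15, 90, 14, 69, 56, 7, 83, 28, 90, 14, 7, 64, 66, 62, 70, 54, 33, 31, 35,
      27, 64, 66, 62, 33, 31, 64, 38, 21, 55, 84, 26, 59, 76, 42, 13, 38, 21, 55, 59, 76, 38], [30,
      67, 30, 67, 30, 82, 15, 82, 15, 56, 41, 56, 69, 28, 14, 31, 66, 31, 66, 31, 33, 64, 33, 64,
      32, 65, 32, 81, 16, 8, 52, 45, 52, 45, 52, 71, 26, 71, 26, 13, 84, 13, 42, 55, 76], [40, 0, 0,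
      0, 0, 80, 0, 0, 0, 63, 0, 0, 29, 0, 58, 1, 0, 0, 0, 0, 2, 0, 0, 0, 4, 0, 0, 8, 0, 16, 34, 0,
      0, 0, 0, 68, 0, 0, 0, 39, 0, 0, 78, 0, 59], [0, 0, 0, 0, 51, 0, 0, 0, 5, 0, 0, 10, 0, 20, 40,
      0, 0, 0, 0, 40, 0, 0, 0, 80, 0, 0, 63, 0, 29, 58, 0, 0, 0, 0, 86, 0, 0, 0, 75, 0, 0, 53, 0, 9,
      18], [0, 0, 0, 0, 27, 0, 0, 0, 43, 0, 0, 11, 0, 75, 44, 0, 0, 0, 0, 32, 0, 0, 0, 33, 0, 0, 31,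
      0, 35, 27, 0, 0, 0, 0, 61, 0, 0, 0, 72, 0, 0, 50, 0, 94, 6], [79, 36, 25, 47, 3, 61, 72, 50,
      94, 25, 47, 3, 50, 94, 3, 18, 61, 72, 50, 94, 36, 25, 47, 3, 72, 50, 94, 47, 3, 94, 45, 7, 83,
      28, 41, 90, 14, 69, 56, 83, 28, 41, 69, 56, 41], [84, 39, 77, 60, 14, 0, 0, 0, 0, 0, 0, 0, 0,
      0, 0, 23, 28, 13, 58, 20, 0, 0, 0, 0, 0, 0, 0, 0, 0, 0, 79, 54, 32, 1, 94, 0, 0, 0, 0, 0, 0,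
      0, 0, 0, 0]]
  B :=
    [[32, 66, 0, 12, 74, 49, 34, 91, 43, 49, 11, 87, 88, 88, 0, 48, 31, 10, 7, 50, 54, 96, 52, 0,
      55, 24, 41, 13, 55, 32, 74, 44, 21, 9, 85, 29, 21, 90, 31, 25, 29, 46, 11, 21, 71], [50, 24,
      2, 37, 70, 35, 74, 24, 15, 65, 65, 24, 24, 86, 55, 28, 57, 47, 25, 46, 60, 25, 95, 61, 39, 60,
      76, 21, 27, 23, 95, 80, 6, 7, 36, 11, 54, 23, 43, 66, 92, 66, 54, 68, 33], [73, 31, 20, 91,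
      11, 7, 83, 0, 6, 71, 89, 35, 64, 80, 41, 64, 76, 90, 90, 26, 77, 77, 7, 19, 27, 24, 12, 5, 33,
      94, 38, 36, 89, 28, 19, 40, 88, 39, 42, 91, 2, 43, 95, 73, 37], [14, 38, 76, 17, 27, 39, 2,
      40, 52, 0, 32, 52, 81, 86, 43, 7, 71, 92, 49, 77, 28, 66, 18, 85, 28, 57, 76, 41, 22, 30, 8,
      73, 94, 28, 34, 94, 22, 71, 37, 60, 61, 1, 84, 13, 49], [26, 65, 31, 19, 36, 17, 96, 72, 10,
      49, 40, 65, 42, 92, 65, 42, 67, 80, 59, 23, 36, 40, 25, 18, 85, 20, 39, 24, 52, 7, 5, 59, 16,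
      53, 58, 9, 78, 75, 85, 58, 53, 63, 0, 0, 59], [21, 54, 80, 47, 6, 71, 82, 1, 42, 66, 21, 94,
      47, 29, 43, 19, 31, 78, 32, 9, 35, 20, 36, 11, 60, 47, 39, 38, 65, 75, 55, 54, 0, 84, 7, 28,
      76, 0, 92, 40, 47, 54, 20, 83, 74], [13, 51, 67, 26, 45, 92, 34, 37, 73, 92, 57, 89, 68, 32,
      20, 89, 29, 33, 7, 34, 65, 14, 91, 6, 60, 27, 12, 12, 8, 96, 15, 23, 50, 66, 43, 10, 34, 49,
      44, 17, 28, 19, 82, 75, 37], [32, 78, 31, 40, 13, 7, 13, 88, 52, 37, 58, 95, 33, 38, 39, 56,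
      70, 74, 54, 24, 14, 30, 9, 3, 30, 16, 13, 32, 78, 8, 18, 1, 13, 41, 26, 14, 16, 50, 40, 90,
      14, 22, 34, 62, 54], [78, 36, 94, 42, 64, 43, 50, 44, 51, 87, 6, 75, 57, 28, 47, 22, 42, 77,
      75, 74, 51, 4, 25, 59, 18, 56, 3, 13, 93, 73, 12, 83, 65, 32, 68, 88, 2, 28, 21, 31, 60, 77,
      96, 21, 49], [9, 94, 38, 7, 2, 7, 33, 81, 9, 54, 46, 58, 83, 68, 42, 49, 67, 14, 70, 59, 11,
      87, 17, 56, 86, 73, 80, 88, 28, 75, 4, 46, 0, 52, 54, 59, 51, 66, 56, 40, 89, 81, 25, 2, 83],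
      [85, 8, 83, 72, 78, 15, 6, 40, 16, 96, 88, 22, 30, 34, 16, 76, 9, 16, 95, 73, 32, 61, 31, 60,
      2, 14, 55, 1, 17, 96, 86, 16, 57, 56, 68, 75, 78, 31, 63, 52, 6, 54, 46, 11, 5], [59, 41, 70,
      14, 68, 32, 54, 6, 71, 69, 85, 87, 19, 25, 31, 92, 2, 2, 88, 9, 82, 52, 67, 50, 49, 81, 27,
      37, 75, 70, 6, 5, 32, 76, 54, 0, 22, 42, 57, 32, 26, 7, 96, 87, 34], [39, 88, 40, 28, 1, 16,
      1, 33, 47, 24, 21, 62, 48, 80, 81, 31, 30, 44, 32, 88, 84, 6, 8, 86, 86, 62, 39, 84, 33, 83,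
      16, 13, 14, 9, 60, 55, 95, 86, 63, 58, 19, 84, 45, 65, 84], [74, 1, 56, 83, 17, 58, 75, 81,
      83, 87, 5, 20, 94, 94, 73, 86, 96, 78, 2, 72, 91, 44, 72, 37, 96, 10, 58, 9, 6, 5, 8, 28, 20,
      93, 93, 22, 75, 49, 78, 21, 30, 27, 69, 36, 61], [7, 20, 24, 22, 40, 35, 32, 0, 79, 91, 20,
      30, 4, 23, 89, 63, 64, 3, 45, 29, 82, 67, 29, 90, 94, 20, 74, 71, 8, 13, 25, 45, 29, 66, 95,
      84, 49, 37, 47, 43, 63, 93, 16, 28, 88], [19, 17, 85, 12, 26, 63, 46, 77, 23, 40, 43, 87, 68,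
      95, 37, 85, 20, 40, 27, 16, 45, 62, 96, 39, 46, 57, 8, 90, 75, 72, 86, 4, 52, 2, 74, 51, 87,
      51, 51, 3, 94, 2, 11, 62, 71], [2, 78, 93, 50, 56, 76, 36, 46, 27, 88, 60, 90, 67, 19, 52, 76,
      82, 86, 48, 3, 76, 89, 51, 19, 51, 14, 94, 57, 34, 63, 3, 2, 57, 62, 9, 34, 61, 67, 33, 92,
      66, 53, 67, 73, 23], [11, 31, 53, 7, 65, 51, 18, 37, 89, 76, 7, 80, 73, 61, 49, 56, 10, 95,
      80, 33, 35, 61, 93, 46, 13, 14, 42, 17, 2, 76, 15, 45, 8, 59, 94, 54, 43, 76, 73, 45, 31, 5,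
      47, 80, 83], [62, 76, 22, 69, 29, 78, 34, 67, 38, 28, 71, 93, 83, 45, 37, 87, 56, 19, 31, 47,
      36, 32, 85, 85, 34, 50, 43, 95, 79, 70, 33, 28, 35, 60, 26, 26, 50, 34, 46, 55, 83, 17, 13,
      72, 13], [89, 24, 31, 22, 36, 50, 25, 82, 89, 48, 38, 3, 40, 51, 0, 71, 57, 74, 9, 24, 60, 62,
      73, 38, 72, 87, 7, 91, 85, 92, 8, 63, 56, 38, 88, 52, 22, 89, 37, 75, 45, 49, 86, 94, 88],
      [14, 33, 84, 60, 67, 30, 34, 8, 14, 25, 75, 59, 86, 35, 65, 92, 76, 6, 59, 3, 54, 24, 87, 13,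
      75, 4, 54, 51, 95, 60, 22, 31, 4, 66, 0, 64, 33, 0, 25, 53, 59, 43, 29, 95, 64], [45, 3, 92,
      26, 93, 47, 9, 82, 33, 91, 23, 77, 6, 63, 40, 12, 65, 60, 69, 43, 29, 23, 15, 88, 24, 34, 5,
      44, 73, 13, 11, 9, 16, 35, 79, 77, 68, 64, 84, 47, 62, 95, 70, 27, 37], [9, 64, 15, 25, 44,
      74, 90, 65, 25, 87, 34, 35, 10, 65, 14, 51, 77, 48, 59, 90, 66, 5, 75, 45, 96, 60, 65, 83, 93,
      64, 72, 18, 66, 39, 18, 50, 90, 58, 90, 17, 66, 34, 11, 68, 92], [19, 50, 71, 83, 65, 87, 60,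
      52, 52, 81, 27, 7, 79, 33, 69, 82, 30, 36, 17, 29, 35, 1, 44, 53, 40, 13, 55, 47, 65, 22, 27,
      11, 6, 57, 27, 57, 89, 33, 12, 83, 8, 55, 56, 64, 61], [82, 66, 44, 91, 73, 10, 59, 94, 31,
      15, 94, 64, 89, 25, 65, 88, 89, 3, 65, 77, 62, 31, 39, 78, 12, 34, 2, 69, 66, 26, 85, 7, 70,
      83, 32, 54, 10, 77, 17, 77, 94, 11, 27, 29, 37], [26, 85, 78, 57, 18, 18, 72, 81, 18, 95, 30,
      51, 13, 63, 46, 29, 65, 51, 94, 91, 81, 85, 52, 53, 65, 65, 3, 32, 52, 87, 22, 1, 26, 52, 12,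
      61, 42, 88, 84, 29, 92, 14, 15, 18, 43], [31, 53, 47, 14, 56, 65, 77, 70, 60, 31, 45, 37, 53,
      68, 58, 22, 40, 52, 54, 3, 59, 46, 61, 49, 26, 21, 87, 74, 38, 43, 31, 32, 71, 33, 92, 95, 80,
      43, 68, 34, 66, 13, 46, 88, 34], [84, 26, 68, 80, 6, 49, 48, 66, 30, 67, 40, 15, 10, 52, 59,
      95, 64, 37, 54, 1, 15, 12, 41, 53, 15, 81, 77, 85, 46, 32, 26, 59, 70, 28, 4, 86, 8, 82, 75,
      51, 61, 37, 80, 9, 48], [46, 11, 77, 42, 89, 52, 67, 35, 51, 40, 56, 70, 16, 49, 23, 95, 96,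
      75, 19, 61, 92, 88, 35, 1, 59, 40, 19, 83, 23, 75, 67, 81, 7, 11, 25, 79, 60, 86, 21, 40, 10,
      67, 91, 80, 49], [56, 87, 81, 19, 14, 46, 46, 43, 36, 96, 66, 91, 81, 22, 30, 7, 88, 8, 20,
      64, 91, 81, 54, 90, 43, 40, 19, 36, 40, 85, 5, 78, 86, 26, 79, 96, 8, 3, 59, 68, 27, 34, 26,
      84, 59], [31, 96, 73, 0, 1, 28, 24, 69, 57, 79, 64, 0, 57, 14, 74, 74, 75, 60, 40, 29, 79, 29,
      88, 78, 79, 66, 31, 57, 40, 80, 24, 17, 62, 83, 75, 44, 35, 19, 40, 53, 33, 9, 0, 82, 0], [38,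
      49, 90, 42, 16, 43, 74, 92, 24, 0, 68, 44, 13, 34, 10, 8, 9, 88, 42, 61, 7, 51, 78, 42, 76, 0,
      40, 8, 50, 29, 72, 61, 78, 73, 78, 53, 55, 75, 64, 35, 68, 3, 63, 4, 85], [41, 77, 86, 0, 73,
      86, 35, 51, 35, 0, 38, 32, 35, 39, 49, 9, 7, 75, 44, 86, 68, 85, 32, 34, 17, 13, 94, 63, 20,
      77, 49, 94, 95, 4, 58, 79, 28, 27, 79, 72, 38, 88, 90, 86, 48], [58, 23, 31, 26, 84, 71, 83,
      5, 48, 88, 46, 91, 35, 17, 92, 83, 62, 94, 13, 23, 36, 58, 20, 6, 91, 60, 53, 5, 0, 82, 50,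
      21, 67, 65, 69, 6, 93, 44, 25, 88, 15, 84, 90, 36, 90], [22, 16, 2, 46, 43, 37, 49, 11, 23,
      31, 52, 28, 49, 24, 2, 59, 23, 22, 44, 55, 57, 66, 39, 17, 67, 1, 36, 92, 14, 31, 67, 27, 64,
      33, 76, 52, 12, 25, 87, 28, 29, 59, 34, 71, 82], [90, 27, 8, 42, 38, 94, 59, 41, 23, 56, 67,
      27, 3, 53, 76, 74, 60, 47, 52, 38, 0, 28, 41, 44, 69, 25, 15, 96, 59, 59, 69, 31, 32, 54, 32,
      47, 4, 73, 65, 41, 69, 40, 46, 94, 85], [52, 46, 87, 0, 51, 90, 10, 7, 78, 85, 32, 66, 75, 30,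
      91, 91, 49, 62, 22, 9, 32, 9, 71, 84, 32, 34, 63, 69, 28, 16, 89, 81, 25, 67, 49, 68, 72, 13,
      19, 29, 65, 26, 66, 12, 0], [21, 71, 89, 92, 34, 46, 26, 50, 36, 96, 24, 51, 53, 25, 21, 37,
      41, 21, 34, 17, 66, 24, 70, 14, 19, 91, 42, 22, 63, 89, 64, 3, 41, 32, 14, 75, 50, 92, 82, 32,
      82, 22, 96, 77, 3], [96, 14, 89, 80, 36, 48, 69, 55, 40, 79, 23, 16, 14, 53, 16, 73, 77, 39,
      20, 34, 6, 50, 51, 47, 2, 42, 92, 85, 77, 56, 63, 31, 38, 35, 70, 91, 13, 44, 33, 13, 38, 92,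
      45, 35, 72], [68, 68, 89, 0, 73, 54, 81, 3, 48, 30, 55, 62, 91, 13, 54, 94, 28, 33, 24, 53,
      30, 54, 64, 43, 81, 40, 47, 67, 44, 92, 31, 28, 74, 41, 74, 73, 94, 90, 32, 67, 63, 10, 4, 90,
      49], [44, 7, 91, 92, 1, 1, 24, 95, 68, 84, 58, 27, 68, 37, 39, 55, 0, 18, 19, 75, 59, 82, 61,
      27, 12, 70, 63, 3, 82, 52, 22, 40, 80, 20, 70, 29, 11, 79, 50, 78, 48, 31, 72, 44, 3], [55,
      25, 37, 0, 72, 2, 60, 95, 21, 70, 2, 26, 78, 46, 9, 9, 61, 12, 19, 27, 2, 27, 48, 68, 2, 55,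
      42, 45, 52, 85, 49, 12, 10, 51, 61, 63, 87, 29, 76, 34, 95, 49, 26, 62, 0], [49, 50, 93, 26,
      57, 87, 21, 86, 90, 74, 71, 11, 63, 21, 63, 54, 60, 9, 82, 2, 18, 37, 90, 34, 73, 20, 93, 43,
      59, 36, 8, 67, 23, 61, 67, 95, 40, 16, 80, 96, 87, 14, 10, 5, 90], [88, 30, 20, 17, 17, 54,
      16, 37, 12, 27, 53, 3, 37, 39, 92, 35, 25, 73, 26, 2, 70, 83, 39, 61, 74, 12, 48, 5, 27, 54,
      36, 53, 43, 67, 32, 59, 3, 42, 12, 31, 80, 12, 71, 41, 25], [56, 16, 82, 51, 22, 35, 61, 14,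
      37, 58, 45, 67, 29, 89, 51, 91, 49, 23, 72, 76, 69, 65, 39, 38, 59, 7, 53, 74, 14, 24, 12, 15,
      41, 48, 93, 54, 77, 17, 47, 60, 68, 57, 61, 94, 15]]

theorem generic223NoSyzygies_valid : generic223NoSyzygies.Valid (List.ofFn generic223) 4 where
  prime := by norm_num [generic223NoSyzygies]
  length := by decide +kernel
  rows := by decide +kernel
  inverse := by decide +kernel

/-- Independent syzygies of degree 5 of `generic223`. -/
def generic223Syzygies : Independence 4 where
  ρ :=
    ![![[[1400, -3000, -1824, 480, 256], [2625, 1407, -60, -60], [-2194, 1770, 1084], [-1815, -897,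
      -60], [828], [60]], [[0, -375, -169, -60, -28], [0, 582, -270, -228], [-224, 1185, 615, -60],
      [-480, -804], [256, 60]], [[-375, -169, -60, -28], [806, -750, -484], [1185, 423, 420, 256],
      [-996, 0, -32], [-420, -32], [256]]], ![[[0, 0, 224, -480, -256], [-375, -582, 1185, 804, 60],
      [169, -270, -615], [-60, 228, -60], [28]], [[-1400, 2625, 2194, -1815, -828, 60], [-3000,
      -1407, 1770, 897], [1824, -60, -1084, -60], [480, 60], [-256]], [[-375, -806, 1185, 996, -420,
      -256], [169, -750, -423, 0, 32], [-60, 484, 420, 32], [28, 0, -256]]], ![[[-1400, -5600, -952,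
      -8, 448, 288], [-3000, 1011, 2836, 204, -308], [3113, 3811, -2029, 237], [1417, 285, -901],
      [-680, -600], [-116]], [[-1400, -5600, -637, 2932, 580, -84], [-200, -4239, -309, 2715, -475],
      [8048, 2521, -3619, 51], [-2688, 24, 1288], [-1472, 108], [512]], [[0, -637, -2668, -596, 812,
      224], [113, -2301, -2309, 165, 992], [-1583, 3181, 3003, -224], [1144, 264, -1184], [364,
      -448], [-256]]], ![[[1400, -200, -8048, -2688, 1472, 512], [-5600, 4239, 2521, -24, 108],
      [637, -309, 3619, 1288], [2932, -2715, 51], [-580, -475], [-84]], [[1400, -3000, -3113, 1417,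
      680, -116], [-5600, -1011, 3811, -285, -600], [952, 2836, 2029, -901], [-8, -204, 237], [-448,
      -308], [288]], [[0, -113, -1583, -1144, 364, 256], [637, -2301, -3181, 264, 448], [-2668,
      2309, 3003, 1184], [596, 165, 224], [812, -992], [-224]]]]
  idx := ![0, 1, 0, 1]
  pts := ![![-1, 0, 0], ![-1, 0, 0], ![0, -1, 0], ![0, -1, 0]]
  p := 97
  A := [[37, 0, 0, 0], [0, 0, 0, 37], [19, 70, 3, 84], [84, 3, 70, 19]]
  B := [[21, 0, 0, 0], [89, 86, 23, 78], [86, 89, 78, 23], [0, 21, 0, 0]]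

theorem generic223Syzygies_valid : generic223Syzygies.Valid generic223Grad 5 where
  syzygy := by decide +kernel
  prime := by norm_num [generic223Syzygies]
  rows := by decide +kernel
  inverse := by decide +kernel

theorem generic223_not_hasThreeGenerators : ¬ HasThreeGenerators (arrangement generic223) := by
  rw [← prodPoly_ofFn]
  exact not_hasThreeGenerators_of_independence generic223_grad generic223NoSyzygies_valid generic223Syzygies_valid

end Arrangements

/-! ## The strong Ziegler pairs -/

/-- Two arrangements with the same singular points form a strong Ziegler pair, if the syzygies of
exactly one of them are generated by three elements. -/
theorem existsStrongZieglerPair {n N d : ℕ} {deg : Fin n → ℕ} {T : Fin N → PointType n}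
    {c c' : Fin n → PlaneForm} {pt pt' : Fin N → Fin 3 → ℤ} {meetings meetings' : List (Meeting N)}
    (h : Realizes deg T c pt meetings) (h' : Realizes deg T c' pt' meetings')
    (hd : ∑ i, deg i = d) (hpos : 0 < d) {Cmb : PolyS → Prop} (hc : Cmb (arrangement c))
    (hc' : Cmb (arrangement c'))
    (h3 : IsReducedCurve d (arrangement c) → HasThreeGenerators (arrangement c))
    (h3' : ¬ HasThreeGenerators (arrangement c')) : ExistsStrongZieglerPair d Cmb := by
  subst hd
  have ha := h.isConicLineArrangement hpos
  exact ⟨_, _, ha, h'.isConicLineArrangement hpos, hc, hc',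
    h.isStrongZieglerPair h' hpos (h3 ha.toIsReducedCurve) h3'⟩

theorem mainTheorem1 :
    (ExistsStrongZieglerPair 7 HasCmb123 ∧ ExistsStrongZieglerPair 7 HasCmb124 ∧
      ExistsStrongZieglerPair 7 HasCmb212 ∧ ExistsStrongZieglerPair 7 HasCmb224) ∧
    ExistsStrongZieglerPair 8 HasCmb223PlusBitangent := by
  refine ⟨⟨?_, ?_, ?_, ?_⟩, ?_⟩
  · exact existsStrongZieglerPair special123_realizes generic123_realizes rfl (by decide)
      special123_realizes.hasCmb123 generic123_realizes.hasCmb123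
      special123_hasThreeGenerators generic123_not_hasThreeGenerators
  · exact existsStrongZieglerPair special124_realizes generic124_realizes rfl (by decide)
      special124_realizes.hasCmb124 generic124_realizes.hasCmb124
      special124_hasThreeGenerators generic124_not_hasThreeGenerators
  · exact existsStrongZieglerPair special212_realizes generic212_realizes rfl (by decide)
      special212_realizes.hasCmb212 generic212_realizes.hasCmb212
      special212_hasThreeGenerators generic212_not_hasThreeGenerators
  · exact existsStrongZieglerPair special224_realizes generic224_realizes rfl (by decide)
      special224_realizes.hasCmb224 generic224_realizes.hasCmb224
      special224_hasThreeGenerators generic224_not_hasThreeGenerators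
  · exact existsStrongZieglerPair special223_realizes generic223_realizes rfl (by decide)
      (special223_realizes.hasCmb223PlusBitangent special223_bitangents rfl rfl)
      (generic223_realizes.hasCmb223PlusBitangent generic223_bitangents rfl rfl)
      special223_hasThreeGenerators generic223_not_hasThreeGenerators
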